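/- Let an orthogonal polygon be a compact region $P\subset\mathbb{R}^2$ that is the closure of its interior, has connected interior, and whose boundary consists of finitely many pairwise disjoint simple closed polygonal curves with edges alternately horizontal and vertical (so $P$ may have holes); its vertices are the corners of these curves. The vertical (horizontal) segmentation of $P$ is obtained by extending a vertical (horizontal) ray inward from every reflex vertex of $P$ until it hits the boundary again; the rectangles of the resulting partition are called slices. The weak dual of a segmentation is the graph whose vertices are the slices, two slices being adjacent if and only if they share (part of) a side. $P$ has a path-segmentation if the weak dual of its vertical segmentation or that of its horizontal segmentation is a path (possibly a single vertex). A sliding camera in $P$ is a horizontal or vertical line segment $\gamma\subseteq P$; it sees a point $p\in P$ if there is a point $g\in\gamma$ such that the segment $pg$ is perpendicular to $\gamma$ (or $g=p$) and lies in $P$. A set of sliding cameras guards $P$ if every point of $P$ is seen by at least one of them. **Theorem.** (i) Every orthogonal polygon with $n$ vertices that has a path-segmentation can be guarded with at most $\lfloor (n+2)/6\rfloor$ sliding cameras. (ii) The bound is tight: for every even $n\ge 4$ there is an orthogonal polygon with $n$ vertices that has a path-segmentation and cannot be guarded with fewer than $\lfloor (n+2)/6\rfloor$ sliding cameras. -/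

import Mathlib

open Set Topology

/-- A simple closed orthogonal polygonal curve in the plane, given by its cyclic sequence of
vertices (indices are taken modulo `len`). Every edge is a nondegenerate horizontal or vertical
segment, consecutive edges are perpendicular (so every vertex is a genuine corner), and
non-consecutive edges are disjoint. Consecutive edges, being perpendicular, meet only in
their common endpoint. -/
structure OrthogonalCycle where
  len : ℕ
  [len_ne_zero : NeZero len]
  vertex : Fin len → ℝ × ℝ
  vertex_ne : ∀ i, vertex i ≠ vertex (i + 1)
  axisParallel : ∀ i, (vertex i).1 = (vertex (i + 1)).1 ∨ (vertex i).2 = (vertex (i + 1)).2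
  alternating : ∀ i, (vertex i).1 = (vertex (i + 1)).1 ↔
    (vertex (i + 1)).2 = (vertex (i + 1 + 1)).2
  simple : ∀ i j, i ≠ j → j ≠ i + 1 → i ≠ j + 1 →
    Disjoint (segment ℝ (vertex i) (vertex (i + 1))) (segment ℝ (vertex j) (vertex (j + 1)))

attribute [instance] OrthogonalCycle.len_ne_zero

namespace OrthogonalCycle

/-- The curve: the union of all edges. -/
def curve (c : OrthogonalCycle) : Set (ℝ × ℝ) :=
  ⋃ i, segment ℝ (c.vertex i) (c.vertex (i + 1))

end OrthogonalCycle

/-- An orthogonal polygon, possibly with holes: a compact region of the plane which is the closure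
of its interior, whose interior is connected, and whose boundary consists of finitely many
pairwise disjoint simple closed orthogonal polygonal curves. With exactly one boundary curve `C`,
the region is the curve `C` together with its inside, that is, a simple orthogonal polygon. -/
structure OrthogonalPolygon where
  numCycles : ℕ
  cycle : Fin numCycles → OrthogonalCycle
  cycles_disjoint : ∀ i j, i ≠ j → Disjoint (cycle i).curve (cycle j).curve
  region : Set (ℝ × ℝ)
  isCompact_region : IsCompact region
  closure_interior_region : closure (interior region) = region
  isConnected_interior : IsConnected (interior region)
  frontier_region : frontier region = ⋃ i, (cycle i).curve

namespace OrthogonalPolygon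

/-- The number of vertices. -/
def numVertices (P : OrthogonalPolygon) : ℕ :=
  ∑ c, (P.cycle c).len

/-- The point `v` is a reflex vertex of `P`: it is a vertex, with neighbours `u` and `w` on its
boundary curve, and the right angle spanned by the edges `vu` and `vw` lies outside `P` near `v`,
so that the interior angle of `P` at `v` is three right angles. -/
def IsReflexVertex (P : OrthogonalPolygon) (v : ℝ × ℝ) : Prop :=
  ∃ (c : Fin P.numCycles) (i : Fin (P.cycle c).len), (P.cycle c).vertex i = v ∧
    ∀ᶠ t : ℝ in 𝓝[>] 0,
      v + t • ((P.cycle c).vertex (i - 1) - v) + t • ((P.cycle c).vertex (i + 1) - v) ∉ P.region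

/-- The points on the cuts of a segmentation. For `coord = Prod.fst` these are the vertical rays
from all reflex vertices inward, each up to the first point where it hits the boundary again;
for `coord = Prod.snd` these are the horizontal ones. -/
def cuts (P : OrthogonalPolygon) (coord : ℝ × ℝ → ℝ) : Set (ℝ × ℝ) :=
  {q | q ∈ interior P.region ∧ ∃ v, P.IsReflexVertex v ∧ coord v = coord q ∧
    openSegment ℝ v q ⊆ interior P.region}

/-- The slices of the vertical (`coord = Prod.fst`) or horizontal (`coord = Prod.snd`)
segmentation: the closed pieces into which the cuts partition the polygon. -/
def slices (P : OrthogonalPolygon) (coord : ℝ × ℝ → ℝ) : Set (Set (ℝ × ℝ)) :=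
  {s | ∃ p ∈ interior P.region \ P.cuts coord,
    s = closure (connectedComponentIn (interior P.region \ P.cuts coord) p)}

/-- The weak dual graph of a segmentation: its vertices are the slices, and two different slices
are adjacent if they share (part of) a side, i.e. a nondegenerate segment. -/
def weakDual (P : OrthogonalPolygon) (coord : ℝ × ℝ → ℝ) :
    SimpleGraph {s : Set (ℝ × ℝ) // s ∈ P.slices coord} where
  Adj s t := s ≠ t ∧ ∃ a b : ℝ × ℝ, a ≠ b ∧ segment ℝ a b ⊆ s.1 ∩ t.1
  symm := ⟨fun s t ⟨hne, a, b, hab, h⟩ => ⟨hne.symm, a, b, hab, by rwa [inter_comm]⟩⟩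
  loopless := ⟨fun _ h => h.1 rfl⟩

/-- `P` has a path-segmentation: the weak dual of its vertical or of its horizontal segmentation
is a path (a single vertex counts as a path). -/
def HasPathSegmentation (P : OrthogonalPolygon) : Prop :=
  (∃ m : ℕ, Nonempty (P.weakDual Prod.fst ≃g SimpleGraph.pathGraph m)) ∨
    (∃ m : ℕ, Nonempty (P.weakDual Prod.snd ≃g SimpleGraph.pathGraph m))

/-- A sliding camera in `P`: a horizontal or vertical line segment inside `P`. -/
structure SlidingCamera (P : OrthogonalPolygon) where
  a : ℝ × ℝ
  b : ℝ × ℝ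
  ne : a ≠ b
  axisParallel : a.1 = b.1 ∨ a.2 = b.2
  subset_region : segment ℝ a b ⊆ P.region

/-- The camera `γ` sees the point `p`: for some point `g` of `γ`, the segment `pg` is perpendicular
to `γ` and lies inside `P`. -/
def SlidingCamera.Sees {P : OrthogonalPolygon} (γ : P.SlidingCamera) (p : ℝ × ℝ) : Prop :=
  ∃ g ∈ segment ℝ γ.a γ.b,
    (γ.b.1 - γ.a.1) * (g.1 - p.1) + (γ.b.2 - γ.a.2) * (g.2 - p.2) = 0 ∧
      segment ℝ p g ⊆ P.region

/-- The whole polygon `P` can be guarded with (at most) `k` sliding cameras. -/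
def GuardableWith (P : OrthogonalPolygon) (k : ℕ) : Prop :=
  ∃ S : Finset P.SlidingCamera, S.card ≤ k ∧ ∀ p ∈ P.region, ∃ γ ∈ S, γ.Sees p

end OrthogonalPolygon

/-! Upper bound. Reflection at the diagonal reduces to the vertical segmentation. Its slices are
closed rectangles (`exists_isCell`), and a path-shaped weak dual lists them as a sequence of `m`
rectangles (`exists_isVerticalPath`) in which consecutive ones share part of a vertical side. Such a
shared side has at most one end at which both slices have a corner, because the two height ranges
are not equal (`IsCell.side_of_segment_subset`). Let `t` be the number of shared sides with such a
common end.

A vertex is a corner of at most one slice, and a slice corner that is not a vertex lies at a common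
end, where two slice corners coincide. Counting the `4m` slice corners gives `4m ≤ n + 2t`
(`corner_count`). On the other side, any two consecutive slices are seen by one horizontal camera,
and three consecutive slices are seen by one camera when both sides between them have a common end
(`guards_three_slices`). Give each shared side weight 2, or 1 if it has a common end. The greedy
choice of groups of three or two slices uses up weight at least 3 whenever slices remain after a
group, so `1 + ⌊(2(m - 1) - t)/3⌋` cameras suffice (`guards_tail`). This equals `⌊(4m - 2t + 2)/6⌋ ≤
⌊(n + 2)/6⌋`.

Lower bound. A diagonal staircase of `m` overlapping bricks, alternately 7 by 3 and 3 by 7, has `2m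
+ 2` vertices, and its vertical segmentation is a path of `m` slices
(`Staircase.hasPathSegmentation`). There is one witness point per brick, and no sliding camera sees
two witnesses whose indices differ by 3 or more (`Staircase.not_sees`). The witnesses with indices
0, 3, 6, ... therefore need `⌊(m + 2)/3⌋ = ⌊(n + 2)/6⌋` different cameras. -/

/-! ### Axis-parallel segments and connectedness relative to a frontier -/

theorem mem_segment_vertical {x y₁ y₂ : ℝ} {q : ℝ × ℝ} :
    q ∈ segment ℝ (x, y₁) (x, y₂) ↔ q.1 = x ∧ q.2 ∈ uIcc y₁ y₂ := by
  rw [← Prod.image_mk_segment_right, segment_eq_uIcc]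
  constructor
  · rintro ⟨y, hy, rfl⟩
    exact ⟨rfl, hy⟩
  · rintro ⟨rfl, hy⟩
    exact ⟨q.2, hy, rfl⟩

theorem mem_segment_horizontal {x₁ x₂ y : ℝ} {q : ℝ × ℝ} :
    q ∈ segment ℝ (x₁, y) (x₂, y) ↔ q.2 = y ∧ q.1 ∈ uIcc x₁ x₂ := by
  rw [← Prod.image_mk_segment_left, segment_eq_uIcc]
  constructor
  · rintro ⟨x, hx, rfl⟩
    exact ⟨rfl, hx⟩
  · rintro ⟨rfl, hx⟩
    exact ⟨q.1, hx, rfl⟩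

theorem mem_segment_of_fst_eq {u v q : ℝ × ℝ} (h : u.1 = v.1) :
    q ∈ segment ℝ u v ↔ q.1 = u.1 ∧ q.2 ∈ uIcc u.2 v.2 := by
  obtain ⟨a, b⟩ := u
  obtain ⟨c, d⟩ := v
  obtain rfl : a = c := h
  exact mem_segment_vertical

theorem mem_segment_of_snd_eq {u v q : ℝ × ℝ} (h : u.2 = v.2) :
    q ∈ segment ℝ u v ↔ q.2 = u.2 ∧ q.1 ∈ uIcc u.1 v.1 := by
  obtain ⟨a, b⟩ := u
  obtain ⟨c, d⟩ := v
  obtain rfl : b = d := h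
  exact mem_segment_horizontal

/-- A preconnected set that avoids the frontier of `K` and meets its interior lies inside. -/
theorem IsPreconnected.subset_interior_of_disjoint_frontier {X : Type*} [TopologicalSpace X]
    {S K : Set X} (hS : IsPreconnected S) (hK : IsClosed K) (hd : ∀ q ∈ S, q ∉ frontier K)
    (hne : (S ∩ interior K).Nonempty) : S ⊆ interior K := by
  refine hS.subset_left_of_subset_union isOpen_interior hK.isOpen_compl ?_ ?_ hne
  · exact disjoint_compl_right.mono_left interior_subset
  · intro q hq
    by_cases hqK : q ∈ K
    · left
      by_contra h
      exact hd q hq (by rw [hK.frontier_eq]; exact ⟨hqK, h⟩)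
    · exact Or.inr hqK

theorem mem_ball_prod_iff {p q : ℝ × ℝ} {ε : ℝ} :
    q ∈ Metric.ball p ε ↔ |q.1 - p.1| < ε ∧ |q.2 - p.2| < ε := by
  rw [Metric.mem_ball, Prod.dist_eq, max_lt_iff, Real.dist_eq, Real.dist_eq]

/-! ### Incidence of vertices and edges on one boundary curve -/

namespace OrthogonalCycle

variable (c : OrthogonalCycle)

/-- The edge of the curve starting at the vertex with index `i`. -/
def edge (i : Fin c.len) : Set (ℝ × ℝ) := segment ℝ (c.vertex i) (c.vertex (i + 1))

theorem isClosed_edge (i : Fin c.len) : IsClosed (c.edge i) := by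
  rw [edge, ← convexHull_pair]
  exact ((Set.toFinite _).isCompact_convexHull (𝕜 := ℝ)).isClosed

variable {c}

theorem vertex_mem_edge (i : Fin c.len) : c.vertex i ∈ c.edge i := left_mem_segment _ _ _

theorem eq_vertex_of_mem_edge_of_mem_edge_succ {i : Fin c.len} {p : ℝ × ℝ}
    (h₁ : p ∈ c.edge i) (h₂ : p ∈ c.edge (i + 1)) : p = c.vertex (i + 1) := by
  unfold edge at h₁ h₂
  by_cases h : (c.vertex i).1 = (c.vertex (i + 1)).1
  · have h' := (c.alternating i).1 h
    rw [mem_segment_of_fst_eq h] at h₁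
    rw [mem_segment_of_snd_eq h'] at h₂
    exact Prod.ext (h₁.1.trans h) h₂.1
  · have h' := (c.axisParallel i).resolve_left h
    have h'' := (c.axisParallel (i + 1)).resolve_right (fun e => h ((c.alternating i).2 e))
    rw [mem_segment_of_snd_eq h'] at h₁
    rw [mem_segment_of_fst_eq h''] at h₂
    exact Prod.ext h₂.1 (h₁.1.trans h')

theorem eq_vertex_of_mem_edges {i j : Fin c.len} {p : ℝ × ℝ} (hij : i ≠ j)
    (h₁ : p ∈ c.edge i) (h₂ : p ∈ c.edge j) :
    (j = i + 1 ∧ p = c.vertex (i + 1)) ∨ (i = j + 1 ∧ p = c.vertex (j + 1)) := by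
  by_cases h : j = i + 1
  · subst h
    exact Or.inl ⟨rfl, eq_vertex_of_mem_edge_of_mem_edge_succ h₁ h₂⟩
  by_cases h' : i = j + 1
  · subst h'
    exact Or.inr ⟨rfl, eq_vertex_of_mem_edge_of_mem_edge_succ h₂ h₁⟩
  exact absurd h₂ (Set.disjoint_left.1 (c.simple i j hij h h') h₁)

theorem eq_or_eq_of_vertex_mem_edge {i j : Fin c.len} (h : c.vertex i ∈ c.edge j) :
    j = i ∨ j = i - 1 := by
  by_cases hij : i = j
  · exact Or.inl hij.symm
  rcases eq_vertex_of_mem_edges hij (vertex_mem_edge i) h with ⟨-, h'⟩ | ⟨h', -⟩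
  · exact absurd h' (c.vertex_ne i)
  · right
    rw [h', add_sub_cancel_right]

end OrthogonalCycle

/-! ### Local shape of the boundary -/

namespace OrthogonalPolygon

variable (P : OrthogonalPolygon)

/-- The set of vertices. -/
def vertices : Set (ℝ × ℝ) := {v | ∃ c i, (P.cycle c).vertex i = v}

theorem finite_vertices : P.vertices.Finite := by
  have : P.vertices = Set.range (fun x : Σ c, Fin (P.cycle c).len => (P.cycle x.1).vertex x.2) := by
    ext v
    simp [vertices]
  rw [this]
  exact Set.finite_range _

theorem ncard_vertices_le : P.vertices.ncard ≤ P.numVertices := by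
  have : P.vertices = Set.range (fun x : Σ c, Fin (P.cycle c).len => (P.cycle x.1).vertex x.2) := by
    ext v
    simp [vertices]
  rw [this, ← Set.image_univ]
  refine (Set.ncard_image_le (Set.toFinite _)).trans ?_
  rw [Set.ncard_univ, Nat.card_eq_fintype_card, Fintype.card_sigma, numVertices]
  simp

variable {P}

theorem isClosed_region : IsClosed P.region := P.isCompact_region.isClosed

theorem IsReflexVertex.mem_vertices {v : ℝ × ℝ} (h : P.IsReflexVertex v) : v ∈ P.vertices := by
  obtain ⟨c, i, h, -⟩ := h
  exact ⟨c, i, h⟩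

theorem mem_frontier_iff {p : ℝ × ℝ} :
    p ∈ frontier P.region ↔ ∃ c i, p ∈ (P.cycle c).edge i := by
  rw [P.frontier_region]
  simp [OrthogonalCycle.curve, OrthogonalCycle.edge]

theorem mem_frontier_of_mem_vertices {v : ℝ × ℝ} (h : v ∈ P.vertices) :
    v ∈ frontier P.region := by
  obtain ⟨c, i, rfl⟩ := h
  exact mem_frontier_iff.2 ⟨c, i, OrthogonalCycle.vertex_mem_edge i⟩

/-- There are finitely many edges and each is closed, so the edges missing `p` also miss a
neighbourhood of `p`. This localises the boundary to the edges through `p`. -/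
theorem eventually_mem_edge_imp (p : ℝ × ℝ) :
    ∀ᶠ q in 𝓝 p, ∀ c i, q ∈ (P.cycle c).edge i → p ∈ (P.cycle c).edge i := by
  rw [Filter.eventually_all]
  intro c
  rw [Filter.eventually_all]
  intro i
  by_cases h : p ∈ (P.cycle c).edge i
  · exact Filter.Eventually.of_forall fun q _ => h
  · filter_upwards [((P.cycle c).isClosed_edge i).isOpen_compl.mem_nhds h] with q hq hq'
    exact absurd hq' hq

theorem cycle_eq_of_mem_edges {p : ℝ × ℝ} {c c' : Fin P.numCycles} {i : Fin (P.cycle c).len}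
    {j : Fin (P.cycle c').len} (h : p ∈ (P.cycle c).edge i) (h' : p ∈ (P.cycle c').edge j) :
    c = c' := by
  by_contra hne
  exact Set.disjoint_left.1 (P.cycles_disjoint c c' hne)
    (Set.mem_iUnion.2 ⟨i, h⟩) (Set.mem_iUnion.2 ⟨j, h'⟩)

/-- Near a boundary point that is not a vertex, the boundary is an axis-parallel line. -/
theorem frontier_local_of_notMem_vertices {p : ℝ × ℝ} (hp : p ∈ frontier P.region)
    (hv : p ∉ P.vertices) :
    (∀ᶠ q in 𝓝 p, q ∈ frontier P.region ↔ q.1 = p.1) ∨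
      (∀ᶠ q in 𝓝 p, q ∈ frontier P.region ↔ q.2 = p.2) := by
  obtain ⟨c, i, hi⟩ := mem_frontier_iff.1 hp
  have key : ∀ᶠ q in 𝓝 p, q ∈ frontier P.region ↔ q ∈ (P.cycle c).edge i := by
    filter_upwards [eventually_mem_edge_imp (P := P) p] with q hq
    refine ⟨fun h => ?_, fun h => mem_frontier_iff.2 ⟨c, i, h⟩⟩
    obtain ⟨c', j, hj⟩ := mem_frontier_iff.1 h
    have hpj := hq c' j hj
    obtain rfl := cycle_eq_of_mem_edges hi hpj
    by_cases hij : i = j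
    · rwa [hij]
    · exfalso
      rcases OrthogonalCycle.eq_vertex_of_mem_edges hij hi hpj with ⟨-, h⟩ | ⟨-, h⟩ <;>
        exact hv ⟨_, _, h.symm⟩
  have h1 : p ≠ (P.cycle c).vertex i := fun h => hv ⟨_, _, h.symm⟩
  have h2 : p ≠ (P.cycle c).vertex (i + 1) := fun h => hv ⟨_, _, h.symm⟩
  unfold OrthogonalCycle.edge at key hi
  rcases (P.cycle c).axisParallel i with h | h
  · left
    simp only [mem_segment_of_fst_eq h] at key hi
    have hm : p.2 ∈ uIoo ((P.cycle c).vertex i).2 ((P.cycle c).vertex (i + 1)).2 := by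
      rw [uIoo]
      refine ⟨lt_of_le_of_ne hi.2.1 ?_, lt_of_le_of_ne hi.2.2 ?_⟩
      · intro e
        rcases min_choice ((P.cycle c).vertex i).2 ((P.cycle c).vertex (i + 1)).2 with h' | h' <;>
          rw [h'] at e
        · exact h1 (Prod.ext hi.1 e.symm)
        · exact h2 (Prod.ext (hi.1.trans h) e.symm)
      · intro e
        rcases max_choice ((P.cycle c).vertex i).2 ((P.cycle c).vertex (i + 1)).2 with h' | h' <;>
          rw [h'] at e
        · exact h1 (Prod.ext hi.1 e)
        · exact h2 (Prod.ext (hi.1.trans h) e)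
    filter_upwards [key, (isOpen_Ioo.preimage continuous_snd).mem_nhds hm] with q hq hq'
    rw [hq, hi.1]
    exact ⟨fun h => h.1, fun h => ⟨h, Ioo_subset_Icc_self hq'⟩⟩
  · right
    simp only [mem_segment_of_snd_eq h] at key hi
    have hm : p.1 ∈ uIoo ((P.cycle c).vertex i).1 ((P.cycle c).vertex (i + 1)).1 := by
      rw [uIoo]
      refine ⟨lt_of_le_of_ne hi.2.1 ?_, lt_of_le_of_ne hi.2.2 ?_⟩
      · intro e
        rcases min_choice ((P.cycle c).vertex i).1 ((P.cycle c).vertex (i + 1)).1 with h' | h' <;>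
          rw [h'] at e
        · exact h1 (Prod.ext e.symm hi.1)
        · exact h2 (Prod.ext e.symm (hi.1.trans h))
      · intro e
        rcases max_choice ((P.cycle c).vertex i).1 ((P.cycle c).vertex (i + 1)).1 with h' | h' <;>
          rw [h'] at e
        · exact h1 (Prod.ext e hi.1)
        · exact h2 (Prod.ext e (hi.1.trans h))
    filter_upwards [key, (isOpen_Ioo.preimage continuous_fst).mem_nhds hm] with q hq hq'
    rw [hq, hi.1]
    exact ⟨fun h => h.1, fun h => ⟨h, Ioo_subset_Icc_self hq'⟩⟩

theorem exists_sign_mul_eq {x : ℝ} (hx : x ≠ 0) :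
    ∃ s α : ℝ, (s = 1 ∨ s = -1) ∧ 0 < α ∧ x = s * α := by
  rcases lt_or_gt_of_ne hx with h | h
  · exact ⟨-1, -x, Or.inr rfl, by linarith, by ring⟩
  · exact ⟨1, x, Or.inl rfl, h, by ring⟩

/-- Close to one of its ends, an interval cannot be told apart from a half-line. This turns the
edges at a vertex into the half-edges with signs `s` and `τ` used below. -/
theorem eventually_mem_uIcc_iff {f : ℝ × ℝ → ℝ} (hf : Continuous f) {v : ℝ × ℝ} {a s α : ℝ}
    (hs : s = 1 ∨ s = -1) (hα : 0 < α) (ha : a = f v + s * α) :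
    ∀ᶠ q in 𝓝 v, f q ∈ uIcc (f v) a ↔ 0 ≤ s * (f q - f v) := by
  have h1 : ∀ᶠ q in 𝓝 v, f q ∈ Ioo (f v - α) (f v + α) :=
    hf.continuousAt.eventually_mem (Ioo_mem_nhds (by linarith) (by linarith))
  filter_upwards [h1] with q hq
  rcases hs with rfl | rfl
  · rw [uIcc_of_le (by linarith)]
    exact ⟨fun h => by linarith [h.1], fun h => ⟨by linarith, by linarith [hq.2]⟩⟩
  · rw [uIcc_of_ge (by linarith)]
    exact ⟨fun h => by linarith [h.2], fun h => ⟨by linarith [hq.1], by linarith⟩⟩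

/-- Near a vertex, the boundary consists of a horizontal and a vertical half-edge. -/
theorem frontier_local_of_mem_vertices {v : ℝ × ℝ} (hv : v ∈ P.vertices) :
    ∃ s τ α β : ℝ, (s = 1 ∨ s = -1) ∧ (τ = 1 ∨ τ = -1) ∧ 0 < α ∧ 0 < β ∧
      (∀ᶠ q in 𝓝 v, q ∈ frontier P.region ↔
        (q.1 = v.1 ∧ 0 ≤ τ * (q.2 - v.2)) ∨ (q.2 = v.2 ∧ 0 ≤ s * (q.1 - v.1))) ∧
      ((∀ᶠ t : ℝ in 𝓝[>] 0, (v.1 + s * α * t, v.2 + τ * β * t) ∉ P.region) →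
        P.IsReflexVertex v) := by
  obtain ⟨c, i, rfl⟩ := hv
  set v := (P.cycle c).vertex i with hvdef
  have hsucc : (i - 1 + 1 : Fin (P.cycle c).len) = i := sub_add_cancel _ _
  have key : ∀ᶠ q in 𝓝 v, q ∈ frontier P.region ↔
      q ∈ segment ℝ v ((P.cycle c).vertex (i + 1)) ∨
        q ∈ segment ℝ v ((P.cycle c).vertex (i - 1)) := by
    filter_upwards [eventually_mem_edge_imp (P := P) v] with q hq
    have e : (P.cycle c).edge (i - 1) = segment ℝ v ((P.cycle c).vertex (i - 1)) := by
      rw [OrthogonalCycle.edge, hsucc, segment_symm]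
    rw [← e]
    refine ⟨fun h => ?_, fun h => h.elim (fun h => mem_frontier_iff.2 ⟨c, i, h⟩)
      (fun h => mem_frontier_iff.2 ⟨c, _, h⟩)⟩
    obtain ⟨c', j, hj⟩ := mem_frontier_iff.1 h
    have hpj := hq c' j hj
    obtain rfl := cycle_eq_of_mem_edges (OrthogonalCycle.vertex_mem_edge i) hpj
    rcases OrthogonalCycle.eq_or_eq_of_vertex_mem_edge hpj with rfl | rfl
    · exact Or.inl hj
    · exact Or.inr hj
  have hne1 : v ≠ (P.cycle c).vertex (i + 1) := (P.cycle c).vertex_ne i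
  have hne2 : (P.cycle c).vertex (i - 1) ≠ v := by
    have := (P.cycle c).vertex_ne (i - 1)
    rwa [hsucc] at this
  have halt := (P.cycle c).alternating (i - 1)
  have hax := (P.cycle c).axisParallel (i - 1)
  rw [hsucc] at halt hax
  have hax' := (P.cycle c).axisParallel i
  set u := (P.cycle c).vertex (i - 1) with hu
  set w := (P.cycle c).vertex (i + 1) with hw
  rw [← hvdef] at halt hax hax'
  -- The reflex test involves only the sum of the two edge vectors, so it is the same whether the
  -- incoming or the outgoing edge is the horizontal one.
  have hrefl : ∀ a b : ℝ, v + (u - v) + (w - v) = v + (a, b) →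
      (∀ᶠ t : ℝ in 𝓝[>] 0, (v.1 + a * t, v.2 + b * t) ∉ P.region) → P.IsReflexVertex v := by
    intro a b hab h
    refine ⟨c, i, rfl, ?_⟩
    filter_upwards [h] with t ht
    convert ht using 2
    have h1 := congrArg Prod.fst hab
    have h2 := congrArg Prod.snd hab
    simp only [Prod.fst_add, Prod.snd_add, Prod.fst_sub, Prod.snd_sub] at h1 h2
    ext
    · simp only [Prod.fst_add, Prod.fst_sub, Prod.smul_fst, smul_eq_mul]
      linear_combination t * h1
    · simp only [Prod.snd_add, Prod.snd_sub, Prod.smul_snd, smul_eq_mul]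
      linear_combination t * h2
  by_cases h : u.1 = v.1
  · have h' := halt.1 h
    obtain ⟨s, α, hs, hα, e1⟩ := exists_sign_mul_eq (x := w.1 - v.1)
      (fun e => hne1 (Prod.ext (by linarith) h'))
    obtain ⟨τ, β, hτ, hβ, e2⟩ := exists_sign_mul_eq (x := u.2 - v.2)
      (fun e => hne2 (Prod.ext h (by linarith)))
    refine ⟨s, τ, α, β, hs, hτ, hα, hβ, ?_, hrefl (s * α) (τ * β) ?_⟩
    · filter_upwards [key, eventually_mem_uIcc_iff continuous_fst hs hα (a := w.1) (by linarith),
        eventually_mem_uIcc_iff continuous_snd hτ hβ (a := u.2) (by linarith)] with q h1 h2 h3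
      rw [h1, mem_segment_of_snd_eq h', mem_segment_of_fst_eq h.symm, h2, h3, or_comm]
    · ext <;> simp <;> linarith
  · have h1 : u.2 = v.2 := hax.resolve_left h
    have h' : v.1 = w.1 := hax'.resolve_right (fun e => h (halt.2 e))
    obtain ⟨s, α, hs, hα, e1⟩ := exists_sign_mul_eq (x := u.1 - v.1)
      (fun e => h (by linarith))
    obtain ⟨τ, β, hτ, hβ, e2⟩ := exists_sign_mul_eq (x := w.2 - v.2)
      (fun e => hne1 (Prod.ext h' (by linarith)))
    refine ⟨s, τ, α, β, hs, hτ, hα, hβ, ?_, hrefl (s * α) (τ * β) ?_⟩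
    · filter_upwards [key, eventually_mem_uIcc_iff continuous_fst hs hα (a := u.1) (by linarith),
        eventually_mem_uIcc_iff continuous_snd hτ hβ (a := w.2) (by linarith)] with q k1 k2 k3
      rw [k1, mem_segment_of_fst_eq h', mem_segment_of_snd_eq h1.symm, k2, k3]
    · ext <;> simp <;> linarith

end OrthogonalPolygon

/-! ### Density and convexity tools -/

/-- A closed set contains the closure of each of its subsets. In the applications `D` is the
complement of one or two axis-parallel lines: a point with the polygon on all sides of these lines
cannot be a boundary point. -/
theorem mem_interior_of_dense {X : Type*} [TopologicalSpace X] {K D : Set X} {p : X}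
    (hK : IsClosed K) (hD : Dense D) (h : ∀ᶠ q in 𝓝 p, q ∈ D → q ∈ K) : p ∈ interior K := by
  obtain ⟨O, hO, hOo, hp⟩ := eventually_nhds_iff.1 h
  refine mem_interior.2 ⟨O, fun q hq => ?_, hOo, hp⟩
  have := hD.open_subset_closure_inter hOo hq
  exact hK.closure_subset_iff.2 (fun r hr => hO r hr.1 hr.2) this

theorem dense_snd_ne (b : ℝ) : Dense {q : ℝ × ℝ | q.2 ≠ b} := by
  have : {q : ℝ × ℝ | q.2 ≠ b} = univ ×ˢ {b}ᶜ := by ext; simp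
  rw [this]
  exact dense_univ.prod (dense_compl_singleton b)

theorem dense_fst_ne_snd_ne (a b : ℝ) : Dense {q : ℝ × ℝ | q.1 ≠ a ∧ q.2 ≠ b} := by
  have : {q : ℝ × ℝ | q.1 ≠ a ∧ q.2 ≠ b} = {a}ᶜ ×ˢ {b}ᶜ := by ext; simp
  rw [this]
  exact (dense_compl_singleton a).prod (dense_compl_singleton b)

theorem convex_pos_mul_fst_sub (s a : ℝ) : Convex ℝ {q : ℝ × ℝ | 0 < s * (q.1 - a)} := by
  have : {q : ℝ × ℝ | 0 < s * (q.1 - a)} = {q | s * a < (s • LinearMap.fst ℝ ℝ ℝ) q} := by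
    ext q
    simp [mul_sub]
  rw [this]
  exact convex_halfSpace_gt (LinearMap.isLinear _) _

theorem convex_pos_mul_snd_sub (s a : ℝ) : Convex ℝ {q : ℝ × ℝ | 0 < s * (q.2 - a)} := by
  have : {q : ℝ × ℝ | 0 < s * (q.2 - a)} = {q | s * a < (s • LinearMap.snd ℝ ℝ ℝ) q} := by
    ext q
    simp [mul_sub]
  rw [this]
  exact convex_halfSpace_gt (LinearMap.isLinear _) _

theorem mem_openSegment_vertical {x y₁ y₂ : ℝ} {q : ℝ × ℝ} (h : y₁ ≠ y₂) :
    q ∈ openSegment ℝ (x, y₁) (x, y₂) ↔ q.1 = x ∧ q.2 ∈ uIoo y₁ y₂ := by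
  rw [← Prod.image_mk_openSegment_right, openSegment_eq_Ioo' h]
  constructor
  · rintro ⟨y, hy, rfl⟩
    exact ⟨rfl, hy⟩
  · rintro ⟨rfl, hy⟩
    exact ⟨q.2, hy, rfl⟩

theorem eventually_add_sign_mul {v : ℝ} {τ : ℝ} (ε : ℝ) (hε : 0 < ε) (hτ : τ = 1 ∨ τ = -1) :
    ∀ᶠ t : ℝ in 𝓝[>] 0, 0 < t ∧ |v + τ * t - v| < ε := by
  filter_upwards [Ioo_mem_nhdsGT hε] with t ht
  refine ⟨ht.1, ?_⟩
  rcases hτ with rfl | rfl <;> rw [abs_lt] <;> constructor <;> linarith [ht.1, ht.2]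

/-! ### Reflex vertices and one-sided neighbourhoods -/

namespace OrthogonalPolygon

variable {P : OrthogonalPolygon}

theorem notMem_frontier_of_mem_interior {p : ℝ × ℝ} (h : p ∈ interior P.region) :
    p ∉ frontier P.region := fun h' => h'.2 h

theorem mem_interior_of_mem_of_notMem_frontier {p : ℝ × ℝ} (h : p ∈ P.region)
    (h' : p ∉ frontier P.region) : p ∈ interior P.region := by
  by_contra hp
  exact h' (by rw [isClosed_region.frontier_eq]; exact ⟨h, hp⟩)

theorem subset_interior_of_convex {S : Set (ℝ × ℝ)} (hS : Convex ℝ S)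
    (hd : ∀ q ∈ S, q ∉ frontier P.region) {p : ℝ × ℝ} (hp : p ∈ S) (hp' : p ∈ interior P.region) :
    S ⊆ interior P.region :=
  hS.isPreconnected.subset_interior_of_disjoint_frontier isClosed_region hd ⟨p, hp, hp'⟩

/-- At a vertex which is not reflex, no vertical segment leaves into the interior. -/
theorem isReflexVertex_of_eventually_mem {v : ℝ × ℝ} (hv : v ∈ P.vertices) {τ : ℝ}
    (hτ : τ = 1 ∨ τ = -1) (h : ∀ᶠ t : ℝ in 𝓝[>] 0, (v.1, v.2 + τ * t) ∈ interior P.region) :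
    P.IsReflexVertex v := by
  obtain ⟨s₀, τ₀, α, β, hs₀, hτ₀, hα, hβ, hloc, hrefl⟩ := frontier_local_of_mem_vertices hv
  obtain ⟨ε, hε, hball⟩ := Metric.eventually_nhds_iff_ball.1 hloc
  obtain ⟨t₀, ht₀, htpos, htε⟩ := (h.and (eventually_add_sign_mul (v := v.2) ε hε hτ)).exists
  have hmem₀ : (v.1, v.2 + τ * t₀) ∈ Metric.ball v ε := by
    rw [mem_ball_prod_iff]
    exact ⟨by simpa using hε, htε⟩
  -- The vertical half-edge points away from the given segment; otherwise the segment would run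
  -- along the boundary.
  have hne : τ₀ = -τ := by
    by_contra hne
    have : τ₀ = τ := by
      rcases hτ with rfl | rfl <;> rcases hτ₀ with rfl | rfl <;> simp_all
    subst this
    refine notMem_frontier_of_mem_interior ht₀ ((hball _ hmem₀).2 (Or.inl ⟨rfl, ?_⟩))
    rcases hτ with rfl | rfl <;> simp <;> linarith
  subst hne
  by_contra hnr
  -- Suppose the vertex is not reflex. Three convex pieces of the ball avoid the boundary: the half
  -- disc in direction `τ` (A), the half disc opposite to the horizontal half-edge (B), and the
  -- quadrant between the two half-edges (C). Each contains one interior point, hence is interior.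
  have hA : Metric.ball v ε ∩ {q | 0 < τ * (q.2 - v.2)} ⊆ interior P.region := by
    refine subset_interior_of_convex ((convex_ball _ _).inter (convex_pos_mul_snd_sub _ _)) ?_
      ⟨hmem₀, ?_⟩ ht₀
    · rintro q ⟨hq, hq'⟩
      rw [mem_ofPred_eq] at hq'
      rw [hball q hq]
      rintro (⟨-, h2⟩ | ⟨h1, -⟩)
      · linarith
      · rw [h1, sub_self, mul_zero] at hq'
        exact lt_irrefl _ hq'
    · rcases hτ with rfl | rfl <;> simp <;> linarith
  have hB : Metric.ball v ε ∩ {q | 0 < -s₀ * (q.1 - v.1)} ⊆ interior P.region := by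
    -- This point lies in both half discs, so interiority passes from A to B.
    have hm : (v.1 - s₀ * (ε / 2), v.2 + τ * (ε / 2)) ∈ Metric.ball v ε := by
      rw [mem_ball_prod_iff]
      rcases hτ with rfl | rfl <;> rcases hs₀ with rfl | rfl <;>
        constructor <;> rw [abs_lt] <;> constructor <;> simp <;> linarith
    refine subset_interior_of_convex ((convex_ball _ _).inter (convex_pos_mul_fst_sub _ _)) ?_
      ⟨hm, ?_⟩ (hA ⟨hm, ?_⟩)
    · rintro q ⟨hq, hq'⟩
      rw [mem_ofPred_eq] at hq'
      rw [hball q hq]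
      rintro (⟨h1, -⟩ | ⟨-, h2⟩)
      · rw [h1, sub_self, mul_zero] at hq'
        exact lt_irrefl _ hq'
      · linarith
    · rcases hs₀ with rfl | rfl <;> simp <;> linarith
    · rcases hτ with rfl | rfl <;> simp <;> linarith
  have hC : Metric.ball v ε ∩ ({q | 0 < s₀ * (q.1 - v.1)} ∩ {q | 0 < -τ * (q.2 - v.2)}) ⊆
      interior P.region := by
    -- Only here is non-reflexivity used: it puts points of the polygon arbitrarily close to `v`
    -- into the quadrant C.
    have hf : ∃ᶠ t : ℝ in 𝓝[>] 0, (v.1 + s₀ * α * t, v.2 + -τ * β * t) ∈ P.region :=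
      fun hh => hnr (hrefl hh)
    obtain ⟨t, ht, ⟨ht1, ht2⟩, ht3⟩ := (hf.and_eventually
      (((eventually_add_sign_mul (v := v.1) (τ := s₀) (ε / α) (by positivity) hs₀)).and
        (eventually_add_sign_mul (v := v.2) (τ := -τ) (ε / β) (by positivity) hτ₀))).exists
    have hq : (v.1 + s₀ * α * t, v.2 + -τ * β * t) ∈ Metric.ball v ε := by
      rw [mem_ball_prod_iff]
      rw [add_sub_cancel_left, lt_div_iff₀ (by assumption)] at ht2
      have ht3 := ht3.2
      rw [add_sub_cancel_left, lt_div_iff₀ (by assumption)] at ht3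
      rw [add_sub_cancel_left, add_sub_cancel_left]
      constructor
      · calc |s₀ * α * t| = |s₀ * t| * α := by
              rw [mul_right_comm, abs_mul, abs_of_pos hα]
          _ < ε := ht2
      · calc |-τ * β * t| = |-τ * t| * β := by
              rw [mul_right_comm, abs_mul, abs_of_pos hβ]
          _ < ε := ht3
    have hd : ∀ q ∈ Metric.ball v ε ∩ ({q | 0 < s₀ * (q.1 - v.1)} ∩ {q | 0 < -τ * (q.2 - v.2)}),
        q ∉ frontier P.region := by
      rintro q ⟨hq, hq', hq''⟩
      rw [mem_ofPred_eq] at hq' hq''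
      rw [hball q hq]
      rintro (⟨h1, -⟩ | ⟨h1, -⟩)
      · rw [h1, sub_self, mul_zero] at hq'
        exact lt_irrefl _ hq'
      · rw [h1, sub_self, mul_zero] at hq''
        exact lt_irrefl _ hq''
    have hq' : (v.1 + s₀ * α * t, v.2 + -τ * β * t) ∈ Metric.ball v ε ∩
        ({q | 0 < s₀ * (q.1 - v.1)} ∩ {q | 0 < -τ * (q.2 - v.2)}) := by
      refine ⟨hq, ?_, ?_⟩
      · rcases hs₀ with rfl | rfl <;> simp <;> positivity
      · rcases hτ with rfl | rfl <;> simp <;> positivity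
    exact subset_interior_of_convex ((convex_ball _ _).inter
      ((convex_pos_mul_fst_sub _ _).inter (convex_pos_mul_snd_sub _ _))) hd hq'
      (mem_interior_of_mem_of_notMem_frontier ht (hd _ hq'))
  -- A, B and C cover the ball off the two axes through `v`, which makes the boundary point `v`
  -- interior.
  refine notMem_frontier_of_mem_interior (P := P) ?_ (mem_frontier_of_mem_vertices hv)
  refine mem_interior_of_dense isClosed_region (dense_fst_ne_snd_ne v.1 v.2) ?_
  filter_upwards [Metric.ball_mem_nhds v hε] with q hq ⟨h1, h2⟩
  refine interior_subset ?_
  have h1' : q.1 - v.1 ≠ 0 := sub_ne_zero.2 h1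
  have h2' : q.2 - v.2 ≠ 0 := sub_ne_zero.2 h2
  by_cases k1 : 0 < τ * (q.2 - v.2)
  · exact hA ⟨hq, k1⟩
  by_cases k2 : 0 < -s₀ * (q.1 - v.1)
  · exact hB ⟨hq, k2⟩
  refine hC ⟨hq, ?_, ?_⟩
  · have : s₀ * (q.1 - v.1) ≠ 0 := mul_ne_zero (by rcases hs₀ with rfl | rfl <;> norm_num) h1'
    exact lt_of_le_of_ne (by linarith) this.symm
  · have : -τ * (q.2 - v.2) ≠ 0 := mul_ne_zero (by rcases hτ with rfl | rfl <;> norm_num) h2'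
    exact lt_of_le_of_ne (by linarith) this.symm

/-- If the boundary is locally a horizontal line and one side of it meets the interior, then the
whole side is interior. -/
theorem exists_ball_of_frontier_horizontal {p : ℝ × ℝ}
    (hloc : ∀ᶠ q in 𝓝 p, q ∈ frontier P.region ↔ q.2 = p.2) {τ : ℝ}
    (h : ∃ᶠ q in 𝓝 p, 0 < τ * (q.2 - p.2) ∧ q ∈ interior P.region) :
    ∃ ε > 0, (∀ q ∈ Metric.ball p ε, q ∈ frontier P.region ↔ q.2 = p.2) ∧
      ∀ q ∈ Metric.ball p ε, 0 < τ * (q.2 - p.2) → q ∈ interior P.region := by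
  obtain ⟨ε, hε, hball⟩ := Metric.eventually_nhds_iff_ball.1 hloc
  refine ⟨ε, hε, hball, ?_⟩
  obtain ⟨q, ⟨hq1, hq2⟩, hq3⟩ := (h.and_eventually (Metric.ball_mem_nhds p hε)).exists
  have := subset_interior_of_convex (P := P)
    ((convex_ball p ε).inter (convex_pos_mul_snd_sub τ p.2)) ?_ ⟨hq3, hq1⟩ hq2
  · exact fun q h1 h2 => this ⟨h1, h2⟩
  · rintro q ⟨hq, hq'⟩
    rw [hball q hq]
    intro h1
    rw [mem_ofPred_eq, h1, sub_self, mul_zero] at hq'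
    exact lt_irrefl _ hq'

/-- A vertical segment entering the interior at `p` excludes a non-reflex vertex, by the preceding
analysis, and also a point inside a vertical edge, which would contain the start of the segment.
What remains is a point inside a horizontal edge. -/
theorem exists_ball_of_not_isReflexVertex {p : ℝ × ℝ} (hp : p ∈ frontier P.region)
    (hr : ¬ P.IsReflexVertex p) {τ : ℝ} (hτ : τ = 1 ∨ τ = -1)
    (h : ∀ᶠ t : ℝ in 𝓝[>] 0, (p.1, p.2 + τ * t) ∈ interior P.region) :
    ∃ ε > 0, (∀ q ∈ Metric.ball p ε, q ∈ frontier P.region ↔ q.2 = p.2) ∧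
      ∀ q ∈ Metric.ball p ε, 0 < τ * (q.2 - p.2) → q ∈ interior P.region := by
  have hv : p ∉ P.vertices := fun hv => hr (isReflexVertex_of_eventually_mem hv hτ h)
  have hten : Filter.Tendsto (fun t : ℝ => (p.1, p.2 + τ * t)) (𝓝[>] 0) (𝓝 p) := by
    have : Filter.Tendsto (fun t : ℝ => (p.1, p.2 + τ * t)) (𝓝 0) (𝓝 (p.1, p.2 + τ * 0)) :=
      Continuous.tendsto (by fun_prop) 0
    rw [mul_zero, add_zero] at this
    exact this.mono_left nhdsWithin_le_nhds
  rcases frontier_local_of_notMem_vertices hp hv with hloc | hloc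
  · exfalso
    obtain ⟨t, h1, h2⟩ := ((hten.eventually hloc).and h).exists
    exact notMem_frontier_of_mem_interior h2 (h1.2 rfl)
  · refine exists_ball_of_frontier_horizontal hloc ?_
    refine hten.frequently (Filter.Eventually.frequently ?_)
    filter_upwards [h, self_mem_nhdsWithin] with t ht ht'
    refine ⟨?_, ht⟩
    rw [mem_Ioi] at ht'
    rcases hτ with rfl | rfl <;> simp <;> linarith

/-! ### Vertical chords, cuts, and the slices as rectangles -/

/-- The open vertical segment `{x} × (c, d)` is a maximal one in the interior of `P`. -/
def IsChord (P : OrthogonalPolygon) (x c d : ℝ) : Prop :=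
  c < d ∧ (∀ y ∈ Ioo c d, (x, y) ∈ interior P.region) ∧
    (x, c) ∈ frontier P.region ∧ (x, d) ∈ frontier P.region

theorem IsChord.unique {x c d c' d' y : ℝ} (h : P.IsChord x c d) (h' : P.IsChord x c' d')
    (hy : y ∈ Ioo c d) (hy' : y ∈ Ioo c' d') : c = c' ∧ d = d' := by
  have aux : ∀ {c d z}, P.IsChord x c d → (x, z) ∈ frontier P.region → c < z → d ≤ z := by
    intro c d z h hz hc
    by_contra hd
    exact notMem_frontier_of_mem_interior (h.2.1 z ⟨hc, not_le.1 hd⟩) hz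
  have e1 := aux h h'.2.2.2 (hy.1.trans hy'.2)
  have e2 := aux h' h.2.2.2 (hy'.1.trans hy.2)
  refine ⟨le_antisymm ?_ ?_, le_antisymm e1 e2⟩
  · by_contra hlt
    exact absurd (aux h' h.2.2.1 (not_le.1 hlt)) (by linarith [hy.1, hy'.2])
  · by_contra hlt
    exact absurd (aux h h'.2.2.1 (not_le.1 hlt)) (by linarith [hy'.1, hy.2])

/-- The ends are the nearest heights above and below `p` at which the vertical line leaves the
interior. They exist because the polygon is bounded, and they lie in the polygon as limits of
interior points. -/
theorem exists_isChord {p : ℝ × ℝ} (hp : p ∈ interior P.region) :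
    ∃ c d, P.IsChord p.1 c d ∧ p.2 ∈ Ioo c d := by
  obtain ⟨R, hR⟩ := P.isCompact_region.isBounded.subset_closedBall 0
  have hbd : ∀ y, (p.1, y) ∈ interior P.region → |y| ≤ R := by
    intro y hy
    have := hR (interior_subset hy)
    rw [mem_closedBall_zero_iff, Prod.norm_def] at this
    exact (le_max_right _ _).trans this
  have hcl : IsClosed {y : ℝ | (p.1, y) ∉ interior P.region} :=
    (isOpen_interior.preimage (by fun_prop : Continuous fun y : ℝ => (p.1, y))).isClosed_compl
  have hout : ∀ y, R < |y| → (p.1, y) ∉ interior P.region := fun y hy h =>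
    absurd (hbd y h) (not_le.2 hy)
  have hRp : |p.2| ≤ R := hbd _ hp
  set A := {y : ℝ | (p.1, y) ∉ interior P.region} ∩ Ici p.2 with hA
  set B := {y : ℝ | (p.1, y) ∉ interior P.region} ∩ Iic p.2 with hB
  have hAne : A.Nonempty := by
    refine ⟨R + 1, hout _ ?_, ?_⟩
    · exact lt_of_lt_of_le (by linarith) (le_abs_self _)
    · rw [mem_Ici]
      linarith [le_abs_self p.2]
  have hBne : B.Nonempty := by
    refine ⟨-R - 1, hout _ ?_, ?_⟩
    · exact lt_of_lt_of_le (by linarith) (neg_le_abs _)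
    · rw [mem_Iic]
      linarith [neg_le_abs p.2]
  have hAb : BddBelow A := ⟨p.2, fun y hy => hy.2⟩
  have hBb : BddAbove B := ⟨p.2, fun y hy => hy.2⟩
  have hd := (hcl.inter isClosed_Ici).csInf_mem hAne hAb
  have hc := (hcl.inter isClosed_Iic).csSup_mem hBne hBb
  have hd' : p.2 < sInf A := lt_of_le_of_ne hd.2 fun e => hd.1 (by rw [← hA, ← e]; exact hp)
  have hc' : sSup B < p.2 := lt_of_le_of_ne hc.2 fun e => hc.1 (by rw [← hB, e]; exact hp)
  have hin : ∀ y ∈ Ioo (sSup B) (sInf A), (p.1, y) ∈ interior P.region := by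
    intro y hy
    by_contra hn
    rcases le_total p.2 y with h | h
    · exact absurd (csInf_le hAb ⟨hn, h⟩) (not_le.2 hy.2)
    · exact absurd (le_csSup hBb ⟨hn, h⟩) (not_le.2 hy.1)
  have hlim : ∀ z ∈ Icc (sSup B) (sInf A), (p.1, z) ∈ P.region := by
    intro z hz
    rw [← closure_Ioo (hc'.trans hd').ne] at hz
    have hcont : Continuous fun y : ℝ => (p.1, y) := by fun_prop
    have := image_closure_subset_closure_image hcont (mem_image_of_mem _ hz)
    refine isClosed_region.closure_subset_iff.2 ?_ this
    rintro _ ⟨y, hy, rfl⟩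
    exact interior_subset (hin y hy)
  refine ⟨sSup B, sInf A, ⟨hc'.trans hd', hin, ?_, ?_⟩, hc', hd'⟩
  · rw [isClosed_region.frontier_eq]
    exact ⟨hlim _ ⟨le_rfl, (hc'.trans hd').le⟩, hc.1⟩
  · rw [isClosed_region.frontier_eq]
    exact ⟨hlim _ ⟨(hc'.trans hd').le, le_rfl⟩, hd.1⟩

/-- A cut ray reaching the chord must start at one of its ends: a start inside the chord would be a
boundary point in the interior, and a start beyond an end would force the ray through that boundary
point. The right side does not depend on `y`, so a chord is either entirely cut or not at all. -/
theorem IsChord.mem_cuts_iff {x c d y : ℝ} (h : P.IsChord x c d) (hy : y ∈ Ioo c d) :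
    (x, y) ∈ P.cuts Prod.fst ↔ P.IsReflexVertex (x, c) ∨ P.IsReflexVertex (x, d) := by
  constructor
  · rintro ⟨-, ⟨v1, v2⟩, hv, rfl, hseg⟩
    have hvf := mem_frontier_of_mem_vertices hv.mem_vertices
    have hvn : ¬ (c < v2 ∧ v2 < d) := fun hh => notMem_frontier_of_mem_interior (h.2.1 v2 hh) hvf
    dsimp only at hy h ⊢
    rcases le_or_gt v2 c with hle | hgt
    · left
      rcases hle.eq_or_lt with rfl | hlt
      · exact hv
      · exfalso
        refine notMem_frontier_of_mem_interior (hseg ?_) h.2.2.1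
        rw [mem_openSegment_vertical (hlt.trans hy.1).ne, uIoo_of_le (hlt.trans hy.1).le]
        exact ⟨rfl, hlt, hy.1⟩
    · right
      rcases (not_lt.1 fun hh => hvn ⟨hgt, hh⟩).eq_or_lt with rfl | hlt
      · exact hv
      · exfalso
        refine notMem_frontier_of_mem_interior (hseg ?_) h.2.2.2
        rw [mem_openSegment_vertical (hy.2.trans hlt).ne', uIoo_of_ge (hy.2.trans hlt).le]
        exact ⟨rfl, hy.2, hlt⟩
  · rintro (hr | hr)
    · refine ⟨h.2.1 y hy, _, hr, rfl, ?_⟩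
      intro q hq
      rw [mem_openSegment_vertical hy.1.ne, uIoo_of_le hy.1.le] at hq
      rw [← Prod.mk.eta (p := q), hq.1]
      exact h.2.1 _ ⟨hq.2.1, hq.2.2.trans hy.2⟩
    · refine ⟨h.2.1 y hy, _, hr, rfl, ?_⟩
      intro q hq
      rw [mem_openSegment_vertical hy.2.ne', uIoo_of_ge hy.2.le] at hq
      rw [← Prod.mk.eta (p := q), hq.1]
      exact h.2.1 _ ⟨hy.1.trans hq.2.1, hq.2.2⟩

/-- A chord that is not a cut can be moved a little to the left and to the right. -/
theorem IsChord.eventually {x c d : ℝ} (h : P.IsChord x c d) (hc : ¬ P.IsReflexVertex (x, c))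
    (hd : ¬ P.IsReflexVertex (x, d)) : ∀ᶠ x' in 𝓝 x, P.IsChord x' c d := by
  have hcd := h.1
  obtain ⟨ε₁, hε₁, h₁, h₁'⟩ := exists_ball_of_not_isReflexVertex h.2.2.1 hc (Or.inl rfl) (by
    filter_upwards [Ioo_mem_nhdsGT (sub_pos.2 hcd)] with t ht
    exact h.2.1 _ ⟨by linarith [ht.1], by linarith [ht.2]⟩)
  obtain ⟨ε₂, hε₂, h₂, h₂'⟩ := exists_ball_of_not_isReflexVertex h.2.2.2 hd (Or.inr rfl) (by
    filter_upwards [Ioo_mem_nhdsGT (sub_pos.2 hcd)] with t ht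
    exact h.2.1 _ ⟨by linarith [ht.2], by linarith [ht.1]⟩)
  -- Compactness handles the middle of the chord uniformly. Near the ends, the local horizontal
  -- boundary lines do.
  have hmid : ∀ᶠ x' in 𝓝 x, ∀ y ∈ Icc (c + ε₁ / 2) (d - ε₂ / 2), (x', y) ∈ interior P.region := by
    refine isCompact_Icc.eventually_forall_of_forall_eventually fun y hy => ?_
    exact isOpen_interior.mem_nhds (h.2.1 y ⟨by linarith [hy.1], by linarith [hy.2]⟩)
  filter_upwards [hmid, Metric.ball_mem_nhds x hε₁, Metric.ball_mem_nhds x hε₂] with x' k k₁ k₂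
  rw [Metric.mem_ball, Real.dist_eq] at k₁ k₂
  refine ⟨hcd, fun y hy => ?_, ?_, ?_⟩
  · by_cases y1 : y < c + ε₁ / 2
    · refine h₁' _ (mem_ball_prod_iff.2 ⟨k₁, ?_⟩) (by simpa using hy.1)
      rw [abs_lt]
      constructor <;> simp only <;> linarith [hy.1]
    · by_cases y2 : d - ε₂ / 2 < y
      · refine h₂' _ (mem_ball_prod_iff.2 ⟨k₂, ?_⟩) (by simpa using hy.2)
        rw [abs_lt]
        constructor <;> simp only <;> linarith [hy.2]
      · exact k y ⟨not_lt.1 y1, not_lt.1 y2⟩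
  · exact (h₁ _ (mem_ball_prod_iff.2 ⟨k₁, by simpa using hε₁⟩)).2 rfl
  · exact (h₂ _ (mem_ball_prod_iff.2 ⟨k₂, by simpa using hε₂⟩)).2 rfl

/-- The vertices have finitely many first coordinates. Vertical lines close to `x`, other than the
one through `x`, therefore carry no vertices and hence no cuts. -/
theorem eventually_fst_ne (x : ℝ) :
    ∀ᶠ x' in 𝓝 x, x' ≠ x → ∀ v ∈ P.vertices, v.1 ≠ x' := by
  have hfin : (Prod.fst '' P.vertices \ {x}).Finite := (P.finite_vertices.image _).sdiff
  filter_upwards [hfin.isClosed.isOpen_compl.mem_nhds (x := x) (by simp)] with x' h h' v hv e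
  exact h ⟨⟨v, hv, e⟩, h'⟩

/-- The interior of the polygon without the vertical cuts. -/
def cutInterior (P : OrthogonalPolygon) : Set (ℝ × ℝ) := interior P.region \ P.cuts Prod.fst

theorem IsChord.subset_cutInterior {x c d y : ℝ} (h : P.IsChord x c d) (hy : y ∈ Ioo c d)
    (hxy : (x, y) ∈ P.cutInterior) {y' : ℝ} (hy' : y' ∈ Ioo c d) : (x, y') ∈ P.cutInterior :=
  ⟨h.2.1 y' hy', fun hc => hxy.2 ((h.mem_cuts_iff hy).2 ((h.mem_cuts_iff hy').1 hc))⟩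

theorem IsChord.eventually_of_mem_cutInterior {x c d y : ℝ} (h : P.IsChord x c d)
    (hy : y ∈ Ioo c d) (hxy : (x, y) ∈ P.cutInterior) :
    ∀ᶠ x' in 𝓝 x, P.IsChord x' c d ∧ ∀ y' ∈ Ioo c d, (x', y') ∈ P.cutInterior := by
  have hr := hxy.2
  rw [h.mem_cuts_iff hy, not_or] at hr
  filter_upwards [h.eventually hr.1 hr.2, eventually_fst_ne (P := P) x] with x' h1 h2
  refine ⟨h1, fun y' hy' => ?_⟩
  by_cases e : x' = x
  · subst e
    exact h.subset_cutInterior hy hxy hy'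
  · refine ⟨h1.2.1 y' hy', ?_⟩
    rw [h1.mem_cuts_iff hy']
    rintro (h | h) <;> exact h2 e _ h.mem_vertices rfl

/-- The open rectangle `(a, b) × (c, d)` is the interior of a slice. -/
def IsCell (P : OrthogonalPolygon) (a b c d : ℝ) : Prop :=
  a < b ∧ c < d ∧ (∀ x ∈ Ioo a b, P.IsChord x c d) ∧
    ∃ p ∈ P.cutInterior, connectedComponentIn P.cutInterior p = Ioo a b ×ˢ Ioo c d

/-- The ends of the chord through a point off the cuts are locally constant, hence constant on a
component. A component contains the whole chord through each of its points, so it is the product of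
its projection `I` and one interval of heights. The set `I` is open, connected and bounded, that is,
an open interval. -/
theorem exists_isCell {p : ℝ × ℝ} (hp : p ∈ P.cutInterior) :
    ∃ a b c d, P.IsCell a b c d ∧
      connectedComponentIn P.cutInterior p = Ioo a b ×ˢ Ioo c d := by
  obtain ⟨c, d, hch, hpcd⟩ := exists_isChord hp.1
  set W := connectedComponentIn P.cutInterior p with hW
  have hpW : p ∈ W := mem_connectedComponentIn hp
  have hWF : W ⊆ P.cutInterior := connectedComponentIn_subset _ _
  have hchord : ∀ q ∈ W, P.IsChord q.1 c d ∧ q.2 ∈ Ioo c d := by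
    -- On the component, `O` and its complement are both relatively open, so connectedness leaves
    -- only `O`.
    set O := {q : ℝ × ℝ | P.IsChord q.1 c d ∧ q.2 ∈ Ioo c d} with hO
    have hnear : ∀ q ∈ P.cutInterior, ∃ c' d', ∀ᶠ r in 𝓝 q,
        P.IsChord r.1 c' d' ∧ r.2 ∈ Ioo c' d' := by
      intro q hq
      obtain ⟨c', d', h1, h2⟩ := exists_isChord hq.1
      refine ⟨c', d', ?_⟩
      filter_upwards [continuous_fst.continuousAt.eventually
        (h1.eventually_of_mem_cutInterior h2 hq),
        continuous_snd.continuousAt.eventually (isOpen_Ioo.mem_nhds h2)] with r k1 k2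
      exact ⟨k1.1, k2⟩
    have hsub : W ⊆ interior O := by
      refine isPreconnected_connectedComponentIn.subset_left_of_subset_union
        (v := interior Oᶜ) isOpen_interior isOpen_interior ?_ ?_ ?_
      · exact disjoint_compl_right.mono interior_subset interior_subset
      · intro q hq
        obtain ⟨c', d', h⟩ := hnear q (hWF hq)
        by_cases e : q ∈ O
        · left
          obtain ⟨rfl, rfl⟩ := e.1.unique h.self_of_nhds.1 e.2 h.self_of_nhds.2
          exact mem_interior_iff_mem_nhds.2 h
        · right
          rw [mem_interior_iff_mem_nhds]
          filter_upwards [h] with r hr hr'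
          obtain ⟨rfl, rfl⟩ := hr'.1.unique hr.1 hr'.2 hr.2
          exact e h.self_of_nhds
      · refine ⟨p, hpW, ?_⟩
        obtain ⟨c', d', h⟩ := hnear p hp
        obtain ⟨rfl, rfl⟩ := hch.unique h.self_of_nhds.1 hpcd h.self_of_nhds.2
        exact mem_interior_iff_mem_nhds.2 h
    exact fun q hq => interior_subset (s := O) (hsub hq)
  have habs : ∀ S : Set (ℝ × ℝ), IsPreconnected S → S ⊆ P.cutInterior → (S ∩ W).Nonempty →
      S ⊆ W := by
    rintro S hS hSF ⟨q, hqS, hqW⟩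
    rw [hW, connectedComponentIn_eq hqW]
    exact hS.subset_connectedComponentIn hqS hSF
  set I := Prod.fst '' W with hI
  have hIn : I.Nonempty := ⟨p.1, p, hpW, rfl⟩
  have hprod : W = I ×ˢ Ioo c d := by
    ext q
    constructor
    · intro hq
      exact ⟨⟨q, hq, rfl⟩, (hchord q hq).2⟩
    · rintro ⟨⟨r, hr, hrq⟩, hq⟩
      have h1 := hchord r hr
      refine habs ({r.1} ×ˢ Ioo c d) (isPreconnected_singleton.prod isPreconnected_Ioo) ?_
        ⟨r, ⟨rfl, h1.2⟩, hr⟩ ⟨hrq.symm, hq⟩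
      rintro ⟨z1, z2⟩ ⟨hz1, hz2⟩
      obtain rfl : z1 = r.1 := hz1
      exact h1.1.subset_cutInterior h1.2 (hWF hr) hz2
  have hIo : IsOpen I := by
    rw [isOpen_iff_mem_nhds]
    rintro x ⟨r, hr, rfl⟩
    have h1 := hchord r hr
    obtain ⟨ε, hε, hb⟩ := Metric.eventually_nhds_iff_ball.1
      (h1.1.eventually_of_mem_cutInterior h1.2 (hWF hr))
    filter_upwards [Metric.ball_mem_nhds r.1 hε] with x hx
    refine ⟨(x, r.2), ?_, rfl⟩
    refine habs (Metric.ball r.1 ε ×ˢ Ioo c d)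
      ((convex_ball _ _).isPreconnected.prod isPreconnected_Ioo) ?_
      ⟨r, ⟨Metric.mem_ball_self hε, h1.2⟩, hr⟩ ⟨hx, h1.2⟩
    rintro ⟨z1, z2⟩ ⟨hz1, hz2⟩
    exact (hb z1 hz1).2 z2 hz2
  have hIc : IsPreconnected I :=
    isPreconnected_connectedComponentIn.image _ continuous_fst.continuousOn
  have hbd : Bornology.IsBounded I := by
    have h1 : Bornology.IsBounded (Prod.fst '' P.region) :=
      (P.isCompact_region.image continuous_fst).isBounded
    exact h1.subset (image_mono fun q hq => interior_subset (hWF hq).1)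
  have hIoo : I = Ioo (sInf I) (sSup I) := by
    refine subset_antisymm (fun x hx => ?_)
      (IsConnected.Ioo_csInf_csSup_subset ⟨hIn, hIc⟩ hbd.bddBelow hbd.bddAbove)
    obtain ⟨ε, hε, hb⟩ := Metric.isOpen_iff.1 hIo x hx
    have h1 := csInf_le hbd.bddBelow (hb (show x - ε / 2 ∈ Metric.ball x ε by
      rw [Metric.mem_ball, Real.dist_eq, abs_lt]
      constructor <;> linarith))
    have h2 := le_csSup hbd.bddAbove (hb (show x + ε / 2 ∈ Metric.ball x ε by
      rw [Metric.mem_ball, Real.dist_eq, abs_lt]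
      constructor <;> linarith))
    exact ⟨by linarith, by linarith⟩
  have hab : sInf I < sSup I := by
    have h : p.1 ∈ I := ⟨p, hpW, rfl⟩
    rw [hIoo] at h
    exact h.1.trans h.2
  have hWeq : W = Ioo (sInf I) (sSup I) ×ˢ Ioo c d := by rw [← hIoo, hprod]
  refine ⟨sInf I, sSup I, c, d, ⟨hab, hch.1, ?_, p, hp, hWeq⟩, hWeq⟩
  intro x hx
  rw [← hIoo] at hx
  obtain ⟨q, hq, rfl⟩ := hx
  exact (hchord q hq).1

end OrthogonalPolygon

/-! ### Sides and corners of slices -/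

namespace OrthogonalPolygon

variable {P : OrthogonalPolygon} {a b c d a' b' c' d' : ℝ}

namespace IsCell

theorem subset_cutInterior (h : P.IsCell a b c d) : Ioo a b ×ˢ Ioo c d ⊆ P.cutInterior := by
  obtain ⟨-, -, -, p, -, hp⟩ := h
  rw [← hp]
  exact connectedComponentIn_subset _ _

theorem mem_interior (h : P.IsCell a b c d) {q : ℝ × ℝ} (h₁ : q.1 ∈ Ioo a b)
    (h₂ : q.2 ∈ Ioo c d) : q ∈ interior P.region :=
  (h.subset_cutInterior ⟨h₁, h₂⟩).1

theorem subset_of_isPreconnected (h : P.IsCell a b c d) {S : Set (ℝ × ℝ)} (hS : IsPreconnected S)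
    (hSF : S ⊆ P.cutInterior) {q : ℝ × ℝ} (hq : q ∈ S) (hq₁ : q.1 ∈ Ioo a b)
    (hq₂ : q.2 ∈ Ioo c d) : S ⊆ Ioo a b ×ˢ Ioo c d := by
  obtain ⟨-, -, -, p, -, hp⟩ := h
  have hqW : q ∈ connectedComponentIn P.cutInterior p := by
    rw [hp]
    exact ⟨hq₁, hq₂⟩
  rw [← hp, connectedComponentIn_eq hqW]
  exact hS.subset_connectedComponentIn hq hSF

theorem closure_eq (h : P.IsCell a b c d) :
    closure (Ioo a b ×ˢ Ioo c d) = Icc a b ×ˢ Icc c d := by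
  rw [closure_prod_eq, closure_Ioo h.1.ne, closure_Ioo h.2.1.ne]

theorem Icc_subset (h : P.IsCell a b c d) : Icc a b ×ˢ Icc c d ⊆ P.region := by
  rw [← h.closure_eq]
  exact isClosed_region.closure_subset_iff.2 fun q hq =>
    interior_subset (h.subset_cutInterior hq).1

theorem eq_of_mem (h : P.IsCell a b c d) (h' : P.IsCell a' b' c' d') {q : ℝ × ℝ}
    (h₁ : q.1 ∈ Ioo a b) (h₂ : q.2 ∈ Ioo c d) (h₁' : q.1 ∈ Ioo a' b') (h₂' : q.2 ∈ Ioo c' d') :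
    a = a' ∧ b = b' ∧ c = c' ∧ d = d' := by
  have s1 := h.subset_of_isPreconnected (isPreconnected_Ioo.prod isPreconnected_Ioo)
    h'.subset_cutInterior ⟨h₁', h₂'⟩ h₁ h₂
  have s2 := h'.subset_of_isPreconnected (isPreconnected_Ioo.prod isPreconnected_Ioo)
    h.subset_cutInterior ⟨h₁, h₂⟩ h₁' h₂'
  have e := closure_mono s1
  have e' := closure_mono s2
  rw [h.closure_eq, h'.closure_eq] at e e'
  have k1 := (e (a := (a', c')) ⟨⟨le_rfl, h'.1.le⟩, le_rfl, h'.2.1.le⟩)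
  have k2 := (e (a := (b', d')) ⟨⟨h'.1.le, le_rfl⟩, h'.2.1.le, le_rfl⟩)
  have k3 := (e' (a := (a, c)) ⟨⟨le_rfl, h.1.le⟩, le_rfl, h.2.1.le⟩)
  have k4 := (e' (a := (b, d)) ⟨⟨h.1.le, le_rfl⟩, h.2.1.le, le_rfl⟩)
  exact ⟨le_antisymm k1.1.1 k3.1.1, le_antisymm k4.1.2 k2.1.2, le_antisymm k1.2.1 k3.2.1,
    le_antisymm k4.2.2 k2.2.2⟩

theorem mem_frontier (h : P.IsCell a b c d) {x : ℝ} (hx : x ∈ Icc a b) :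
    (x, c) ∈ frontier P.region ∧ (x, d) ∈ frontier P.region := by
  have key : ∀ y, (∀ x ∈ Ioo a b, (x, y) ∈ frontier P.region) → (x, y) ∈ frontier P.region := by
    intro y hy
    rw [← closure_Ioo h.1.ne] at hx
    have hcont : Continuous fun x : ℝ => (x, y) := by fun_prop
    have := image_closure_subset_closure_image hcont (mem_image_of_mem _ hx)
    refine isClosed_frontier.closure_subset_iff.2 ?_ this
    rintro _ ⟨z, hz, rfl⟩
    exact hy z hz
  exact ⟨key c fun x hx => (h.2.2.1 x hx).2.2.1, key d fun x hx => (h.2.2.1 x hx).2.2.2⟩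

/-- If the point were neither on the boundary nor on a cut, a short horizontal segment across the
side would stay off both and enlarge the component. -/
theorem notMem_cutInterior (h : P.IsCell a b c d) {x y : ℝ} (hx : x = a ∨ x = b)
    (hy : y ∈ Ioo c d) : (x, y) ∉ P.cutInterior := by
  intro hF
  obtain ⟨c', d', h1, h2⟩ := exists_isChord hF.1
  obtain ⟨ε, hε, hb⟩ := Metric.eventually_nhds_iff_ball.1
    (h1.eventually_of_mem_cutInterior h2 hF)
  dsimp only at h2 hb
  have hSF : Metric.ball x ε ×ˢ {y} ⊆ P.cutInterior := by
    rintro ⟨z1, z2⟩ ⟨hz1, hz2⟩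
    obtain rfl : z2 = y := hz2
    exact (hb z1 hz1).2 _ h2
  have hS : IsPreconnected (Metric.ball x ε ×ˢ ({y} : Set ℝ)) :=
    (convex_ball _ _).isPreconnected.prod isPreconnected_singleton
  have hab := h.1
  have hm : 0 < min ε (b - a) / 2 := by
    have : 0 < min ε (b - a) := lt_min hε (by linarith)
    linarith
  have hm1 := min_le_left ε (b - a)
  have hm2 := min_le_right ε (b - a)
  have hself : ((x, y) : ℝ × ℝ) ∈ Metric.ball x ε ×ˢ ({y} : Set ℝ) :=
    ⟨Metric.mem_ball_self hε, rfl⟩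
  rcases hx with rfl | rfl
  · have := h.subset_of_isPreconnected hS hSF (q := (x + min ε (b - x) / 2, y))
      ⟨by rw [Metric.mem_ball, Real.dist_eq, abs_lt]; constructor <;> linarith, rfl⟩
      ⟨by linarith, by dsimp only; linarith⟩ hy hself
    exact lt_irrefl _ this.1.1
  · have := h.subset_of_isPreconnected hS hSF (q := (x - min ε (x - a) / 2, y))
      ⟨by rw [Metric.mem_ball, Real.dist_eq, abs_lt]; constructor <;> linarith, rfl⟩
      ⟨by dsimp only; linarith, by dsimp only; linarith⟩ hy hself
    exact lt_irrefl _ this.1.2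

end IsCell

/-- `v` is the corner of the rectangle `[a, b] × [c, d]` in the direction `(s, τ)`. -/
def IsCorner (a b c d s τ : ℝ) (v : ℝ × ℝ) : Prop :=
  (s = 1 ∧ v.1 = b ∨ s = -1 ∧ v.1 = a) ∧ (τ = 1 ∧ v.2 = d ∨ τ = -1 ∧ v.2 = c)

namespace IsCorner

variable {s τ : ℝ} {v : ℝ × ℝ}

theorem sign_fst (h : IsCorner a b c d s τ v) : s = 1 ∨ s = -1 := h.1.imp And.left And.left

theorem sign_snd (h : IsCorner a b c d s τ v) : τ = 1 ∨ τ = -1 := h.2.imp And.left And.left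

theorem fst_mem (h : IsCorner a b c d s τ v) {t : ℝ} (ht : 0 < t) (ht' : t < b - a) :
    v.1 - s * t ∈ Ioo a b := by
  rcases h.1 with ⟨rfl, e⟩ | ⟨rfl, e⟩ <;> rw [e] <;> constructor <;> linarith

theorem snd_mem (h : IsCorner a b c d s τ v) {t : ℝ} (ht : 0 < t) (ht' : t < d - c) :
    v.2 - τ * t ∈ Ioo c d := by
  rcases h.2 with ⟨rfl, e⟩ | ⟨rfl, e⟩ <;> rw [e] <;> constructor <;> linarith

theorem mem_frontier (h : IsCorner a b c d s τ v) (hc : P.IsCell a b c d) {t : ℝ} (ht : 0 ≤ t)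
    (ht' : t ≤ b - a) : (v.1 - s * t, v.2) ∈ frontier P.region := by
  have hm : v.1 - s * t ∈ Icc a b := by
    rcases h.1 with ⟨rfl, e⟩ | ⟨rfl, e⟩ <;> rw [e] <;> constructor <;> linarith
  rcases h.2 with ⟨rfl, e⟩ | ⟨rfl, e⟩ <;> rw [e]
  · exact (hc.mem_frontier hm).2
  · exact (hc.mem_frontier hm).1

theorem self_mem_frontier (h : IsCorner a b c d s τ v) (hc : P.IsCell a b c d) :
    v ∈ frontier P.region := by
  have := h.mem_frontier hc le_rfl (by linarith [hc.1])
  rwa [mul_zero, sub_zero] at this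

end IsCorner

/-- At a vertex, the boundary has only one horizontal direction. -/
theorem sign_eq_of_mem_frontier {v : ℝ × ℝ} (hv : v ∈ P.vertices) {s s' : ℝ}
    (hs : s = 1 ∨ s = -1) (hs' : s' = 1 ∨ s' = -1)
    (h : ∀ᶠ t : ℝ in 𝓝[>] 0, (v.1 - s * t, v.2) ∈ frontier P.region)
    (h' : ∀ᶠ t : ℝ in 𝓝[>] 0, (v.1 - s' * t, v.2) ∈ frontier P.region) : s = s' := by
  obtain ⟨s₀, τ₀, -, -, hs₀, -, -, -, hloc, -⟩ := frontier_local_of_mem_vertices hv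
  have key : ∀ s : ℝ, s = 1 ∨ s = -1 →
      (∀ᶠ t : ℝ in 𝓝[>] 0, (v.1 - s * t, v.2) ∈ frontier P.region) → s = -s₀ := by
    intro s hs h
    have hten : Filter.Tendsto (fun t : ℝ => (v.1 - s * t, v.2)) (𝓝[>] 0) (𝓝 v) := by
      have : Filter.Tendsto (fun t : ℝ => (v.1 - s * t, v.2)) (𝓝 0) (𝓝 (v.1 - s * 0, v.2)) :=
        Continuous.tendsto (by fun_prop) 0
      rw [mul_zero, sub_zero] at this
      exact this.mono_left nhdsWithin_le_nhds
    obtain ⟨t, ⟨h1, h2⟩, ht⟩ := (((hten.eventually hloc).and h).and self_mem_nhdsWithin).exists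
    rcases h1.1 h2 with ⟨k, -⟩ | ⟨-, k⟩
    · rcases hs with rfl | rfl <;> dsimp only at k <;> linarith
    · rcases hs with rfl | rfl <;> rcases hs₀ with rfl | rfl <;> dsimp only at k <;> linarith
  rw [key s hs h, key s' hs' h']

/-- A vertex is the corner of at most one slice. -/
theorem corner_unique {v : ℝ × ℝ} (hv : v ∈ P.vertices) {s τ s' τ' : ℝ}
    (hc : P.IsCell a b c d) (h : IsCorner a b c d s τ v)
    (hc' : P.IsCell a' b' c' d') (h' : IsCorner a' b' c' d' s' τ' v) :
    s = s' ∧ τ = τ' ∧ a = a' ∧ b = b' ∧ c = c' ∧ d = d' := by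
  have hab := hc.1
  have hab' := hc'.1
  have hcd := hc.2.1
  have hcd' := hc'.2.1
  have hss : s = s' := by
    refine sign_eq_of_mem_frontier hv h.sign_fst h'.sign_fst ?_ ?_
    · filter_upwards [Ioo_mem_nhdsGT (sub_pos.2 hab)] with t ht
      exact h.mem_frontier hc ht.1.le ht.2.le
    · filter_upwards [Ioo_mem_nhdsGT (sub_pos.2 hab')] with t ht
      exact h'.mem_frontier hc' ht.1.le ht.2.le
  subst hss
  obtain ⟨t, ht0, ht⟩ := exists_between (lt_min (sub_pos.2 hab) (sub_pos.2 hab'))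
  obtain ⟨u, hu0, hu⟩ := exists_between (lt_min (sub_pos.2 hcd) (sub_pos.2 hcd'))
  obtain ⟨ht1, ht2⟩ := lt_min_iff.1 ht
  obtain ⟨hu1, hu2⟩ := lt_min_iff.1 hu
  -- Otherwise the two slices lie above and below a common piece of a horizontal boundary edge,
  -- which would then be interior.
  have hττ : τ = τ' := by
    by_contra hne
    have hz := h.mem_frontier hc ht0.le ht1.le
    refine notMem_frontier_of_mem_interior (P := P) ?_ hz
    refine mem_interior_of_dense isClosed_region (dense_snd_ne v.2) ?_
    have e1 : ∀ᶠ q : ℝ × ℝ in 𝓝 (v.1 - s * t, v.2), q.1 ∈ Ioo a b :=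
      continuous_fst.continuousAt.eventually (isOpen_Ioo.mem_nhds (h.fst_mem ht0 ht1))
    have e2 : ∀ᶠ q : ℝ × ℝ in 𝓝 (v.1 - s * t, v.2), q.1 ∈ Ioo a' b' :=
      continuous_fst.continuousAt.eventually (isOpen_Ioo.mem_nhds (h'.fst_mem ht0 ht2))
    have e3 : ∀ᶠ q : ℝ × ℝ in 𝓝 (v.1 - s * t, v.2), q.2 ∈ Ioo (v.2 - u) (v.2 + u) :=
      continuous_snd.continuousAt.eventually
        (isOpen_Ioo.mem_nhds ⟨by dsimp only; linarith, by dsimp only; linarith⟩)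
    filter_upwards [e1, e2, e3] with q q1 q2 q3 q4
    refine interior_subset ?_
    have hor : 0 < -τ * (q.2 - v.2) ∨ 0 < -τ' * (q.2 - v.2) := by
      rcases h.sign_snd with rfl | rfl <;> rcases h'.sign_snd with rfl | rfl <;>
        rcases lt_or_gt_of_ne q4 with k | k <;> first
          | exact absurd rfl hne
          | (left; linarith)
          | (right; linarith)
    rcases hor with k | k
    · refine hc.mem_interior q1 ?_
      rcases h.2 with ⟨rfl, e⟩ | ⟨rfl, e⟩ <;> constructor <;> linarith [q3.1, q3.2]
    · refine hc'.mem_interior q2 ?_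
      rcases h'.2 with ⟨rfl, e⟩ | ⟨rfl, e⟩ <;> constructor <;> linarith [q3.1, q3.2]
  subst hττ
  exact ⟨rfl, rfl, hc.eq_of_mem hc' (q := (v.1 - s * t, v.2 - τ * u)) (h.fst_mem ht0 ht1)
    (h.snd_mem hu0 hu1) (h'.fst_mem ht0 ht2) (h'.snd_mem hu0 hu2)⟩

/-- If a corner of a slice is not a vertex, then the next slice has the same corner. -/
theorem exists_isCell_of_corner_notMem_vertices {v : ℝ × ℝ} (hv : v ∉ P.vertices) {s τ : ℝ}
    (hc : P.IsCell a b c d) (h : IsCorner a b c d s τ v) :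
    ∃ a' b' c' d', P.IsCell a' b' c' d' ∧ IsCorner a' b' c' d' (-s) τ v := by
  have hab := hc.1
  have hcd := hc.2.1
  have hs := h.sign_fst
  have hτ := h.sign_snd
  have hten : Filter.Tendsto (fun t : ℝ => (v.1 - s * t, v.2)) (𝓝[>] 0) (𝓝 v) := by
    have : Filter.Tendsto (fun t : ℝ => (v.1 - s * t, v.2)) (𝓝 0) (𝓝 (v.1 - s * 0, v.2)) :=
      Continuous.tendsto (by fun_prop) 0
    rw [mul_zero, sub_zero] at this
    exact this.mono_left nhdsWithin_le_nhds
  have hten' : Filter.Tendsto (fun t : ℝ => (v.1 - s * t, v.2 - τ * t)) (𝓝[>] 0) (𝓝 v) := by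
    have : Filter.Tendsto (fun t : ℝ => (v.1 - s * t, v.2 - τ * t)) (𝓝 0)
        (𝓝 (v.1 - s * 0, v.2 - τ * 0)) :=
      Continuous.tendsto (by fun_prop) 0
    rw [mul_zero, mul_zero, sub_zero, sub_zero] at this
    exact this.mono_left nhdsWithin_le_nhds
  -- The horizontal side of the slice ending at `v` consists of boundary points, so the boundary at
  -- `v` cannot be a vertical line.
  have hloc : ∀ᶠ q in 𝓝 v, q ∈ frontier P.region ↔ q.2 = v.2 := by
    refine (frontier_local_of_notMem_vertices (h.self_mem_frontier hc) hv).resolve_left ?_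
    intro hloc
    obtain ⟨t, ht1, ht2⟩ := ((hten.eventually hloc).and (Ioo_mem_nhdsGT (sub_pos.2 hab))).exists
    have := ht1.1 (h.mem_frontier hc ht2.1.le ht2.2.le)
    have ht := ht2.1
    rcases hs with rfl | rfl <;> dsimp only at this <;> linarith
  obtain ⟨ε₀, hε₀, hb, hside⟩ := exists_ball_of_frontier_horizontal hloc (τ := -τ) (by
    refine hten'.frequently (Filter.Eventually.frequently ?_)
    filter_upwards [Ioo_mem_nhdsGT (sub_pos.2 hab), Ioo_mem_nhdsGT (sub_pos.2 hcd)] with t h1 h2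
    refine ⟨?_, hc.mem_interior (h.fst_mem h1.1 h1.2) (h.snd_mem h2.1 h2.2)⟩
    have := h1.1
    rcases hτ with rfl | rfl <;> linarith)
  obtain ⟨ε₁, hε₁, hX⟩ := Metric.eventually_nhds_iff_ball.1 (eventually_fst_ne (P := P) v.1)
  obtain ⟨δ, hδ, hδ0, hδ1, hδ2⟩ : ∃ δ > 0, δ ≤ ε₀ ∧ δ ≤ ε₁ ∧ δ ≤ d - c :=
    ⟨min ε₀ (min ε₁ (d - c)), lt_min hε₀ (lt_min hε₁ (by linarith)), min_le_left _ _,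
      (min_le_right _ _).trans (min_le_left _ _), (min_le_right _ _).trans (min_le_right _ _)⟩
  -- This is the quarter disc across the vertical side. It is interior, and `δ` is small enough that
  -- no vertex, hence no cut, has a first coordinate occurring in it. It therefore lies in one
  -- slice, whose corner `v` will be.
  set H := Metric.ball v δ ∩ ({q | 0 < s * (q.1 - v.1)} ∩ {q | 0 < -τ * (q.2 - v.2)}) with hH
  have hHc : Convex ℝ H := (convex_ball _ _).inter
    ((convex_pos_mul_fst_sub _ _).inter (convex_pos_mul_snd_sub _ _))
  have hHF : H ⊆ P.cutInterior := by
    rintro q ⟨hq, hq1, hq2⟩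
    refine ⟨hside q (Metric.ball_subset_ball hδ0 hq) hq2, ?_⟩
    rintro ⟨-, w, hw, hwq, -⟩
    refine hX q.1 ?_ ?_ w hw.mem_vertices hwq
    · rw [Metric.mem_ball, Real.dist_eq]
      exact (mem_ball_prod_iff.1 hq).1.trans_le hδ1
    · intro e
      rw [mem_ofPred_eq, e, sub_self, mul_zero] at hq1
      exact lt_irrefl _ hq1
  have hmem : ∀ t u, 0 < t → t < δ → 0 < u → u < δ → (v.1 + s * t, v.2 - τ * u) ∈ H := by
    intro t u h1 h2 h3 h4
    refine ⟨mem_ball_prod_iff.2 ⟨?_, ?_⟩, ?_, ?_⟩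
    · rcases hs with rfl | rfl <;> rw [abs_lt] <;> constructor <;> dsimp only <;> linarith
    · rcases hτ with rfl | rfl <;> rw [abs_lt] <;> constructor <;> dsimp only <;> linarith
    · rw [mem_ofPred_eq]
      rcases hs with rfl | rfl <;> dsimp only <;> linarith
    · rw [mem_ofPred_eq]
      rcases hτ with rfl | rfl <;> dsimp only <;> linarith
  have h0 := hmem (δ / 2) (δ / 2) (by linarith) (by linarith) (by linarith) (by linarith)
  obtain ⟨a', b', c', d', hc', hcomp⟩ := exists_isCell (hHF h0)
  have hsub : H ⊆ Ioo a' b' ×ˢ Ioo c' d' := by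
    rw [← hcomp]
    exact hHc.isPreconnected.subset_connectedComponentIn h0 hHF
  have hcl : Icc a' b' ×ˢ Icc c' d' = closure (Ioo a' b' ×ˢ Ioo c' d') := hc'.closure_eq.symm
  have hvmem : v ∈ Icc a' b' ×ˢ Icc c' d' := by
    rw [hcl]
    have hten2 : Filter.Tendsto (fun t : ℝ => (v.1 + s * t, v.2 - τ * t)) (𝓝[>] 0) (𝓝 v) := by
      have : Filter.Tendsto (fun t : ℝ => (v.1 + s * t, v.2 - τ * t)) (𝓝 0)
          (𝓝 (v.1 + s * 0, v.2 - τ * 0)) :=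
        Continuous.tendsto (by fun_prop) 0
      rw [mul_zero, mul_zero, add_zero, sub_zero] at this
      exact this.mono_left nhdsWithin_le_nhds
    refine mem_closure_of_tendsto hten2 ?_
    filter_upwards [Ioo_mem_nhdsGT hδ] with t ht
    exact hsub (hmem t t ht.1 ht.2 ht.1 ht.2)
  have h0' := hsub h0
  -- The new slice cannot extend across the side of the old one, whose points are not in
  -- `cutInterior`; nor, in the next step, across the horizontal boundary line through `v`.
  have hv1 : v.1 ∉ Ioo a' b' := fun hh =>
    hc.notMem_cutInterior (x := v.1) (y := v.2 - τ * (δ / 2))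
      (h.1.elim (fun k => Or.inr k.2) fun k => Or.inl k.2)
      (h.snd_mem (by linarith) (by linarith)) (hc'.subset_cutInterior ⟨hh, h0'.2⟩)
  have hv2 : v.2 ∉ Ioo c' d' := fun hh => by
    refine notMem_frontier_of_mem_interior (P := P)
      (hc'.mem_interior (q := (v.1 + s * (δ / 2), v.2)) h0'.1 hh) ((hb _ ?_).2 rfl)
    refine mem_ball_prod_iff.2 ⟨?_, by simpa using hε₀⟩
    rcases hs with rfl | rfl <;> rw [abs_lt] <;> constructor <;> dsimp only <;> linarith
  refine ⟨a', b', c', d', hc', ?_, ?_⟩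
  · have k1 := hvmem.1
    have k2 := h0'.1
    rw [mem_Ioo, not_and, not_lt] at hv1
    dsimp only at k2
    rcases hs with rfl | rfl
    · refine Or.inr ⟨rfl, ?_⟩
      by_contra hne
      have := hv1 (lt_of_le_of_ne k1.1 (Ne.symm hne))
      linarith [k2.2]
    · refine Or.inl ⟨by norm_num, ?_⟩
      have : a' < v.1 := by linarith [k2.1]
      exact le_antisymm k1.2 (hv1 this)
  · have k1 := hvmem.2
    have k2 := h0'.2
    rw [mem_Ioo, not_and, not_lt] at hv2
    dsimp only at k2
    rcases hτ with rfl | rfl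
    · refine Or.inl ⟨rfl, ?_⟩
      have : c' < v.2 := by linarith [k2.1]
      exact le_antisymm k1.2 (hv2 this)
    · refine Or.inr ⟨rfl, ?_⟩
      by_contra hne
      have := hv2 (lt_of_le_of_ne k1.1 (Ne.symm hne))
      linarith [k2.2]

/-- The top side of a slice and the bottom side of a slice have no common inner points. -/
theorem IsCell.snd_ne_of_mem (h : P.IsCell a b c d) (h' : P.IsCell a' b' c' d') {x : ℝ}
    (hx : x ∈ Ioo a b) (hx' : x ∈ Ioo a' b') : d ≠ c' := by
  rintro rfl
  refine notMem_frontier_of_mem_interior (P := P) ?_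
    (h.mem_frontier (x := x) (Ioo_subset_Icc_self hx)).2
  refine mem_interior_of_dense isClosed_region (dense_snd_ne d) ?_
  have e1 : ∀ᶠ q : ℝ × ℝ in 𝓝 (x, d), q.1 ∈ Ioo a b :=
    continuous_fst.continuousAt.eventually (isOpen_Ioo.mem_nhds hx)
  have e2 : ∀ᶠ q : ℝ × ℝ in 𝓝 (x, d), q.1 ∈ Ioo a' b' :=
    continuous_fst.continuousAt.eventually (isOpen_Ioo.mem_nhds hx')
  have e3 : ∀ᶠ q : ℝ × ℝ in 𝓝 (x, d), q.2 ∈ Ioo c d' :=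
    continuous_snd.continuousAt.eventually (isOpen_Ioo.mem_nhds ⟨h.2.1, h'.2.1⟩)
  filter_upwards [e1, e2, e3] with q q1 q2 q3 q4
  rcases lt_or_gt_of_ne q4 with k | k
  · exact interior_subset (h.mem_interior q1 ⟨q3.1, k⟩)
  · exact interior_subset (h'.mem_interior q2 ⟨k, q3.2⟩)

/-- Two slices that share a segment share part of a vertical side, and not the whole side. -/
theorem IsCell.side_of_segment_subset (h : P.IsCell a b c d) (h' : P.IsCell a' b' c' d')
    (hne : ¬ (a = a' ∧ b = b' ∧ c = c' ∧ d = d')) {u v : ℝ × ℝ} (huv : u ≠ v)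
    (hu : u ∈ Icc a b ×ˢ Icc c d ∩ Icc a' b' ×ˢ Icc c' d')
    (hv : v ∈ Icc a b ×ˢ Icc c d ∩ Icc a' b' ×ˢ Icc c' d') :
    (b = a' ∨ b' = a) ∧ c < d' ∧ c' < d ∧ ¬ (c = c' ∧ d = d') := by
  have hab := h.1
  have hcd := h.2.1
  have hab' := h'.1
  have hcd' := h'.2.1
  obtain ⟨⟨⟨u1, u2⟩, u3, u4⟩, ⟨u5, u6⟩, u7, u8⟩ := hu
  obtain ⟨⟨⟨v1, v2⟩, v3, v4⟩, ⟨v5, v6⟩, v7, v8⟩ := hv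
  have hdis : ¬ ((a < b' ∧ a' < b) ∧ c < d' ∧ c' < d) := by
    rintro ⟨⟨k1, k2⟩, k3, k4⟩
    obtain ⟨x, hx1, hx2⟩ := exists_between
      (show max a a' < min b b' from max_lt (lt_min hab k1) (lt_min k2 hab'))
    obtain ⟨y, hy1, hy2⟩ := exists_between
      (show max c c' < min d d' from max_lt (lt_min hcd k3) (lt_min k4 hcd'))
    rw [max_lt_iff] at hx1 hy1
    rw [lt_min_iff] at hx2 hy2
    exact hne (h.eq_of_mem h' (q := (x, y)) ⟨hx1.1, hx2.1⟩ ⟨hy1.1, hy2.1⟩ ⟨hx1.2, hx2.2⟩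
      ⟨hy1.2, hy2.2⟩)
  -- If the horizontal ranges overlap, the height ranges do not, and the slices can only touch along
  -- horizontal sides. These are boundary edges with the interior on one side.
  have hx : ¬ (a < b' ∧ a' < b) := by
    intro hx
    have hy : ¬ (c < d' ∧ c' < d) := fun hy => hdis ⟨hx, hy⟩
    obtain ⟨x, hx1, hx2⟩ := exists_between
      (show max a a' < min b b' from max_lt (lt_min hab hx.1) (lt_min hx.2 hab'))
    rw [max_lt_iff] at hx1
    rw [lt_min_iff] at hx2
    rw [not_and_or, not_lt, not_lt] at hy
    rcases hy with hy | hy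
    · exact h'.snd_ne_of_mem h ⟨hx1.2, hx2.2⟩ ⟨hx1.1, hx2.1⟩ (by linarith)
    · exact h.snd_ne_of_mem h' ⟨hx1.1, hx2.1⟩ ⟨hx1.2, hx2.2⟩ (by linarith)
  have hside : b = a' ∨ b' = a := by
    rw [not_and_or, not_lt, not_lt] at hx
    rcases hx with hx | hx
    · right; linarith
    · left; linarith
  have hu1 : u.1 = v.1 := by
    rcases hside with rfl | rfl <;> linarith
  have hu2 : u.2 ≠ v.2 := fun e => huv (Prod.ext hu1 e)
  refine ⟨hside, ?_, ?_, ?_⟩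
  · rcases lt_or_gt_of_ne hu2 with k | k <;> linarith
  · rcases lt_or_gt_of_ne hu2 with k | k <;> linarith
  · rintro ⟨rfl, rfl⟩
    -- With equal height ranges the common side is a chord. It is off `cutInterior`, so it is a cut
    -- and one of its ends is a reflex vertex. But the boundary runs horizontally to both sides of
    -- that end, which is impossible at a vertex.
    have key : ∀ {a b a' b' : ℝ}, P.IsCell a b c d → P.IsCell a' b' c d → b ≠ a' := by
      rintro a b a' b' h h' rfl
      have hch : P.IsChord b c d := by
        refine ⟨hcd, fun y hy => ?_, h.mem_frontier ⟨h.1.le, le_rfl⟩⟩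
        refine mem_interior_of_dense isClosed_region (dense_fst_ne_snd_ne b y) ?_
        have e1 : ∀ᶠ q : ℝ × ℝ in 𝓝 (b, y), q.1 ∈ Ioo a b' :=
          continuous_fst.continuousAt.eventually (isOpen_Ioo.mem_nhds ⟨h.1, h'.1⟩)
        have e2 : ∀ᶠ q : ℝ × ℝ in 𝓝 (b, y), q.2 ∈ Ioo c d :=
          continuous_snd.continuousAt.eventually (isOpen_Ioo.mem_nhds hy)
        filter_upwards [e1, e2] with q q1 q2 q3
        rcases lt_or_gt_of_ne q3.1 with k | k
        · exact interior_subset (h.mem_interior ⟨q1.1, k⟩ q2)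
        · exact interior_subset (h'.mem_interior ⟨k, q1.2⟩ q2)
      obtain ⟨y, hy⟩ := exists_between hcd
      have hF := h.notMem_cutInterior (x := b) (Or.inr rfl) hy
      have hcut : (b, y) ∈ P.cuts Prod.fst := by
        by_contra hcut
        exact hF ⟨hch.2.1 y hy, hcut⟩
      have hcontra : ∀ z, (∀ x ∈ Icc a b, (x, z) ∈ frontier P.region) →
          (∀ x ∈ Icc b b', (x, z) ∈ frontier P.region) → (b, z) ∉ P.vertices := by
        intro z hz hz' hv
        have : (1 : ℝ) = -1 := by
          refine sign_eq_of_mem_frontier hv (Or.inl rfl) (Or.inr rfl) ?_ ?_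
          · filter_upwards [Ioo_mem_nhdsGT (sub_pos.2 h.1)] with t ht
            exact hz _ ⟨by linarith [ht.2], by linarith [ht.1]⟩
          · filter_upwards [Ioo_mem_nhdsGT (sub_pos.2 h'.1)] with t ht
            exact hz' _ ⟨by linarith [ht.1], by linarith [ht.2]⟩
        norm_num at this
      rcases (hch.mem_cuts_iff hy).1 hcut with hr | hr
      · exact hcontra c (fun x hx => (h.mem_frontier hx).1) (fun x hx => (h'.mem_frontier hx).1)
          hr.mem_vertices
      · exact hcontra d (fun x hx => (h.mem_frontier hx).2) (fun x hx => (h'.mem_frontier hx).2)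
          hr.mem_vertices
    rcases hside with e | e
    · exact key h h' e
    · exact key h' h e

/-- All cuts lie on the finitely many vertical lines through vertices, whose complement is dense.
Hence the closed slices cover the polygon. -/
theorem region_subset_closure_cutInterior : P.region ⊆ closure P.cutInterior := by
  have hfin : (Prod.fst '' P.vertices).Finite := P.finite_vertices.image _
  have hD : Dense {q : ℝ × ℝ | q.1 ∈ (Prod.fst '' P.vertices)ᶜ} := by
    have : {q : ℝ × ℝ | q.1 ∈ (Prod.fst '' P.vertices)ᶜ} = (Prod.fst '' P.vertices)ᶜ ×ˢ univ := by
      ext; simp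
    rw [this]
    exact (hfin.countable.dense_compl ℝ).prod dense_univ
  rw [← P.closure_interior_region]
  refine closure_minimal (fun q hq => ?_) isClosed_closure
  refine closure_mono ?_ (hD.open_subset_closure_inter isOpen_interior hq)
  rintro r ⟨hr, hr'⟩
  refine ⟨hr, ?_⟩
  rintro ⟨-, w, hw, hwr, -⟩
  exact hr' ⟨w, hw.mem_vertices, hwr⟩

end OrthogonalPolygon

/-! ### Path-segmentations as sequences of rectangles -/

namespace OrthogonalPolygon

variable {P : OrthogonalPolygon}

/-- The slices of the vertical segmentation are the rectangles `[aᵢ, bᵢ] × [cᵢ, dᵢ]` for `i < m`,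
and two of them are adjacent if and only if they are consecutive. -/
structure IsVerticalPath (P : OrthogonalPolygon) (m : ℕ) (a b c d : ℕ → ℝ) : Prop where
  pos : 0 < m
  isCell : ∀ i < m, P.IsCell (a i) (b i) (c i) (d i)
  cover : ∀ p ∈ P.region, ∃ i < m, p ∈ Icc (a i) (b i) ×ˢ Icc (c i) (d i)
  exists_eq : ∀ a' b' c' d', P.IsCell a' b' c' d' →
    ∃ i < m, a i = a' ∧ b i = b' ∧ c i = c' ∧ d i = d'
  inj : ∀ i < m, ∀ j < m, a i = a j → b i = b j → c i = c j → d i = d j → i = j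
  side : ∀ i, i + 1 < m → (b i = a (i + 1) ∨ b (i + 1) = a i) ∧ c i < d (i + 1) ∧
    c (i + 1) < d i ∧ ¬ (c i = c (i + 1) ∧ d i = d (i + 1))
  consecutive : ∀ i < m, ∀ j < m, b i = a j → c i < d j → c j < d i → j = i + 1 ∨ i = j + 1

theorem mem_slices_iff {s : Set (ℝ × ℝ)} : s ∈ P.slices Prod.fst ↔
    ∃ a b c d, P.IsCell a b c d ∧ s = Icc a b ×ˢ Icc c d := by
  constructor
  · rintro ⟨p, hp, rfl⟩
    obtain ⟨a, b, c, d, h, hcomp⟩ := exists_isCell hp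
    refine ⟨a, b, c, d, h, ?_⟩
    change closure (connectedComponentIn P.cutInterior p) = _
    rw [hcomp, h.closure_eq]
  · rintro ⟨a, b, c, d, h, rfl⟩
    obtain ⟨p, hp, hcomp⟩ := h.2.2.2
    refine ⟨p, hp, ?_⟩
    change _ = closure (connectedComponentIn P.cutInterior p)
    rw [hcomp, h.closure_eq]

theorem eq_of_Icc_prod_eq {a b c d a' b' c' d' : ℝ} (hab : a ≤ b) (hcd : c ≤ d) (hab' : a' ≤ b')
    (hcd' : c' ≤ d') (h : Icc a b ×ˢ Icc c d = Icc a' b' ×ˢ Icc c' d') :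
    a = a' ∧ b = b' ∧ c = c' ∧ d = d' := by
  have k1 : ((a', c') : ℝ × ℝ) ∈ Icc a b ×ˢ Icc c d := h ▸ ⟨⟨le_rfl, hab'⟩, le_rfl, hcd'⟩
  have k2 : ((b', d') : ℝ × ℝ) ∈ Icc a b ×ˢ Icc c d := h ▸ ⟨⟨hab', le_rfl⟩, hcd', le_rfl⟩
  have k3 : ((a, c) : ℝ × ℝ) ∈ Icc a' b' ×ˢ Icc c' d' := h ▸ ⟨⟨le_rfl, hab⟩, le_rfl, hcd⟩
  have k4 : ((b, d) : ℝ × ℝ) ∈ Icc a' b' ×ˢ Icc c' d' := h ▸ ⟨⟨hab, le_rfl⟩, hcd, le_rfl⟩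
  exact ⟨le_antisymm k1.1.1 k3.1.1, le_antisymm k4.1.2 k2.1.2, le_antisymm k1.2.1 k3.2.1,
    le_antisymm k4.2.2 k2.2.2⟩

theorem exists_isVerticalPath {m : ℕ} (e : P.weakDual Prod.fst ≃g SimpleGraph.pathGraph m) :
    ∃ a b c d, P.IsVerticalPath m a b c d := by
  choose a b c d hcell hslice using fun i : Fin m => mem_slices_iff.1 (e.symm i).2
  have hall : ∀ a' b' c' d', P.IsCell a' b' c' d' →
      ∃ i, a i = a' ∧ b i = b' ∧ c i = c' ∧ d i = d' := by
    intro a' b' c' d' h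
    have hs : Icc a' b' ×ˢ Icc c' d' ∈ P.slices Prod.fst :=
      mem_slices_iff.2 ⟨_, _, _, _, h, rfl⟩
    refine ⟨e ⟨_, hs⟩, ?_⟩
    have := hslice (e ⟨_, hs⟩)
    rw [e.symm_apply_apply] at this
    have k := hcell (e ⟨_, hs⟩)
    exact eq_of_Icc_prod_eq k.1.le k.2.1.le h.1.le h.2.1.le this.symm
  have hinj : ∀ i j, a i = a j → b i = b j → c i = c j → d i = d j → i = j := by
    intro i j h1 h2 h3 h4
    apply e.symm.injective
    apply Subtype.ext
    rw [hslice, hslice, h1, h2, h3, h4]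
  have hadj : ∀ i j : Fin m, (i : ℕ) + 1 = j ∨ (j : ℕ) + 1 = i ↔
      i ≠ j ∧ ∃ u v : ℝ × ℝ, u ≠ v ∧ segment ℝ u v ⊆
        Icc (a i) (b i) ×ˢ Icc (c i) (d i) ∩ Icc (a j) (b j) ×ˢ Icc (c j) (d j) := by
    intro i j
    rw [← SimpleGraph.pathGraph_adj, ← e.symm.map_adj_iff]
    change _ ≠ _ ∧ (∃ u v : ℝ × ℝ, u ≠ v ∧ segment ℝ u v ⊆ _) ↔ _
    rw [hslice, hslice, e.symm.injective.ne_iff]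
  have hcover : P.region ⊆ ⋃ i, Icc (a i) (b i) ×ˢ Icc (c i) (d i) := by
    refine region_subset_closure_cutInterior.trans (closure_minimal ?_ ?_)
    · intro p hp
      obtain ⟨a', b', c', d', h, hcomp⟩ := exists_isCell hp
      obtain ⟨i, rfl, rfl, rfl, rfl⟩ := hall _ _ _ _ h
      have := mem_connectedComponentIn hp
      rw [hcomp] at this
      exact mem_iUnion.2 ⟨i, Ioo_subset_Icc_self this.1, Ioo_subset_Icc_self this.2⟩
    · exact isClosed_iUnion_of_finite fun i => isClosed_Icc.prod isClosed_Icc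
  have hm : 0 < m := by
    obtain ⟨p, hp⟩ := P.isConnected_interior.nonempty
    obtain ⟨i, -⟩ := mem_iUnion.1 (hcover (interior_subset hp))
    exact i.pos
  -- The value 0 beyond the path is never used, since every condition is restricted to indices below
  -- `m`.
  let ext : (Fin m → ℝ) → ℕ → ℝ := fun f i => if h : i < m then f ⟨i, h⟩ else 0
  have hext : ∀ f i (h : i < m), ext f i = f ⟨i, h⟩ := fun f i h => dif_pos h
  refine ⟨ext a, ext b, ext c, ext d, hm, ?_, ?_, ?_, ?_, ?_, ?_⟩
  · intro i hi
    simp only [hext _ _ hi]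
    exact hcell _
  · intro p hp
    obtain ⟨i, hi⟩ := mem_iUnion.1 (hcover hp)
    refine ⟨i, i.2, ?_⟩
    simpa only [hext _ _ i.2] using hi
  · intro a' b' c' d' h
    obtain ⟨i, hi⟩ := hall _ _ _ _ h
    refine ⟨i, i.2, ?_⟩
    simpa only [hext _ _ i.2] using hi
  · intro i hi j hj
    simp only [hext _ _ hi, hext _ _ hj]
    intro h1 h2 h3 h4
    exact congrArg Fin.val (hinj _ _ h1 h2 h3 h4)
  · intro i hi
    have hi' : i < m := by omega
    simp only [hext _ _ hi, hext _ _ hi']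
    obtain ⟨hne, u, v, huv, hseg⟩ := (hadj ⟨i, hi'⟩ ⟨i + 1, hi⟩).1 (Or.inl rfl)
    exact (hcell _).side_of_segment_subset (hcell _)
      (fun h => hne (hinj _ _ h.1 h.2.1 h.2.2.1 h.2.2.2)) huv
      (hseg (left_mem_segment _ _ _)) (hseg (right_mem_segment _ _ _))
  · intro i hi j hj
    simp only [hext _ _ hi, hext _ _ hj]
    intro h1 h2 h3
    have k1 := hcell ⟨i, hi⟩
    have k2 := hcell ⟨j, hj⟩
    have := (hadj ⟨i, hi⟩ ⟨j, hj⟩).2 ?_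
    · rcases this with h | h
      · exact Or.inl h.symm
      · exact Or.inr h.symm
    -- The shared segment spans the intersection of the two height ranges.
    refine ⟨?_, (b ⟨i, hi⟩, max (c ⟨i, hi⟩) (c ⟨j, hj⟩)), (b ⟨i, hi⟩, min (d ⟨i, hi⟩) (d ⟨j, hj⟩)),
      ?_, ?_⟩
    · intro hij
      rw [← hij] at h1
      exact k1.1.ne' h1
    · intro hh
      refine (max_lt (lt_min k1.2.1 h2) (lt_min h3 k2.2.1)).ne (congrArg Prod.snd hh)
    · intro q hq
      rw [mem_segment_vertical, uIcc_of_le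
        (max_lt (lt_min k1.2.1 h2) (lt_min h3 k2.2.1)).le] at hq
      obtain ⟨q1, q2, q3⟩ := hq
      rw [max_le_iff] at q2
      rw [le_min_iff] at q3
      exact ⟨⟨⟨by linarith [k1.1], q1.le⟩, q2.1, q3.1⟩,
        ⟨⟨by linarith, by linarith [k2.1]⟩, q2.2, q3.2⟩⟩

/-! ### Counting slice corners against vertices -/

namespace IsVerticalPath

variable {m : ℕ} {a b c d : ℕ → ℝ}

/-- The number of ends of the side between the slices `i` and `i + 1` that are corners of both. -/
noncomputable def commonEnds (c d : ℕ → ℝ) (i : ℕ) : ℕ :=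
  (if d i = d (i + 1) then 1 else 0) + (if c i = c (i + 1) then 1 else 0)

/-- The booleans select the right and the upper side. The slice that continues beyond a non-vertex
corner has the same corner on its opposite side; the two share part of a vertical side, so they are
neighbours on the path. -/
theorem exists_consecutive_of_corner (h : P.IsVerticalPath m a b c d) {i : ℕ} (hi : i < m)
    {s τ : Bool} (hv : (cond s (b i) (a i), cond τ (d i) (c i)) ∉ P.vertices) :
    ∃ j < m, (j = i + 1 ∨ i = j + 1) ∧ cond s (b i) (a i) = cond s (a j) (b j) ∧
      cond τ (d i) (c i) = cond τ (d j) (c j) := by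
  have hcor : IsCorner (a i) (b i) (c i) (d i) (cond s 1 (-1)) (cond τ 1 (-1))
      (cond s (b i) (a i), cond τ (d i) (c i)) := by
    cases s <;> cases τ <;> simp [IsCorner]
  obtain ⟨a', b', c', d', h', hcor'⟩ :=
    exists_isCell_of_corner_notMem_vertices hv (h.isCell i hi) hcor
  obtain ⟨j, hj, rfl, rfl, rfl, rfl⟩ := h.exists_eq _ _ _ _ h'
  have e1 : cond s (b i) (a i) = cond s (a j) (b j) := by
    rcases hcor'.1 with ⟨e, e'⟩ | ⟨e, e'⟩ <;> cases s <;>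
      simp only [cond_true, cond_false] at e e' ⊢ <;> first
        | exact e'
        | (exfalso; norm_num at e)
  have e2 : cond τ (d i) (c i) = cond τ (d j) (c j) := by
    rcases hcor'.2 with ⟨e, e'⟩ | ⟨e, e'⟩ <;> cases τ <;>
      simp only [cond_true, cond_false] at e e' ⊢ <;> first
        | exact e'
        | (exfalso; norm_num at e)
  refine ⟨j, hj, ?_, e1, e2⟩
  have k1 := (h.isCell i hi).2.1
  have k2 := (h.isCell j hj).2.1
  have k3 : c i < d j := by cases τ <;> simp at e2 <;> linarith
  have k4 : c j < d i := by cases τ <;> simp at e2 <;> linarith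
  cases s
  · exact (h.consecutive j hj i hi e1.symm k4 k3).symm
  · exact h.consecutive i hi j hj e1 k3 k4

/-- Slice corners at vertices inject into the vertices. Every other slice corner is matched with a
corner of the next or of the previous slice, at a common end of the side between them, and each
common end is used at most once in either direction. -/
theorem corner_count (h : P.IsVerticalPath m a b c d) :
    4 * m ≤ P.vertices.ncard + 2 * ∑ e ∈ Finset.range (m - 1), commonEnds c d e := by
  classical
  set pt : ℕ × Bool × Bool → ℝ × ℝ :=
    fun x => (cond x.2.1 (b x.1) (a x.1), cond x.2.2 (d x.1) (c x.1)) with hpt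
  set all : Finset (ℕ × Bool × Bool) := Finset.range m ×ˢ Finset.univ with hall
  set T : Finset (ℕ × Bool) := (Finset.range (m - 1) ×ˢ Finset.univ).filter
    fun x => cond x.2 (d x.1) (c x.1) = cond x.2 (d (x.1 + 1)) (c (x.1 + 1)) with hT
  have hTcard : T.card = ∑ e ∈ Finset.range (m - 1), commonEnds c d e := by
    rw [hT, Finset.card_filter, Finset.sum_product]
    refine Finset.sum_congr rfl fun e _ => ?_
    rw [Fintype.sum_bool, commonEnds]
    rfl
  set A : Finset (ℕ × Bool × Bool) := all.filter fun x => (x.1, x.2.2) ∈ T ∧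
    cond x.2.1 (b x.1) (a x.1) = cond x.2.1 (a (x.1 + 1)) (b (x.1 + 1)) with hA
  set B : Finset (ℕ × Bool × Bool) := all.filter fun x => x.1 ≠ 0 ∧ (x.1 - 1, x.2.2) ∈ T ∧
    cond x.2.1 (b x.1) (a x.1) = cond x.2.1 (a (x.1 - 1)) (b (x.1 - 1)) with hB
  -- A given neighbour cannot touch both vertical sides of a slice. Hence the index of the neighbour
  -- and the choice of top or bottom determine the corner, and both `A` and `B` inject into `T`.
  have hdir : ∀ i < m, ∀ j < m, ∀ s s' : Bool, cond s (b i) (a i) = cond s (a j) (b j) →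
      cond s' (b i) (a i) = cond s' (a j) (b j) → s = s' := by
    intro i hi j hj s s' e e'
    have k1 := (h.isCell i hi).1
    have k2 := (h.isCell j hj).1
    cases s <;> cases s' <;> simp only [cond_true, cond_false] at e e' <;> first
      | rfl
      | (exfalso; linarith)
  have hAcard : A.card ≤ T.card := by
    refine Finset.card_le_card_of_injOn (fun x => (x.1, x.2.2)) (fun x hx => ?_) ?_
    · exact (Finset.mem_filter.1 hx).2.1
    · rintro ⟨i, s, τ⟩ hx ⟨i', s', τ'⟩ hx' hxx
      obtain ⟨-, hx1, hx2⟩ := Finset.mem_filter.1 hx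
      obtain ⟨-, -, hx3⟩ := Finset.mem_filter.1 hx'
      obtain ⟨rfl, rfl⟩ := Prod.mk.inj hxx
      have hi := Finset.mem_range.1 (Finset.mem_product.1 (Finset.mem_filter.1 hx1).1).1
      dsimp only at hi
      rw [hdir i (by omega) (i + 1) (by omega) s s' hx2 hx3]
  have hBcard : B.card ≤ T.card := by
    refine Finset.card_le_card_of_injOn (fun x => (x.1 - 1, x.2.2)) (fun x hx => ?_) ?_
    · exact (Finset.mem_filter.1 hx).2.2.1
    · rintro ⟨i, s, τ⟩ hx ⟨i', s', τ'⟩ hx' hxx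
      obtain ⟨-, hx0, hx1, hx2⟩ := Finset.mem_filter.1 hx
      obtain ⟨-, hx0', -, hx3⟩ := Finset.mem_filter.1 hx'
      obtain ⟨hii, hττ⟩ := Prod.mk.inj hxx
      dsimp only at hii hx0 hx0' hττ
      obtain rfl : i = i' := by omega
      subst hττ
      have hi := Finset.mem_range.1 (Finset.mem_product.1 (Finset.mem_filter.1 hx1).1).1
      dsimp only at hi
      rw [hdir i (by omega) (i - 1) (by omega) s s' hx2 hx3]
  have hV : (all.filter fun x => pt x ∈ P.vertices).card ≤ P.vertices.ncard := by
    rw [Set.ncard_eq_toFinset_card _ P.finite_vertices]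
    refine Finset.card_le_card_of_injOn pt (fun x hx => ?_) ?_
    · simpa using (Finset.mem_filter.1 hx).2
    · rintro ⟨i, s, τ⟩ hx ⟨i', s', τ'⟩ hx' hxx
      obtain ⟨hx1, hx2⟩ := Finset.mem_filter.1 hx
      obtain ⟨hx1', -⟩ := Finset.mem_filter.1 hx'
      have hi := Finset.mem_range.1 (Finset.mem_product.1 hx1).1
      have hi' := Finset.mem_range.1 (Finset.mem_product.1 hx1').1
      have hcor : ∀ (i : ℕ) (s τ : Bool),
          IsCorner (a i) (b i) (c i) (d i) (cond s 1 (-1)) (cond τ 1 (-1)) (pt (i, s, τ)) := by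
        intro i s τ
        cases s <;> cases τ <;> simp [IsCorner, hpt]
      have key := corner_unique hx2 (h.isCell i hi) (hcor i s τ) (h.isCell i' hi')
        (hxx ▸ hcor i' s' τ')
      obtain rfl := h.inj i hi i' hi' key.2.2.1 key.2.2.2.1 key.2.2.2.2.1 key.2.2.2.2.2
      have hb : ∀ s s' : Bool, (cond s 1 (-1) : ℝ) = cond s' 1 (-1) → s = s' := by
        intro s s'
        cases s <;> cases s' <;> norm_num
      rw [hb _ _ key.1, hb _ _ key.2.1]
  have hN : (all.filter fun x => pt x ∉ P.vertices) ⊆ A ∪ B := by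
    rintro ⟨i, s, τ⟩ hx
    obtain ⟨hx1, hx2⟩ := Finset.mem_filter.1 hx
    have hi := Finset.mem_range.1 (Finset.mem_product.1 hx1).1
    obtain ⟨j, hj, hij, e1, e2⟩ := h.exists_consecutive_of_corner hi hx2
    dsimp only at hi
    rw [Finset.mem_union]
    rcases hij with rfl | rfl
    · left
      refine Finset.mem_filter.2 ⟨hx1, Finset.mem_filter.2 ⟨?_, e2⟩, e1⟩
      exact Finset.mem_product.2 ⟨Finset.mem_range.2 (by dsimp only; omega), Finset.mem_univ _⟩
    · right
      refine Finset.mem_filter.2 ⟨hx1, by simp, Finset.mem_filter.2 ⟨?_, ?_⟩, e1⟩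
      · exact Finset.mem_product.2 ⟨Finset.mem_range.2 (by dsimp only; omega), Finset.mem_univ _⟩
      · exact e2.symm
  have hall_card : all.card = 4 * m := by
    rw [hall, Finset.card_product, Finset.card_range, Finset.card_univ, Fintype.card_prod,
      Fintype.card_bool]
    ring
  have hsplit := Finset.card_filter_add_card_filter_not (s := all) (fun x => pt x ∈ P.vertices)
  have h1 := Finset.card_le_card hN
  have h2 := Finset.card_union_le A B
  omega

end IsVerticalPath

end OrthogonalPolygon

/-! ### Guarding a path of slices -/

namespace OrthogonalPolygon

variable {P : OrthogonalPolygon}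

/-- The points of `A` can be guarded with at most `k` sliding cameras. -/
def Guards (P : OrthogonalPolygon) (A : Set (ℝ × ℝ)) (k : ℕ) : Prop :=
  ∃ S : Finset P.SlidingCamera, S.card ≤ k ∧ ∀ p ∈ A, ∃ γ ∈ S, γ.Sees p

theorem Guards.union {A B : Set (ℝ × ℝ)} {k l : ℕ} (hA : P.Guards A k) (hB : P.Guards B l) :
    P.Guards (A ∪ B) (k + l) := by
  classical
  obtain ⟨S, hS, hSA⟩ := hA
  obtain ⟨T, hT, hTB⟩ := hB
  refine ⟨S ∪ T, (Finset.card_union_le _ _).trans (by omega), ?_⟩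
  rintro p (hp | hp)
  · obtain ⟨γ, hγ, h⟩ := hSA p hp
    exact ⟨γ, Finset.mem_union_left _ hγ, h⟩
  · obtain ⟨γ, hγ, h⟩ := hTB p hp
    exact ⟨γ, Finset.mem_union_right _ hγ, h⟩

theorem Guards.mono {A B : Set (ℝ × ℝ)} {k l : ℕ} (hB : P.Guards B k) (hA : A ⊆ B) (hk : k ≤ l) :
    P.Guards A l := by
  obtain ⟨S, hS, hSB⟩ := hB
  exact ⟨S, hS.trans hk, fun p hp => hSB p (hA hp)⟩

theorem guards_one_of_horizontal {A : Set (ℝ × ℝ)} {α β y : ℝ} (hαβ : α < β)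
    (hseg : ∀ x ∈ Icc α β, (x, y) ∈ P.region)
    (hA : ∀ p ∈ A, p.1 ∈ Icc α β ∧ segment ℝ p (p.1, y) ⊆ P.region) : P.Guards A 1 := by
  have hsub : segment ℝ (α, y) (β, y) ⊆ P.region := by
    intro q hq
    rw [mem_segment_horizontal, uIcc_of_le hαβ.le] at hq
    rw [← Prod.mk.eta (p := q), hq.1]
    exact hseg _ hq.2
  refine ⟨{⟨(α, y), (β, y), fun h => hαβ.ne (congrArg Prod.fst h), Or.inr rfl, hsub⟩}, by simp,
    fun p hp => ⟨_, Finset.mem_singleton_self _, (p.1, y), ?_, ?_, (hA p hp).2⟩⟩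
  · change _ ∈ segment ℝ (α, y) (β, y)
    rw [mem_segment_horizontal, uIcc_of_le hαβ.le]
    exact ⟨rfl, (hA p hp).1⟩
  · dsimp only
    ring

theorem guards_one_of_vertical {A : Set (ℝ × ℝ)} {x γ δ : ℝ} (hγδ : γ < δ)
    (hseg : ∀ y ∈ Icc γ δ, (x, y) ∈ P.region)
    (hA : ∀ p ∈ A, p.2 ∈ Icc γ δ ∧ segment ℝ p (x, p.2) ⊆ P.region) : P.Guards A 1 := by
  have hsub : segment ℝ (x, γ) (x, δ) ⊆ P.region := by
    intro q hq
    rw [mem_segment_vertical, uIcc_of_le hγδ.le] at hq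
    rw [← Prod.mk.eta (p := q), hq.1]
    exact hseg _ hq.2
  refine ⟨{⟨(x, γ), (x, δ), fun h => hγδ.ne (congrArg Prod.snd h), Or.inl rfl, hsub⟩}, by simp,
    fun p hp => ⟨_, Finset.mem_singleton_self _, (x, p.2), ?_, ?_, (hA p hp).2⟩⟩
  · change _ ∈ segment ℝ (x, γ) (x, δ)
    rw [mem_segment_vertical, uIcc_of_le hγδ.le]
    exact ⟨rfl, (hA p hp).1⟩
  · dsimp only
    ring

namespace IsVerticalPath

variable {m : ℕ} {a b c d : ℕ → ℝ}

/-- The slice with index `i`. -/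
def slice (a b c d : ℕ → ℝ) (i : ℕ) : Set (ℝ × ℝ) := Icc (a i) (b i) ×ˢ Icc (c i) (d i)

theorem slice_subset (h : P.IsVerticalPath m a b c d) {i : ℕ} (hi : i < m) :
    slice a b c d i ⊆ P.region := (h.isCell i hi).Icc_subset

theorem touching (h : P.IsVerticalPath m a b c d) {i : ℕ} (hi : i + 1 < m) :
    a i ≤ b (i + 1) ∧ a (i + 1) ≤ b i := by
  have h1 := (h.isCell i (by omega)).1
  have h2 := (h.isCell (i + 1) hi).1
  rcases (h.side i hi).1 with e | e <;> constructor <;> linarith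

/-- Three slices, each touching the next one, are seen by a horizontal camera at a common height. -/
theorem guards_of_common_height (h : P.IsVerticalPath m a b c d) {i j k : ℕ} (hi : i < m)
    (hj : j < m) (hk : k < m) (hij : a i ≤ b j ∧ a j ≤ b i) (hjk : a j ≤ b k ∧ a k ≤ b j) {y : ℝ}
    (hyi : y ∈ Icc (c i) (d i)) (hyj : y ∈ Icc (c j) (d j)) (hyk : y ∈ Icc (c k) (d k)) :
    P.Guards (slice a b c d i ∪ slice a b c d j ∪ slice a b c d k) 1 := by
  have key : ∀ l < m, y ∈ Icc (c l) (d l) → ∀ p ∈ slice a b c d l,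
      segment ℝ p (p.1, y) ⊆ P.region := by
    intro l hl hy p hp
    have hp' : (p.1, y) ∈ slice a b c d l := ⟨hp.1, hy⟩
    exact (((convex_Icc _ _).prod (convex_Icc _ _)).segment_subset hp hp').trans
      (h.slice_subset hl)
  have h1 := (h.isCell i hi).1
  refine guards_one_of_horizontal (α := min (a i) (min (a j) (a k)))
    (β := max (b i) (max (b j) (b k))) (y := y)
    ((min_le_left _ _).trans_lt (h1.trans_le (le_max_left _ _))) ?_ ?_
  · rintro x ⟨hx1, hx2⟩
    rw [min_le_iff, min_le_iff] at hx1
    rw [le_max_iff, le_max_iff] at hx2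
    -- The horizontal ranges touch from one slice to the next, so their union has no gaps. A point
    -- of the hull lying outside all three contradicts the inequalities in every case.
    by_contra hx
    have hout : ∀ l < m, y ∈ Icc (c l) (d l) → x < a l ∨ b l < x := by
      intro l hl hy
      by_contra! hcon
      exact hx (h.slice_subset hl ⟨hcon, hy⟩)
    have o1 := hout i hi hyi
    have o2 := hout j hj hyj
    have o3 := hout k hk hyk
    have h2 := (h.isCell j hj).1
    have h3 := (h.isCell k hk).1
    rcases o1 with o1 | o1 <;> rcases o2 with o2 | o2 <;> rcases o3 with o3 | o3 <;>
      rcases hx1 with k1 | k1 | k1 <;> rcases hx2 with k2 | k2 | k2 <;> linarith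
  · rintro p ((hp | hp) | hp)
    · exact ⟨⟨(min_le_left _ _).trans hp.1.1, hp.1.2.trans (le_max_left _ _)⟩, key i hi hyi p hp⟩
    · exact ⟨⟨((min_le_right _ _).trans (min_le_left _ _)).trans hp.1.1,
        hp.1.2.trans ((le_max_left _ _).trans (le_max_right _ _))⟩, key j hj hyj p hp⟩
    · exact ⟨⟨((min_le_right _ _).trans (min_le_right _ _)).trans hp.1.1,
        hp.1.2.trans ((le_max_right _ _).trans (le_max_right _ _))⟩, key k hk hyk p hp⟩

/-- A slice and two slices touching it with smaller height ranges are seen by a vertical camera. -/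
theorem guards_of_middle_tall (h : P.IsVerticalPath m a b c d) {i j k : ℕ} (hi : i < m)
    (hj : j < m) (hk : k < m) (hij : a i ≤ b j ∧ a j ≤ b i) (hjk : a j ≤ b k ∧ a k ≤ b j)
    (hi' : Icc (c i) (d i) ⊆ Icc (c j) (d j)) (hk' : Icc (c k) (d k) ⊆ Icc (c j) (d j)) :
    P.Guards (slice a b c d i ∪ slice a b c d j ∪ slice a b c d k) 1 := by
  have h2 := (h.isCell j hj).1
  have hmem : a j ∈ Icc (a j) (b j) := ⟨le_rfl, h2.le⟩
  have key : ∀ l < m, a l ≤ b j → a j ≤ b l → Icc (c l) (d l) ⊆ Icc (c j) (d j) →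
      ∀ p ∈ slice a b c d l, p.2 ∈ Icc (c j) (d j) ∧ segment ℝ p (a j, p.2) ⊆ P.region := by
    intro l hl e1 e2 hlj p hp
    refine ⟨hlj hp.2, fun q hq => ?_⟩
    rw [mem_segment_of_snd_eq (u := p) (v := (a j, p.2)) rfl] at hq
    obtain ⟨hq1, hq2⟩ := hq
    have h3 := (h.isCell l hl).1
    have hp1 := hp.1
    -- The line of sight stays in its own slice until it leaves the horizontal range of that slice.
    -- From there to the camera it runs within the range of the middle slice, which contains its
    -- height.
    by_cases hql : q.1 ∈ Icc (a l) (b l)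
    · exact h.slice_subset hl ⟨hql, hq1 ▸ hp.2⟩
    · refine h.slice_subset hj ⟨?_, hq1 ▸ hlj hp.2⟩
      rw [mem_Icc, not_and_or, not_le, not_le] at hql
      rcases le_total p.1 (a j) with hle | hle
      · rw [uIcc_of_le hle] at hq2
        rcases hql with k | k <;> constructor <;> linarith [hq2.1, hq2.2, hp1.1, hp1.2]
      · rw [uIcc_of_ge hle] at hq2
        rcases hql with k | k <;> constructor <;> linarith [hq2.1, hq2.2, hp1.1, hp1.2]
  refine guards_one_of_vertical (x := a j) (h.isCell j hj).2.1
    (fun y hy => h.slice_subset hj ⟨hmem, hy⟩) ?_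
  rintro p ((hp | hp) | hp)
  · exact key i hi hij.1 hij.2 hi' p hp
  · exact key j hj h2.le h2.le subset_rfl p hp
  · exact key k hk hjk.2 hjk.1 hk' p hp

theorem guards_one_slice (h : P.IsVerticalPath m a b c d) {i : ℕ} (hi : i < m) :
    P.Guards (slice a b c d i) 1 := by
  have h1 := h.isCell i hi
  have hy : c i ∈ Icc (c i) (d i) := ⟨le_rfl, h1.2.1.le⟩
  exact (h.guards_of_common_height hi hi hi ⟨h1.1.le, h1.1.le⟩ ⟨h1.1.le, h1.1.le⟩ hy hy hy).mono
    subset_union_right le_rfl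

theorem guards_two_slices (h : P.IsVerticalPath m a b c d) {i : ℕ} (hi : i + 1 < m) :
    P.Guards (slice a b c d i ∪ slice a b c d (i + 1)) 1 := by
  have hi' : i < m := by omega
  have ht := h.touching hi
  have h1 := (h.isCell i hi').2.1
  have h2 := (h.isCell (i + 1) hi).2.1
  have hs := (h.side i hi).2
  have hy : max (c i) (c (i + 1)) ∈ Icc (c i) (d i) :=
    ⟨le_max_left _ _, max_le h1.le hs.2.1.le⟩
  have hy' : max (c i) (c (i + 1)) ∈ Icc (c (i + 1)) (d (i + 1)) :=
    ⟨le_max_right _ _, max_le hs.1.le h2.le⟩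
  refine (h.guards_of_common_height hi' hi hi' ht ht.symm hy hy' hy).mono
    subset_union_left le_rfl

/-- A common end makes two height ranges nested. If the middle range contains both others, a
vertical camera in the middle slice suffices. Otherwise one outer range contains the middle one, and
a height common to the middle and the other outer slice is common to all three. -/
theorem guards_three_slices (h : P.IsVerticalPath m a b c d) {i : ℕ} (hi : i + 2 < m)
    (h₁ : c i = c (i + 1) ∨ d i = d (i + 1)) (h₂ : c (i + 1) = c (i + 2) ∨ d (i + 1) = d (i + 2)) :
    P.Guards (slice a b c d i ∪ slice a b c d (i + 1) ∪ slice a b c d (i + 2)) 1 := by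
  have hi0 : i < m := by omega
  have hi1 : i + 1 < m := by omega
  have ht := h.touching hi1
  have ht' := h.touching hi
  have k0 := (h.isCell i hi0).2.1
  have k1 := (h.isCell (i + 1) hi1).2.1
  have k2 := (h.isCell (i + 2) hi).2.1
  have s1 := (h.side i hi1).2
  have s2 := (h.side (i + 1) hi).2
  rw [show i + 1 + 1 = i + 2 from rfl] at ht' s2
  by_cases n1 : c (i + 1) ≤ c i ∧ d i ≤ d (i + 1)
  · by_cases n2 : c (i + 1) ≤ c (i + 2) ∧ d (i + 2) ≤ d (i + 1)
    · exact h.guards_of_middle_tall hi0 hi1 hi ht ht' (Icc_subset_Icc n1.1 n1.2)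
        (Icc_subset_Icc n2.1 n2.2)
    · have n2' : c (i + 2) ≤ c (i + 1) ∧ d (i + 1) ≤ d (i + 2) := by
        rw [not_and_or, not_le, not_le] at n2
        rcases h₂ with e | e <;> rcases n2 with n2 | n2 <;> constructor <;> linarith
      refine h.guards_of_common_height hi0 hi1 hi ht ht' (y := max (c i) (c (i + 1)))
        ⟨le_max_left _ _, max_le k0.le s1.2.1.le⟩ ⟨le_max_right _ _, max_le s1.1.le k1.le⟩ ?_
      exact ⟨n2'.1.trans (le_max_right _ _), (max_le s1.1.le k1.le).trans n2'.2⟩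
  · have n1' : c i ≤ c (i + 1) ∧ d (i + 1) ≤ d i := by
      rw [not_and_or, not_le, not_le] at n1
      rcases h₁ with e | e <;> rcases n1 with n1 | n1 <;> constructor <;> linarith
    refine h.guards_of_common_height hi0 hi1 hi ht ht' (y := max (c (i + 1)) (c (i + 2))) ?_
      ⟨le_max_left _ _, max_le k1.le s2.2.1.le⟩ ⟨le_max_right _ _, max_le s2.1.le k2.le⟩
    exact ⟨n1'.1.trans (le_max_left _ _), (max_le k1.le s2.2.1.le).trans n1'.2⟩

theorem commonEnds_le_one (h : P.IsVerticalPath m a b c d) {i : ℕ} (hi : i + 1 < m) :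
    commonEnds c d i ≤ 1 := by
  have := (h.side i hi).2.2.2
  unfold commonEnds
  split_ifs <;> simp_all

theorem eq_or_eq_of_commonEnds_ne_zero {i : ℕ} (h : commonEnds c d i ≠ 0) :
    c i = c (i + 1) ∨ d i = d (i + 1) := by
  unfold commonEnds at h
  split_ifs at h <;> simp_all

/-- The slices from index `i` on. -/
def tail (m : ℕ) (a b c d : ℕ → ℝ) (i : ℕ) : Set (ℝ × ℝ) :=
  {p | ∃ j, i ≤ j ∧ j < m ∧ p ∈ slice a b c d j}

theorem tail_subset (i : ℕ) : tail m a b c d i ⊆ slice a b c d i ∪ tail m a b c d (i + 1) := by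
  rintro p ⟨j, hij, hj, hp⟩
  rcases hij.eq_or_lt with rfl | hlt
  · exact Or.inl hp
  · exact Or.inr ⟨j, hlt, hj, hp⟩

theorem tail_of_le {i : ℕ} (hi : m ≤ i) : tail m a b c d i = ∅ := by
  ext p
  simp only [tail, mem_ofPred_eq, mem_empty_iff_false, iff_false]
  rintro ⟨j, hij, hj, -⟩
  omega

/-- Greedy induction in which each shared side has weight 2, or 1 if it has a common end. The
leading 1 pays for the last camera, and every earlier camera must use up weight at least 3. -/
theorem guards_tail (h : P.IsVerticalPath m a b c d) (i : ℕ) (hi : i < m) :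
    P.Guards (tail m a b c d i)
      (1 + (∑ e ∈ Finset.Ico i (m - 1), (2 - commonEnds c d e)) / 3) := by
  induction hl : m - i using Nat.strong_induction_on generalizing i with
  | _ l ih =>
    subst hl
    have hstep : ∀ j < m - 1, ∑ e ∈ Finset.Ico j (m - 1), (2 - commonEnds c d e) =
        (2 - commonEnds c d j) + ∑ e ∈ Finset.Ico (j + 1) (m - 1), (2 - commonEnds c d e) :=
      fun j hj => Finset.sum_eq_sum_Ico_succ_bot hj _
    have t0 := tail_subset (m := m) (a := a) (b := b) (c := c) (d := d) i
    have t1 := tail_subset (m := m) (a := a) (b := b) (c := c) (d := d) (i + 1)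
    have t2 := tail_subset (m := m) (a := a) (b := b) (c := c) (d := d) (i + 2)
    have t01 : tail m a b c d i ⊆
        slice a b c d i ∪ slice a b c d (i + 1) ∪ tail m a b c d (i + 2) := by
      rw [union_assoc]
      exact t0.trans (union_subset_union_right _ t1)
    have t012 : tail m a b c d i ⊆ slice a b c d i ∪ slice a b c d (i + 1) ∪
        slice a b c d (i + 2) ∪ tail m a b c d (i + 3) := by
      rw [union_assoc]
      exact t01.trans (union_subset_union_right _ t2)
    rcases Nat.lt_or_ge (i + 1) m with hi1 | hi1
    swap
    · refine (h.guards_one_slice hi).mono (t0.trans ?_) (by omega)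
      rw [tail_of_le hi1, union_empty]
    rcases Nat.lt_or_ge (i + 2) m with hi2 | hi2
    swap
    · refine (h.guards_two_slices hi1).mono (t01.trans ?_) (by omega)
      rw [tail_of_le hi2, union_empty]
    have e0 := hstep i (by omega)
    have e1 := hstep (i + 1) (by omega)
    have c0 := h.commonEnds_le_one hi1
    have c1 := h.commonEnds_le_one hi2
    by_cases hn : commonEnds c d i = 0 ∨ commonEnds c d (i + 1) = 0
    -- Two slices are removed together with two shared sides, one of weight 2 and the other of
    -- weight at least 1.
    · refine ((h.guards_two_slices hi1).union (ih (m - (i + 2)) (by omega) (i + 2) hi2 rfl)).mono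
        t01 ?_
      rw [show i + 1 + 1 = i + 2 from rfl] at e1
      omega
    · rw [not_or] at hn
      have g := h.guards_three_slices hi2 (eq_or_eq_of_commonEnds_ne_zero hn.1)
        (eq_or_eq_of_commonEnds_ne_zero hn.2)
      rcases Nat.lt_or_ge (i + 3) m with hi3 | hi3
      -- Three slices are removed together with three shared sides, each of weight at least 1.
      · have e2 := hstep (i + 2) (by omega)
        have c2 := h.commonEnds_le_one hi3
        refine (g.union (ih (m - (i + 3)) (by omega) (i + 3) hi3 rfl)).mono t012 ?_
        rw [show i + 1 + 1 = i + 2 from rfl] at e1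
        rw [show i + 2 + 1 = i + 3 from rfl] at e2
        omega
      · refine g.mono (t012.trans ?_) (by omega)
        rw [tail_of_le hi3, union_empty]

/-- With `t` the sum of `commonEnds`, the number of cameras is `1 + ⌊(2(m - 1) - t)/3⌋ = ⌊(4m - 2t +
2)/6⌋`, and the corner count bounds `4m - 2t` by the number of vertices. -/
theorem guardableWith (h : P.IsVerticalPath m a b c d) :
    P.GuardableWith ((P.numVertices + 2) / 6) := by
  have h1 := h.corner_count
  have h2 := P.ncard_vertices_le
  have h3 : ∑ e ∈ Finset.range (m - 1), (2 - commonEnds c d e) +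
      ∑ e ∈ Finset.range (m - 1), commonEnds c d e = 2 * (m - 1) := by
    rw [← Finset.sum_add_distrib, Finset.sum_congr rfl (g := fun _ => 2), Finset.sum_const,
      Finset.card_range, smul_eq_mul, mul_comm]
    intro e he
    have := h.commonEnds_le_one (i := e) (by rw [Finset.mem_range] at he; omega)
    omega
  have hm := h.pos
  have hg := h.guards_tail 0 hm
  rw [← Finset.range_eq_Ico] at hg
  refine hg.mono (fun p hp => ?_) (by omega)
  obtain ⟨i, hi, hip⟩ := h.cover p hp
  exact ⟨i, Nat.zero_le _, hi, hip⟩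

end IsVerticalPath

end OrthogonalPolygon

/-! ### Reflection at the diagonal: from the vertical to the horizontal segmentation -/

theorem preimage_swap_segment (u v : ℝ × ℝ) :
    Prod.swap ⁻¹' segment ℝ u v = segment ℝ u.swap v.swap := by
  have h := image_segment ℝ (LinearEquiv.prodComm ℝ ℝ ℝ).toLinearMap.toAffineMap u v
  rw [← Set.image_swap_eq_preimage_swap]
  exact h

theorem preimage_swap_openSegment (u v : ℝ × ℝ) :
    Prod.swap ⁻¹' openSegment ℝ u v = openSegment ℝ u.swap v.swap := by
  have h := image_openSegment ℝ (LinearEquiv.prodComm ℝ ℝ ℝ).toLinearMap.toAffineMap u v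
  rw [← Set.image_swap_eq_preimage_swap]
  exact h

theorem preimage_swap_connectedComponentIn (F : Set (ℝ × ℝ)) {p : ℝ × ℝ} (hp : p ∈ F) :
    Prod.swap ⁻¹' connectedComponentIn F p = connectedComponentIn (Prod.swap ⁻¹' F) p.swap := by
  have h := (Homeomorph.prodComm ℝ ℝ).image_connectedComponentIn hp
  rw [← Set.image_swap_eq_preimage_swap]
  exact h

/-- The mirror image of a curve at the diagonal. -/
def OrthogonalCycle.swap (c : OrthogonalCycle) : OrthogonalCycle where
  len := c.len
  vertex i := (c.vertex i).swap
  vertex_ne i h := c.vertex_ne i (Prod.swap_injective h)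
  axisParallel i := (c.axisParallel i).symm
  alternating i := by
    -- The ends of every edge agree in exactly one coordinate, so the alternation condition is
    -- equivalent to its mirror image.
    have h1 := c.axisParallel i
    have h2 := c.axisParallel (i + 1)
    have h3 := c.alternating i
    have h4 : ¬ ((c.vertex i).1 = (c.vertex (i + 1)).1 ∧ (c.vertex i).2 = (c.vertex (i + 1)).2) :=
      fun h => c.vertex_ne i (Prod.ext h.1 h.2)
    have h5 : ¬ ((c.vertex (i + 1)).1 = (c.vertex (i + 1 + 1)).1 ∧
        (c.vertex (i + 1)).2 = (c.vertex (i + 1 + 1)).2) :=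
      fun h => c.vertex_ne (i + 1) (Prod.ext h.1 h.2)
    simp only [Prod.fst_swap, Prod.snd_swap]
    tauto
  simple i j h1 h2 h3 := by
    rw [← preimage_swap_segment, ← preimage_swap_segment]
    exact (c.simple i j h1 h2 h3).preimage _

theorem OrthogonalCycle.curve_swap (c : OrthogonalCycle) :
    c.swap.curve = Prod.swap ⁻¹' c.curve := by
  rw [OrthogonalCycle.curve, OrthogonalCycle.curve, preimage_iUnion]
  exact iUnion_congr fun i => (preimage_swap_segment _ _).symm

namespace OrthogonalPolygon

/-- The mirror image of a polygon at the diagonal. -/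
def swap (P : OrthogonalPolygon) : OrthogonalPolygon where
  numCycles := P.numCycles
  cycle i := (P.cycle i).swap
  cycles_disjoint i j h := by
    rw [OrthogonalCycle.curve_swap, OrthogonalCycle.curve_swap]
    exact (P.cycles_disjoint i j h).preimage _
  region := Prod.swap ⁻¹' P.region
  isCompact_region := (Homeomorph.prodComm ℝ ℝ).isCompact_preimage.2 P.isCompact_region
  closure_interior_region := by
    have h1 := (Homeomorph.prodComm ℝ ℝ).preimage_interior P.region
    have h2 := (Homeomorph.prodComm ℝ ℝ).preimage_closure (interior P.region)
    rw [P.closure_interior_region, h1] at h2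
    exact h2.symm
  isConnected_interior := by
    have h1 := (Homeomorph.prodComm ℝ ℝ).preimage_interior P.region
    have h2 := (Homeomorph.prodComm ℝ ℝ).isConnected_preimage.2 P.isConnected_interior
    rw [h1] at h2
    exact h2
  frontier_region := by
    have h1 := (Homeomorph.prodComm ℝ ℝ).preimage_frontier P.region
    rw [P.frontier_region, Homeomorph.coe_prodComm, preimage_iUnion] at h1
    rw [← h1]
    exact iUnion_congr fun i => (OrthogonalCycle.curve_swap _).symm

variable {P : OrthogonalPolygon}

theorem interior_region_swap : interior P.swap.region = Prod.swap ⁻¹' interior P.region :=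
  ((Homeomorph.prodComm ℝ ℝ).preimage_interior P.region).symm

theorem isReflexVertex_swap {v : ℝ × ℝ} : P.swap.IsReflexVertex v ↔ P.IsReflexVertex v.swap := by
  have key : ∀ (u v w : ℝ × ℝ) (t : ℝ), v + t • (u.swap - v) + t • (w.swap - v) ∈ P.swap.region ↔
      v.swap + t • (u - v.swap) + t • (w - v.swap) ∈ P.region := fun u v w t => Iff.rfl
  constructor
  · rintro ⟨c, i, h1, h2⟩
    refine ⟨c, i, Prod.swap_injective (h1.trans (Prod.swap_swap v).symm), ?_⟩
    filter_upwards [h2] with t ht h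
    exact ht ((key _ _ _ _).2 h)
  · rintro ⟨c, i, h1, h2⟩
    refine ⟨c, i, ?_, ?_⟩
    · change ((P.cycle c).vertex i).swap = v
      rw [h1, Prod.swap_swap]
    · filter_upwards [h2] with t ht h
      exact ht ((key _ _ _ _).1 h)

theorem cuts_swap : P.swap.cuts Prod.fst = Prod.swap ⁻¹' P.cuts Prod.snd := by
  have hs : ∀ v q : ℝ × ℝ, openSegment ℝ v q ⊆ interior P.swap.region ↔
      openSegment ℝ v.swap q.swap ⊆ interior P.region := by
    intro v q
    rw [interior_region_swap, ← image_subset_iff, Set.image_swap_eq_preimage_swap,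
      preimage_swap_openSegment]
  ext q
  constructor
  · rintro ⟨hq, v, hv, hvq, hseg⟩
    rw [interior_region_swap] at hq
    exact ⟨hq, v.swap, isReflexVertex_swap.1 hv, hvq, (hs _ _).1 hseg⟩
  · rintro ⟨hq, v, hv, hvq, hseg⟩
    refine ⟨by rw [interior_region_swap]; exact hq, v.swap,
      isReflexVertex_swap.2 (by rwa [Prod.swap_swap]), hvq, (hs _ _).2 ?_⟩
    rwa [Prod.swap_swap]

theorem preimage_swap_mem_slices {s : Set (ℝ × ℝ)} (hs : s ∈ P.slices Prod.snd) :
    Prod.swap ⁻¹' s ∈ P.swap.slices Prod.fst := by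
  obtain ⟨p, hp, rfl⟩ := hs
  refine ⟨p.swap, ?_, ?_⟩
  · rw [interior_region_swap, cuts_swap]
    exact hp
  · rw [interior_region_swap, cuts_swap, ← preimage_sdiff,
      ← preimage_swap_connectedComponentIn _ hp]
    exact (Homeomorph.prodComm ℝ ℝ).preimage_closure _

theorem preimage_swap_mem_slices' {s : Set (ℝ × ℝ)} (hs : s ∈ P.swap.slices Prod.fst) :
    Prod.swap ⁻¹' s ∈ P.slices Prod.snd := by
  obtain ⟨p, hp, rfl⟩ := hs
  rw [interior_region_swap, cuts_swap, ← preimage_sdiff] at hp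
  refine ⟨p.swap, hp, ?_⟩
  rw [interior_region_swap, cuts_swap, ← preimage_sdiff]
  have h := preimage_swap_connectedComponentIn
    (Prod.swap ⁻¹' (interior P.region \ P.cuts Prod.snd)) hp
  rw [← preimage_comp, Prod.swap_swap_eq, preimage_id] at h
  rw [← h]
  exact (Homeomorph.prodComm ℝ ℝ).preimage_closure _

theorem preimage_swap_preimage_swap (s : Set (ℝ × ℝ)) : Prod.swap ⁻¹' (Prod.swap ⁻¹' s) = s := by
  rw [← preimage_comp, Prod.swap_swap_eq, preimage_id]

/-- The horizontal segmentation of `P` is the vertical segmentation of its mirror image. -/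
def weakDualSwap (P : OrthogonalPolygon) : P.swap.weakDual Prod.fst ≃g P.weakDual Prod.snd where
  toFun s := ⟨Prod.swap ⁻¹' s.1, preimage_swap_mem_slices' s.2⟩
  invFun s := ⟨Prod.swap ⁻¹' s.1, preimage_swap_mem_slices s.2⟩
  left_inv s := Subtype.ext (preimage_swap_preimage_swap _)
  right_inv s := Subtype.ext (preimage_swap_preimage_swap _)
  map_rel_iff' := by
    have key : ∀ (a b : ℝ × ℝ) (s t : Set (ℝ × ℝ)), segment ℝ a b ⊆ s ∩ t →
        segment ℝ a.swap b.swap ⊆ Prod.swap ⁻¹' s ∩ Prod.swap ⁻¹' t := by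
      intro a b s t h
      rw [← preimage_swap_segment]
      exact preimage_mono h
    intro s t
    constructor
    · rintro ⟨hne, a, b, hab, h⟩
      refine ⟨fun e => hne (e ▸ rfl), a.swap, b.swap, fun e => hab (Prod.swap_injective e), ?_⟩
      have := key a b _ _ h
      rwa [Equiv.coe_fn_mk, preimage_swap_preimage_swap, preimage_swap_preimage_swap] at this
    · rintro ⟨hne, a, b, hab, h⟩
      refine ⟨fun e => hne (Subtype.ext ?_), a.swap, b.swap,
        fun e => hab (Prod.swap_injective e), key a b _ _ h⟩
      have := congrArg (fun x => Prod.swap ⁻¹' x.1) e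
      simpa only [Equiv.coe_fn_mk, preimage_swap_preimage_swap] using this

/-- The mirror image of a sliding camera. -/
def SlidingCamera.unswap (γ : P.swap.SlidingCamera) : P.SlidingCamera where
  a := γ.a.swap
  b := γ.b.swap
  ne h := γ.ne (Prod.swap_injective h)
  axisParallel := γ.axisParallel.symm
  subset_region := by
    rw [← preimage_swap_segment, ← preimage_swap_preimage_swap P.region]
    exact preimage_mono γ.subset_region

theorem SlidingCamera.Sees.unswap {γ : P.swap.SlidingCamera} {p : ℝ × ℝ} (h : γ.Sees p) :
    γ.unswap.Sees p.swap := by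
  obtain ⟨g, hg, h1, h2⟩ := h
  refine ⟨g.swap, ?_, ?_, ?_⟩
  · change g.swap ∈ segment ℝ γ.a.swap γ.b.swap
    rw [← preimage_swap_segment, mem_preimage, Prod.swap_swap]
    exact hg
  · change (γ.b.2 - γ.a.2) * (g.2 - p.2) + (γ.b.1 - γ.a.1) * (g.1 - p.1) = 0
    linarith
  · rw [← preimage_swap_segment, ← preimage_swap_preimage_swap P.region]
    exact preimage_mono h2

theorem GuardableWith.of_swap {k : ℕ} (h : P.swap.GuardableWith k) : P.GuardableWith k := by
  classical
  obtain ⟨S, hS, hSee⟩ := h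
  refine ⟨S.image SlidingCamera.unswap, Finset.card_image_le.trans hS, fun p hp => ?_⟩
  obtain ⟨γ, hγ, h⟩ := hSee p.swap (by
    change p.swap.swap ∈ P.region
    rwa [Prod.swap_swap])
  exact ⟨γ.unswap, Finset.mem_image_of_mem _ hγ, by simpa using h.unswap⟩

theorem HasPathSegmentation.guardableWith (h : P.HasPathSegmentation) :
    P.GuardableWith ((P.numVertices + 2) / 6) := by
  rcases h with ⟨m, ⟨e⟩⟩ | ⟨m, ⟨e⟩⟩
  · obtain ⟨a, b, c, d, h⟩ := exists_isVerticalPath e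
    exact h.guardableWith
  · obtain ⟨a, b, c, d, h⟩ := exists_isVerticalPath (P.weakDualSwap.trans e)
    exact h.guardableWith.of_swap

end OrthogonalPolygon

/-! ### Coordinates and edges of the staircase -/

namespace Staircase

/-- The left end of the brick `k`. The bricks are alternately horizontal and vertical. -/
def left (k : ℕ) : ℤ := if k % 2 = 0 then 2 * k - 3 else 2 * k - 1

/-- The right end of the brick `k`. -/
def right (k : ℕ) : ℤ := if k % 2 = 0 then 2 * k + 4 else 2 * k + 2

/-- The lower end of the brick `k`. -/
def bottom (k : ℕ) : ℤ := if k % 2 = 0 then 2 * k else 2 * k - 2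

/-- The upper end of the brick `k`. -/
def top (k : ℕ) : ℤ := if k % 2 = 0 then 2 * k + 3 else 2 * k + 5

/-- The first coordinates of the vertices of the staircase with `m` bricks: first the lower chain,
then the upper chain backwards. -/
def X (m k : ℕ) : ℤ :=
  if k ≤ m then (if k = 0 then -3 else if k % 2 = 0 then 2 * k else 2 * k + 2)
  else if k = m + 1 ∧ m % 2 = 1 then 2 * m + 2
  else if k % 2 = 0 then 2 * (2 * m + 1 - k) - 1 else 2 * (2 * m + 1 - k) - 3

/-- The second coordinates of the vertices of the staircase with `m` bricks. -/
def Y (m k : ℕ) : ℤ :=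
  if k ≤ m then (if k = m ∧ m % 2 = 0 then 2 * m + 3 else if k % 2 = 0 then 2 * k else 2 * k - 2)
  else if k % 2 = 0 then 2 * (2 * m + 1 - k) + 1 else 2 * (2 * m + 1 - k) + 3

/-- The index of the next vertex. -/
def next (m k : ℕ) : ℕ := if k = 2 * m + 1 then 0 else k + 1

/-- The vertex with index `k`. -/
def pt (m k : ℕ) : ℝ × ℝ := (X m k, Y m k)

theorem X_eq_iff (m k l : ℕ) : (pt m k).1 = (pt m l).1 ↔ X m k = X m l := by simp [pt]

theorem Y_eq_iff (m k l : ℕ) : (pt m k).2 = (pt m l).2 ↔ Y m k = Y m l := by simp [pt]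

theorem next_eq_succ {m k : ℕ} (hk : k < 2 * m + 1) : next m k = k + 1 := if_neg hk.ne

theorem next_lt {m k : ℕ} (hk : k < 2 * m + 2) : next m k < 2 * m + 2 := by
  unfold next
  split_ifs <;> first | contradiction | omega

theorem next_eq_or (m k : ℕ) : (k = 2 * m + 1 ∧ next m k = 0) ∨ (k ≠ 2 * m + 1 ∧ next m k = k + 1) := by
  unfold next
  split_ifs with h
  · exact Or.inl ⟨h, rfl⟩
  · exact Or.inr ⟨h, rfl⟩

/-- The edges of the lower chain. -/
theorem lower_edge {m k : ℕ} (hk : k < m) :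
    (k % 2 = 0 ∧ Y m k = 2 * k ∧ Y m (next m k) = 2 * k ∧ X m (next m k) = 2 * k + 4 ∧
      (k = 0 ∧ X m k = -3 ∨ 0 < k ∧ X m k = 2 * k)) ∨
    (k % 2 = 1 ∧ X m k = 2 * k + 2 ∧ X m (next m k) = 2 * k + 2 ∧ Y m k = 2 * k - 2 ∧
      (k + 1 < m ∧ Y m (next m k) = 2 * k + 2 ∨ k + 1 = m ∧ Y m (next m k) = 2 * k + 5)) := by
  rw [next_eq_succ (by omega)]
  rcases Nat.mod_two_eq_zero_or_one k with h | h
  · refine Or.inl ⟨h, ?_, ?_, ?_, ?_⟩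
    · unfold Y; split_ifs <;> first | contradiction | omega
    · unfold Y; split_ifs <;> first | contradiction | omega
    · unfold X; split_ifs <;> first | contradiction | omega
    · unfold X; split_ifs <;> first | contradiction | omega
  · refine Or.inr ⟨h, ?_, ?_, ?_, ?_⟩
    · unfold X; split_ifs <;> first | contradiction | omega
    · unfold X; split_ifs <;> first | contradiction | omega
    · unfold Y; split_ifs <;> first | contradiction | omega
    · unfold Y; split_ifs <;> first | contradiction | omega

/-- The edge that closes the staircase at the end. -/
theorem last_edge {m : ℕ} (hm : 1 ≤ m) :
    (m % 2 = 1 ∧ X m m = 2 * m + 2 ∧ X m (next m m) = 2 * m + 2 ∧ Y m m = 2 * m - 2 ∧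
      Y m (next m m) = 2 * m + 1) ∨
    (m % 2 = 0 ∧ Y m m = 2 * m + 3 ∧ Y m (next m m) = 2 * m + 3 ∧ X m m = 2 * m ∧
      X m (next m m) = 2 * m - 3) := by
  rw [next_eq_succ (by omega)]
  rcases Nat.mod_two_eq_zero_or_one m with h | h
  · refine Or.inr ⟨h, ?_, ?_, ?_, ?_⟩
    · unfold Y; split_ifs <;> first | contradiction | omega
    · unfold Y; split_ifs <;> first | contradiction | omega
    · unfold X; split_ifs <;> first | contradiction | omega
    · unfold X; split_ifs <;> first | contradiction | omega
  · refine Or.inl ⟨h, ?_, ?_, ?_, ?_⟩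
    · unfold X; split_ifs <;> first | contradiction | omega
    · unfold X; split_ifs <;> first | contradiction | omega
    · unfold Y; split_ifs <;> first | contradiction | omega
    · unfold Y; split_ifs <;> first | contradiction | omega

/-- The edges of the upper chain. -/
theorem upper_edge {m j k : ℕ} (hj : j < m) (hk : k + j = 2 * m) :
    (j % 2 = 0 ∧ Y m k = 2 * j + 3 ∧ Y m (next m k) = 2 * j + 3 ∧ X m (next m k) = 2 * j - 3 ∧
      (j + 1 < m ∧ X m k = 2 * j + 1 ∨ j + 1 = m ∧ X m k = 2 * j + 4)) ∨
    (j % 2 = 1 ∧ X m k = 2 * j - 1 ∧ X m (next m k) = 2 * j - 1 ∧ Y m k = 2 * j + 5 ∧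
      Y m (next m k) = 2 * j + 1) := by
  rw [next_eq_succ (by omega)]
  rcases Nat.mod_two_eq_zero_or_one j with h | h
  · refine Or.inl ⟨h, ?_, ?_, ?_, ?_⟩
    · unfold Y; split_ifs <;> first | contradiction | omega
    · unfold Y; split_ifs <;> first | contradiction | omega
    · unfold X; split_ifs <;> first | contradiction | omega
    · unfold X; split_ifs <;> first | contradiction | omega
  · refine Or.inr ⟨h, ?_, ?_, ?_, ?_⟩
    · unfold X; split_ifs <;> first | contradiction | omega
    · unfold X; split_ifs <;> first | contradiction | omega
    · unfold Y; split_ifs <;> first | contradiction | omega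
    · unfold Y; split_ifs <;> first | contradiction | omega

/-- The edge that closes the staircase at the beginning. -/
theorem first_edge {m : ℕ} (hm : 1 ≤ m) :
    X m (2 * m + 1) = -3 ∧ X m (next m (2 * m + 1)) = -3 ∧ Y m (2 * m + 1) = 3 ∧
      Y m (next m (2 * m + 1)) = 0 := by
  rw [show next m (2 * m + 1) = 0 from if_pos rfl]
  refine ⟨?_, ?_, ?_, ?_⟩
  · unfold X; split_ifs <;> first | contradiction | omega
  · unfold X; split_ifs <;> first | contradiction | omega
  · unfold Y; split_ifs <;> first | contradiction | omega
  · unfold Y; split_ifs <;> first | contradiction | omega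

theorem index_cases {m k : ℕ} (hk : k < 2 * m + 2) :
    k < m ∨ k = m ∨ (∃ j < m, k + j = 2 * m) ∨ k = 2 * m + 1 := by
  by_cases h : m < k ∧ k < 2 * m + 1
  · exact Or.inr (Or.inr (Or.inl ⟨2 * m - k, by omega, by omega⟩))
  · omega

/-- The position of the edge `k` of the staircase. -/
def EdgeSpec (m k : ℕ) : Prop :=
  (k < m ∧ k % 2 = 0 ∧ Y m k = 2 * k ∧ Y m (next m k) = 2 * k ∧ X m (next m k) = 2 * k + 4 ∧
      2 * (k : ℤ) - 3 ≤ X m k ∧ X m k ≤ 2 * k ∧ (k = 0 ∨ X m k = 2 * k)) ∨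
  (k < m ∧ k % 2 = 1 ∧ X m k = 2 * k + 2 ∧ X m (next m k) = 2 * k + 2 ∧ Y m k = 2 * k - 2 ∧
      2 * (k : ℤ) + 2 ≤ Y m (next m k) ∧ Y m (next m k) ≤ 2 * k + 5 ∧
      (k + 1 = m ∨ Y m (next m k) = 2 * k + 2)) ∨
  (k = m ∧ k % 2 = 1 ∧ X m k = 2 * k + 2 ∧ X m (next m k) = 2 * k + 2 ∧ Y m k = 2 * k - 2 ∧
      Y m (next m k) = 2 * k + 1) ∨
  (k = m ∧ k % 2 = 0 ∧ Y m k = 2 * k + 3 ∧ Y m (next m k) = 2 * k + 3 ∧ X m k = 2 * k ∧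
      X m (next m k) = 2 * k - 3) ∨
  (∃ j < m, k + j = 2 * m ∧ j % 2 = 0 ∧ Y m k = 2 * j + 3 ∧ Y m (next m k) = 2 * j + 3 ∧
      X m (next m k) = 2 * j - 3 ∧ 2 * (j : ℤ) + 1 ≤ X m k ∧ X m k ≤ 2 * j + 4 ∧
      (j + 1 = m ∨ X m k = 2 * j + 1)) ∨
  (∃ j < m, k + j = 2 * m ∧ j % 2 = 1 ∧ X m k = 2 * j - 1 ∧ X m (next m k) = 2 * j - 1 ∧
      Y m k = 2 * j + 5 ∧ Y m (next m k) = 2 * j + 1) ∨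
  (k = 2 * m + 1 ∧ X m k = -3 ∧ X m (next m k) = -3 ∧ Y m k = 3 ∧ Y m (next m k) = 0)

theorem edgeSpec {m k : ℕ} (hm : 1 ≤ m) (hk : k < 2 * m + 2) : EdgeSpec m k := by
  unfold EdgeSpec
  rcases index_cases hk with h | rfl | ⟨j, hj, h⟩ | rfl
  · rcases lower_edge h with h' | h'
    · exact Or.inl (by omega)
    · exact Or.inr (Or.inl (by omega))
  · rcases last_edge hm with h' | h'
    · exact Or.inr (Or.inr (Or.inl (by omega)))
    · exact Or.inr (Or.inr (Or.inr (Or.inl (by omega))))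
  · rcases upper_edge hj h with h' | h'
    · exact Or.inr (Or.inr (Or.inr (Or.inr (Or.inl ⟨j, by omega⟩))))
    · exact Or.inr (Or.inr (Or.inr (Or.inr (Or.inr (Or.inl ⟨j, by omega⟩)))))
  · have := first_edge hm
    exact Or.inr (Or.inr (Or.inr (Or.inr (Or.inr (Or.inr (by omega))))))

theorem X_eq_or_Y_eq {m k : ℕ} (hm : 1 ≤ m) (hk : k < 2 * m + 2) :
    (X m k = X m (next m k) ∧ Y m k ≠ Y m (next m k)) ∨
      (X m k ≠ X m (next m k) ∧ Y m k = Y m (next m k)) := by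
  rcases edgeSpec hm hk with h | h | h | h | ⟨j, h⟩ | ⟨j, h⟩ | h <;> omega

theorem X_eq_next_iff {m k : ℕ} (hm : 1 ≤ m) (hk : k < 2 * m + 2) :
    X m k = X m (next m k) ↔ Y m (next m k) = Y m (next m (next m k)) := by
  have hn := next_eq_or m k
  have h' := edgeSpec hm (next_lt hk)
  generalize hl : next m k = l at *
  have h := edgeSpec hm hk
  unfold EdgeSpec at h
  rw [hl] at h
  rcases h with h | h | h | h | ⟨j, h⟩ | ⟨j, h⟩ | h <;>
    rcases h' with h' | h' | h' | h' | ⟨j', h'⟩ | ⟨j', h'⟩ | h' <;> omega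

-- Non-consecutive edges are separated by a vertical or horizontal line. `EdgeSpec` describes each
-- type of edge by linear conditions, so every pair of types is decided by integer arithmetic, in
-- some cases after comparing the positions of the two edges along the chains.
set_option maxHeartbeats 2000000 in
theorem edges_separated {m k l : ℕ} (hm : 1 ≤ m) (hk : k < 2 * m + 2) (hl : l < 2 * m + 2)
    (h₁ : k ≠ l) (h₂ : l ≠ next m k) (h₃ : k ≠ next m l) :
    (max (X m k) (X m (next m k)) < min (X m l) (X m (next m l)) ∨
      max (X m l) (X m (next m l)) < min (X m k) (X m (next m k))) ∨
    (max (Y m k) (Y m (next m k)) < min (Y m l) (Y m (next m l)) ∨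
      max (Y m l) (Y m (next m l)) < min (Y m k) (Y m (next m k))) := by
  have hnk := next_eq_or m k
  have hnl := next_eq_or m l
  have hk := edgeSpec hm hk
  have hl := edgeSpec hm hl
  unfold EdgeSpec at hk hl
  generalize next m k = k' at *
  generalize next m l = l' at *
  simp only [max_lt_iff, lt_min_iff]
  rcases hk with h | h | h | h | ⟨j, h⟩ | ⟨j, h⟩ | h <;>
    rcases hl with h' | h' | h' | h' | ⟨j', h'⟩ | ⟨j', h'⟩ | h' <;>
    first
      | (right; left; omega)
      | (right; right; omega)
      | (left; left; omega)
      | (left; right; omega)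
      | (rcases lt_trichotomy k l with ho | ho | ho <;> first
          | (exfalso; omega)
          | (right; left; omega)
          | (right; right; omega)
          | (left; left; omega)
          | (left; right; omega))
      | (rcases lt_trichotomy k j' with ho | ho | ho <;> first
          | (exfalso; omega)
          | (right; left; omega)
          | (right; right; omega)
          | (left; left; omega)
          | (left; right; omega))
      | (rcases lt_trichotomy j l with ho | ho | ho <;> first
          | (exfalso; omega)
          | (right; left; omega)
          | (right; right; omega)
          | (left; left; omega))

end Staircase

theorem mem_segment_iff_of_axisParallel {u v q : ℝ × ℝ} (h : u.1 = v.1 ∨ u.2 = v.2) :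
    q ∈ segment ℝ u v ↔ q.1 ∈ uIcc u.1 v.1 ∧ q.2 ∈ uIcc u.2 v.2 := by
  rcases h with h | h
  · rw [mem_segment_of_fst_eq h, ← h, uIcc_self, mem_singleton_iff]
  · rw [mem_segment_of_snd_eq h, ← h, uIcc_self, mem_singleton_iff, and_comm]

/-! ### The staircase as an orthogonal polygon -/

namespace Staircase

/-- The brick `k`. -/
def brick (k : ℕ) : Set (ℝ × ℝ) :=
  Icc (left k : ℝ) (right k) ×ˢ Icc (bottom k : ℝ) (top k)

/-- The interior of the brick `k`. -/
def openBrick (k : ℕ) : Set (ℝ × ℝ) :=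
  Ioo (left k : ℝ) (right k) ×ˢ Ioo (bottom k : ℝ) (top k)

/-- The staircase with `m` bricks. -/
def region (m : ℕ) : Set (ℝ × ℝ) := ⋃ k ∈ Iio m, brick k

/-- The interior of the staircase with `m` bricks. -/
def inner (m : ℕ) : Set (ℝ × ℝ) := ⋃ k ∈ Iio m, openBrick k

theorem mem_region {m : ℕ} {q : ℝ × ℝ} : q ∈ region m ↔ ∃ k < m, q ∈ brick k := by
  simp [region]

theorem mem_inner {m : ℕ} {q : ℝ × ℝ} : q ∈ inner m ↔ ∃ k < m, q ∈ openBrick k := by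
  simp [inner]

theorem mem_brick_even {k : ℕ} (h : k % 2 = 0) {q : ℝ × ℝ} : q ∈ brick k ↔
    (2 * k - 3 ≤ q.1 ∧ q.1 ≤ 2 * k + 4) ∧ 2 * k ≤ q.2 ∧ q.2 ≤ 2 * k + 3 := by
  rw [brick, mem_prod, mem_Icc, mem_Icc]
  simp [left, right, bottom, top, h]

theorem mem_brick_odd {k : ℕ} (h : k % 2 = 1) {q : ℝ × ℝ} : q ∈ brick k ↔
    (2 * k - 1 ≤ q.1 ∧ q.1 ≤ 2 * k + 2) ∧ 2 * k - 2 ≤ q.2 ∧ q.2 ≤ 2 * k + 5 := by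
  rw [brick, mem_prod, mem_Icc, mem_Icc]
  simp [left, right, bottom, top, h]

theorem mem_openBrick_even {k : ℕ} (h : k % 2 = 0) {q : ℝ × ℝ} : q ∈ openBrick k ↔
    (2 * k - 3 < q.1 ∧ q.1 < 2 * k + 4) ∧ 2 * k < q.2 ∧ q.2 < 2 * k + 3 := by
  simp [openBrick, mem_prod, left, right, bottom, top, h]

theorem mem_openBrick_odd {k : ℕ} (h : k % 2 = 1) {q : ℝ × ℝ} : q ∈ openBrick k ↔
    (2 * k - 1 < q.1 ∧ q.1 < 2 * k + 2) ∧ 2 * k - 2 < q.2 ∧ q.2 < 2 * k + 5 := by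
  simp [openBrick, mem_prod, left, right, bottom, top, h]

theorem left_lt_right (k : ℕ) : left k < right k := by
  unfold left right
  split_ifs <;> omega

theorem bottom_lt_top (k : ℕ) : bottom k < top k := by
  unfold bottom top
  split_ifs <;> omega

theorem closure_openBrick (k : ℕ) : closure (openBrick k) = brick k := by
  have h1 : (left k : ℝ) ≠ right k := by exact_mod_cast (left_lt_right k).ne
  have h2 : (bottom k : ℝ) ≠ top k := by exact_mod_cast (bottom_lt_top k).ne
  rw [openBrick, closure_prod_eq, closure_Ioo h1, closure_Ioo h2, brick]

theorem openBrick_subset_brick (k : ℕ) : openBrick k ⊆ brick k :=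
  prod_mono Ioo_subset_Icc_self Ioo_subset_Icc_self

theorem isOpen_inner (m : ℕ) : IsOpen (inner m) :=
  isOpen_biUnion fun _ _ => isOpen_Ioo.prod isOpen_Ioo

theorem isCompact_region (m : ℕ) : IsCompact (region m) :=
  (finite_Iio m).isCompact_biUnion fun _ _ => isCompact_Icc.prod isCompact_Icc

theorem inner_subset_region (m : ℕ) : inner m ⊆ region m :=
  iUnion₂_mono fun k _ => openBrick_subset_brick k

theorem closure_inner (m : ℕ) : closure (inner m) = region m := by
  rw [inner, (finite_Iio m).closure_biUnion]
  exact iUnion₂_congr fun k _ => closure_openBrick k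

theorem isConnected_inner {m : ℕ} (hm : 1 ≤ m) : IsConnected (inner m) := by
  refine IsConnected.biUnion_of_chain ⟨0, hm⟩ ordConnected_Iio (fun k _ => ?_) fun k _ _ => ?_
  · have h1 : (left k : ℝ) < right k := by exact_mod_cast left_lt_right k
    have h2 : (bottom k : ℝ) < top k := by exact_mod_cast bottom_lt_top k
    exact (isConnected_Ioo h1).prod (isConnected_Ioo h2)
  · rw [Nat.succ_eq_succ]
    rcases Nat.mod_two_eq_zero_or_one k with h | h
    · refine ⟨(2 * k + 2, 2 * k + 1), (mem_openBrick_even h).2 ?_,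
        (mem_openBrick_odd (by omega)).2 ?_⟩ <;> push_cast <;>
        refine ⟨⟨?_, ?_⟩, ?_, ?_⟩ <;> linarith
    · refine ⟨(2 * k + 1, 2 * k + 3), (mem_openBrick_odd h).2 ?_,
        (mem_openBrick_even (by omega)).2 ?_⟩ <;> push_cast <;>
        refine ⟨⟨?_, ?_⟩, ?_, ?_⟩ <;> linarith

/-- The edge with index `k`. -/
def edge (m k : ℕ) : Set (ℝ × ℝ) := segment ℝ (pt m k) (pt m (next m k))

theorem axisParallel_pt {m k : ℕ} (hm : 1 ≤ m) (hk : k < 2 * m + 2) :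
    (pt m k).1 = (pt m (next m k)).1 ∨ (pt m k).2 = (pt m (next m k)).2 := by
  rw [X_eq_iff, Y_eq_iff]
  exact (X_eq_or_Y_eq hm hk).imp And.left And.right

theorem mem_edge_iff {m k : ℕ} (hm : 1 ≤ m) (hk : k < 2 * m + 2) {q : ℝ × ℝ} :
    q ∈ edge m k ↔ q.1 ∈ uIcc (X m k : ℝ) (X m (next m k)) ∧
      q.2 ∈ uIcc (Y m k : ℝ) (Y m (next m k)) :=
  mem_segment_iff_of_axisParallel (axisParallel_pt hm hk)

theorem edge_disjoint {m k l : ℕ} (hm : 1 ≤ m) (hk : k < 2 * m + 2) (hl : l < 2 * m + 2)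
    (h₁ : k ≠ l) (h₂ : l ≠ next m k) (h₃ : k ≠ next m l) : Disjoint (edge m k) (edge m l) := by
  rw [Set.disjoint_left]
  intro q hq hq'
  rw [mem_edge_iff hm hk] at hq
  rw [mem_edge_iff hm hl] at hq'
  simp only [uIcc, mem_Icc] at hq hq'
  rcases edges_separated hm hk hl h₁ h₂ h₃ with (h | h) | h | h
  all_goals
    have h' : ((_ : ℤ) : ℝ) < ((_ : ℤ) : ℝ) := Int.cast_lt.2 h
    push_cast at h'
    linarith [hq.1.1, hq.1.2, hq.2.1, hq.2.2, hq'.1.1, hq'.1.2, hq'.2.1, hq'.2.2]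

theorem val_succ {m : ℕ} (i : Fin (2 * m + 1 + 1)) : ((i + 1 : Fin _) : ℕ) = next m i := by
  rw [Fin.val_add_one, next]
  simp only [Fin.ext_iff, Fin.val_last]

/-- The boundary curve of the staircase with `m` bricks. -/
def cycle (m : ℕ) (hm : 1 ≤ m) : OrthogonalCycle :=
  { len := 2 * m + 1 + 1
    vertex := fun i => pt m i
    vertex_ne := fun i h => by
      rw [val_succ] at h
      have h1 := (X_eq_iff _ _ _).1 (congrArg Prod.fst h)
      have h2 := (Y_eq_iff _ _ _).1 (congrArg Prod.snd h)
      rcases X_eq_or_Y_eq hm i.2 with h' | h'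
      · exact h'.2 h2
      · exact h'.1 h1
    axisParallel := fun i => by
      rw [val_succ]
      exact axisParallel_pt hm i.2
    alternating := fun i => by
      simp only [val_succ, X_eq_iff, Y_eq_iff]
      exact X_eq_next_iff hm i.2
    simple := fun i j h₁ h₂ h₃ => by
      rw [val_succ, val_succ]
      refine edge_disjoint hm i.2 j.2 (fun h => h₁ (Fin.ext h)) (fun h => h₂ (Fin.ext ?_))
        (fun h => h₃ (Fin.ext ?_)) <;> rw [val_succ] <;> exact h }

theorem curve_cycle (m : ℕ) (hm : 1 ≤ m) : (cycle m hm).curve = ⋃ k ∈ Iio (2 * m + 2), edge m k := by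
  ext q
  rw [OrthogonalCycle.curve, mem_iUnion, mem_iUnion₂]
  constructor
  · rintro ⟨i, hi⟩
    refine ⟨i, i.2, ?_⟩
    rw [edge, ← val_succ i]
    exact hi
  · rintro ⟨k, hk, h⟩
    refine ⟨⟨k, hk⟩, ?_⟩
    rw [edge, ← val_succ ⟨k, hk⟩] at h
    exact h

theorem exists_brick_of_edge {m k : ℕ} (hm : 1 ≤ m) (hk : k < 2 * m + 2) : ∃ b < m,
    ((left b ≤ X m k ∧ X m k ≤ right b) ∧ bottom b ≤ Y m k ∧ Y m k ≤ top b) ∧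
    (left b ≤ X m (next m k) ∧ X m (next m k) ≤ right b) ∧
      bottom b ≤ Y m (next m k) ∧ Y m (next m k) ≤ top b := by
  unfold left right bottom top
  rcases edgeSpec hm hk with h | h | h | h | ⟨j, h⟩ | ⟨j, h⟩ | h
  · exact ⟨k, h.1, by simp only [h.2.1, if_true]; omega⟩
  · exact ⟨k, h.1, by simp only [h.2.1, one_ne_zero, if_false]; omega⟩
  -- The closing edge has index `m`, but it lies on the last brick, which has index `m - 1`.
  · exact ⟨m - 1, by omega, by simp only [show (m - 1) % 2 = 0 by omega, if_true]; omega⟩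
  · exact ⟨m - 1, by omega,
      by simp only [show (m - 1) % 2 = 1 by omega, one_ne_zero, if_false]; omega⟩
  · exact ⟨j, h.1, by simp only [h.2.2.1, if_true]; omega⟩
  · exact ⟨j, h.1, by simp only [h.2.2.1, one_ne_zero, if_false]; omega⟩
  · exact ⟨0, hm, by simp only [Nat.zero_mod, if_true]; omega⟩

theorem edge_subset_region {m k : ℕ} (hm : 1 ≤ m) (hk : k < 2 * m + 2) :
    edge m k ⊆ region m := by
  obtain ⟨b, hb, ⟨⟨h1, h2⟩, h3, h4⟩, ⟨h5, h6⟩, h7, h8⟩ := exists_brick_of_edge hm hk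
  intro q hq
  refine mem_region.2 ⟨b, hb, ?_⟩
  refine ((convex_Icc _ _).prod (convex_Icc _ _)).segment_subset ?_ ?_ hq
  · exact ⟨⟨Int.cast_le.2 h1, Int.cast_le.2 h2⟩, Int.cast_le.2 h3, Int.cast_le.2 h4⟩
  · exact ⟨⟨Int.cast_le.2 h5, Int.cast_le.2 h6⟩, Int.cast_le.2 h7, Int.cast_le.2 h8⟩

/-- The bricks climb to the upper right, so each edge has one diagonal direction leading out of all
bricks at once: to the lower right in the first alternative, to the upper left in the second. -/
theorem outside_direction {m k : ℕ} (hm : 1 ≤ m) (hk : k < 2 * m + 2) :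
    (∀ b < m, (right b ≤ X m k ∧ right b ≤ X m (next m k)) ∨
      (Y m k ≤ bottom b ∧ Y m (next m k) ≤ bottom b)) ∨
    (∀ b < m, (X m k ≤ left b ∧ X m (next m k) ≤ left b) ∨
      (top b ≤ Y m k ∧ top b ≤ Y m (next m k))) := by
  unfold left right bottom top
  rcases edgeSpec hm hk with h | h | h | h | ⟨j, h⟩ | ⟨j, h⟩ | h
  · left; intro b hb; split_ifs <;> omega
  · left; intro b hb; split_ifs <;> omega
  · left; intro b hb; split_ifs <;> omega
  · right; intro b hb; split_ifs <;> omega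
  · right; intro b hb; split_ifs <;> omega
  · right; intro b hb; split_ifs <;> omega
  · right; intro b hb; split_ifs <;> omega

theorem notMem_interior_of_mem_edge {m k : ℕ} (hm : 1 ≤ m) (hk : k < 2 * m + 2) {q : ℝ × ℝ}
    (hq : q ∈ edge m k) : q ∉ interior (region m) := by
  intro hint
  have hlim : ∀ σ : ℝ, ∀ᶠ t : ℝ in 𝓝[>] 0, (q.1 + σ * t, q.2 - σ * t) ∈ region m := by
    intro σ
    have hten : Filter.Tendsto (fun t : ℝ => (q.1 + σ * t, q.2 - σ * t)) (𝓝 0)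
        (𝓝 (q.1 + σ * 0, q.2 - σ * 0)) := Continuous.tendsto (by fun_prop) 0
    rw [mul_zero, add_zero, sub_zero] at hten
    exact (hten.mono_left nhdsWithin_le_nhds).eventually (mem_interior_iff_mem_nhds.1 hint)
  rw [mem_edge_iff hm hk] at hq
  simp only [uIcc, mem_Icc, min_le_iff, le_max_iff] at hq
  obtain ⟨⟨q1, q2⟩, q3, q4⟩ := hq
  rcases outside_direction hm hk with h | h
  · obtain ⟨t, ht, ht0⟩ := ((hlim 1).and self_mem_nhdsWithin).exists
    obtain ⟨b, hb, ⟨⟨b1, b2⟩, b3, b4⟩⟩ := mem_region.1 ht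
    dsimp only at b1 b2 b3 b4
    replace ht0 : 0 < t := ht0
    rcases h b hb with ⟨k1, k2⟩ | ⟨k1, k2⟩
    · have k1' : (right b : ℝ) ≤ X m k := Int.cast_le.2 k1
      have k2' : (right b : ℝ) ≤ X m (next m k) := Int.cast_le.2 k2
      rcases q1 with q1 | q1 <;> linarith
    · have k1' : (Y m k : ℝ) ≤ bottom b := Int.cast_le.2 k1
      have k2' : (Y m (next m k) : ℝ) ≤ bottom b := Int.cast_le.2 k2
      rcases q4 with q4 | q4 <;> linarith
  · obtain ⟨t, ht, ht0⟩ := ((hlim (-1)).and self_mem_nhdsWithin).exists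
    obtain ⟨b, hb, ⟨⟨b1, b2⟩, b3, b4⟩⟩ := mem_region.1 ht
    dsimp only at b1 b2 b3 b4
    replace ht0 : 0 < t := ht0
    rcases h b hb with ⟨k1, k2⟩ | ⟨k1, k2⟩
    · have k1' : (X m k : ℝ) ≤ left b := Int.cast_le.2 k1
      have k2' : (X m (next m k) : ℝ) ≤ left b := Int.cast_le.2 k2
      rcases q2 with q2 | q2 <;> linarith
    · have k1' : (top b : ℝ) ≤ Y m k := Int.cast_le.2 k1
      have k2' : (top b : ℝ) ≤ Y m (next m k) := Int.cast_le.2 k2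
      rcases q3 with q3 | q3 <;> linarith

end Staircase

namespace Staircase

variable {m k : ℕ} {q : ℝ × ℝ}

theorem mem_edge_of_le (hm : 1 ≤ m) (hk : k < 2 * m + 2)
    (h₁ : X m k ≤ q.1 ∧ q.1 ≤ X m (next m k) ∨ X m (next m k) ≤ q.1 ∧ q.1 ≤ X m k)
    (h₂ : Y m k ≤ q.2 ∧ q.2 ≤ Y m (next m k) ∨ Y m (next m k) ≤ q.2 ∧ q.2 ≤ Y m k) :
    ∃ k < 2 * m + 2, q ∈ edge m k :=
  ⟨k, hk, (mem_edge_iff hm hk).2 ⟨mem_uIcc.2 h₁, mem_uIcc.2 h₂⟩⟩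

theorem mem_lower_even (hm : 1 ≤ m) (hk : k < m) (h : k % 2 = 0) (h₂ : q.2 = 2 * k)
    (h₁ : k = 0 ∨ 2 * k ≤ q.1) (h₁' : 2 * k - 3 ≤ q.1) (h₁'' : q.1 ≤ 2 * k + 4) :
    ∃ k < 2 * m + 2, q ∈ edge m k := by
  obtain ⟨-, e1, e2, e3, e4⟩ := (lower_edge hk).resolve_right (by omega)
  refine mem_edge_of_le hm (by omega : k < 2 * m + 2) (Or.inl ⟨?_, ?_⟩) (Or.inl ⟨?_, ?_⟩)
  · rcases e4 with ⟨rfl, e4⟩ | ⟨hk0, e4⟩ <;> rw [e4] <;> push_cast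
    · simpa using h₁'
    · exact h₁.resolve_left hk0.ne'
  · rw [e3]; push_cast; linarith
  · rw [e1]; push_cast; linarith
  · rw [e2]; push_cast; linarith

theorem mem_lower_odd (hm : 1 ≤ m) (hk : k < m) (h : k % 2 = 1) (h₁ : q.1 = 2 * k + 2)
    (h₂ : 2 * k - 2 ≤ q.2) (h₂' : q.2 ≤ 2 * k + 5) (h₂'' : k + 1 = m ∨ q.2 ≤ 2 * k + 2) :
    ∃ k < 2 * m + 2, q ∈ edge m k := by
  obtain ⟨-, e1, e2, e3, e4⟩ := (lower_edge hk).resolve_left (by omega)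
  refine mem_edge_of_le hm (by omega : k < 2 * m + 2) (Or.inl ⟨?_, ?_⟩) (Or.inl ⟨?_, ?_⟩)
  · rw [e1]; push_cast; linarith
  · rw [e2]; push_cast; linarith
  · rw [e3]; push_cast; linarith
  · rcases e4 with ⟨hk', e4⟩ | ⟨-, e4⟩ <;> rw [e4] <;> push_cast
    · exact h₂''.resolve_left hk'.ne
    · exact h₂'

theorem mem_last_odd (h : m % 2 = 1) (h₁ : q.1 = 2 * m + 2) (h₂ : 2 * m - 2 ≤ q.2)
    (h₂' : q.2 ≤ 2 * m + 1) : ∃ k < 2 * m + 2, q ∈ edge m k := by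
  have hm : 1 ≤ m := by omega
  obtain ⟨-, e1, e2, e3, e4⟩ := (last_edge hm).resolve_right (by omega)
  refine mem_edge_of_le hm (by omega : m < 2 * m + 2) (Or.inl ⟨?_, ?_⟩) (Or.inl ⟨?_, ?_⟩)
  · rw [e1]; push_cast; linarith
  · rw [e2]; push_cast; linarith
  · rw [e3]; push_cast; linarith
  · rw [e4]; push_cast; linarith

theorem mem_last_even (hm : 1 ≤ m) (h : m % 2 = 0) (h₂ : q.2 = 2 * m + 3) (h₁ : 2 * m - 3 ≤ q.1)
    (h₁' : q.1 ≤ 2 * m) : ∃ k < 2 * m + 2, q ∈ edge m k := by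
  obtain ⟨-, e1, e2, e3, e4⟩ := (last_edge hm).resolve_left (by omega)
  refine mem_edge_of_le hm (by omega : m < 2 * m + 2) (Or.inr ⟨?_, ?_⟩) (Or.inl ⟨?_, ?_⟩)
  · rw [e4]; push_cast; linarith
  · rw [e3]; push_cast; linarith
  · rw [e1]; push_cast; linarith
  · rw [e2]; push_cast; linarith

theorem mem_upper_even (hk : k < m) (h : k % 2 = 0) (h₂ : q.2 = 2 * k + 3)
    (h₁ : 2 * k - 3 ≤ q.1) (h₁' : q.1 ≤ 2 * k + 4) (h₁'' : k + 1 = m ∨ q.1 ≤ 2 * k + 1) :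
    ∃ k < 2 * m + 2, q ∈ edge m k := by
  obtain ⟨-, e1, e2, e3, e4⟩ :=
    (upper_edge hk (show 2 * m - k + k = 2 * m by omega)).resolve_right (by omega)
  refine mem_edge_of_le (k := 2 * m - k) (by omega) (by omega) (Or.inr ⟨?_, ?_⟩) (Or.inl ⟨?_, ?_⟩)
  · rw [e3]; push_cast; linarith
  · rcases e4 with ⟨hk', e4⟩ | ⟨-, e4⟩ <;> rw [e4] <;> push_cast
    · exact h₁''.resolve_left hk'.ne
    · exact h₁'
  · rw [e1]; push_cast; linarith
  · rw [e2]; push_cast; linarith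

theorem mem_upper_odd (hk : k < m) (h : k % 2 = 1) (h₁ : q.1 = 2 * k - 1)
    (h₂ : 2 * k + 1 ≤ q.2) (h₂' : q.2 ≤ 2 * k + 5) : ∃ k < 2 * m + 2, q ∈ edge m k := by
  obtain ⟨-, e1, e2, e3, e4⟩ :=
    (upper_edge hk (show 2 * m - k + k = 2 * m by omega)).resolve_left (by omega)
  refine mem_edge_of_le (k := 2 * m - k) (by omega) (by omega) (Or.inl ⟨?_, ?_⟩) (Or.inr ⟨?_, ?_⟩)
  · rw [e1]; push_cast; linarith
  · rw [e2]; push_cast; linarith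
  · rw [e4]; push_cast; linarith
  · rw [e3]; push_cast; linarith

theorem mem_first (hm : 1 ≤ m) (h₁ : q.1 = -3) (h₂ : 0 ≤ q.2) (h₂' : q.2 ≤ 3) :
    ∃ k < 2 * m + 2, q ∈ edge m k := by
  obtain ⟨e1, e2, e3, e4⟩ := first_edge hm
  refine mem_edge_of_le hm (by omega : 2 * m + 1 < 2 * m + 2) (Or.inl ⟨?_, ?_⟩) (Or.inr ⟨?_, ?_⟩)
  · rw [e1]; push_cast; linarith
  · rw [e2]; push_cast; linarith
  · rw [e4]; push_cast; linarith
  · rw [e3]; push_cast; linarith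

/-- The point lies on a side of its brick. On the bottom and top sides, the parts crossed by the
open neighbouring bricks (`n2`, `n1`) are excluded, and what remains is exactly one boundary edge.
The short left and right sides lie entirely in boundary edges. -/
theorem exists_edge_of_even (hm : 1 ≤ m) (hk : k < m) (h : k % 2 = 0) (hq : q ∈ brick k)
    (hn : q ∉ inner m) : ∃ k < 2 * m + 2, q ∈ edge m k := by
  rw [mem_brick_even h] at hq
  obtain ⟨⟨q1, q2⟩, q3, q4⟩ := hq
  rw [mem_inner] at hn
  push Not at hn
  have n0 := hn k hk
  rw [mem_openBrick_even h] at n0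
  have n1 : k + 1 < m → ¬ ((2 * k + 1 < q.1 ∧ q.1 < 2 * k + 4) ∧ 2 * k < q.2 ∧
      q.2 < 2 * k + 7) := by
    rintro hk1 ⟨⟨k1, k2⟩, k3, k4⟩
    refine hn (k + 1) hk1 ((mem_openBrick_odd (by omega)).2 ?_)
    push_cast
    refine ⟨⟨?_, ?_⟩, ?_, ?_⟩ <;> linarith
  have n2 : k ≠ 0 → ¬ ((2 * k - 3 < q.1 ∧ q.1 < 2 * k) ∧ 2 * k - 4 < q.2 ∧
      q.2 < 2 * k + 3) := by
    rintro hk1 ⟨⟨k1, k2⟩, k3, k4⟩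
    obtain ⟨l, rfl⟩ := Nat.exists_eq_succ_of_ne_zero hk1
    refine hn l (by omega) ((mem_openBrick_odd (by omega)).2 ?_)
    push_cast at k1 k2 k3 k4
    refine ⟨⟨?_, ?_⟩, ?_, ?_⟩ <;> linarith
  have hleft : q.1 = 2 * k - 3 → ∃ k < 2 * m + 2, q ∈ edge m k := by
    intro e
    rcases Nat.eq_zero_or_pos k with rfl | hk0
    · norm_num at e q3 q4
      exact mem_first hm e q3 q4
    · obtain ⟨l, rfl⟩ := Nat.exists_eq_succ_of_ne_zero hk0.ne'
      push_cast at e q3 q4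
      exact mem_upper_odd (k := l) (by omega) (by omega) (by linarith) (by linarith) (by linarith)
  have hright : q.1 = 2 * k + 4 → ∃ k < 2 * m + 2, q ∈ edge m k := by
    intro e
    rcases (Nat.succ_le_of_lt hk).eq_or_lt with rfl | hk1
    · refine mem_last_odd (by omega) ?_ ?_ ?_ <;> push_cast <;> linarith
    · refine mem_lower_odd (k := k + 1) hm hk1 (by omega) ?_ ?_ ?_ (Or.inr ?_) <;> push_cast <;>
        linarith
  rcases q1.eq_or_lt with e | q1
  · exact hleft e.symm
  rcases q2.eq_or_lt with e | q2
  · exact hright e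
  rcases q3.eq_or_lt with e | q3
  · refine mem_lower_even hm hk h e.symm ?_ q1.le q2.le
    by_contra hcon
    rw [not_or, not_le] at hcon
    exact n2 hcon.1 ⟨⟨q1, hcon.2⟩, by linarith, by linarith⟩
  rcases q4.eq_or_lt with e | q4
  · refine mem_upper_even hk h e q1.le q2.le ?_
    by_contra hcon
    rw [not_or, not_le] at hcon
    exact n1 (by omega) ⟨⟨hcon.2, q2⟩, by linarith, by linarith⟩
  exact absurd ⟨⟨q1, q2⟩, q3, q4⟩ n0

theorem exists_edge_of_odd (hm : 1 ≤ m) (hk : k < m) (h : k % 2 = 1) (hq : q ∈ brick k)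
    (hn : q ∉ inner m) : ∃ k < 2 * m + 2, q ∈ edge m k := by
  obtain ⟨l, rfl⟩ : ∃ l, k = l + 1 := ⟨k - 1, by omega⟩
  rw [mem_brick_odd h] at hq
  obtain ⟨⟨q1, q2⟩, q3, q4⟩ := hq
  rw [mem_inner] at hn
  push Not at hn
  have n0 := hn (l + 1) hk
  rw [mem_openBrick_odd h] at n0
  have n2 := hn l (by omega)
  rw [mem_openBrick_even (by omega)] at n2
  push_cast at n0 q1 q2 q3 q4
  have n1 : l + 2 < m → ¬ ((2 * l + 1 < q.1 ∧ q.1 < 2 * l + 8) ∧ 2 * l + 4 < q.2 ∧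
      q.2 < 2 * l + 7) := by
    rintro hk1 ⟨⟨k1, k2⟩, k3, k4⟩
    refine hn (l + 2) hk1 ((mem_openBrick_even (by omega)).2 ?_)
    push_cast
    refine ⟨⟨?_, ?_⟩, ?_, ?_⟩ <;> linarith
  rcases q3.eq_or_lt with e | q3
  · exact mem_lower_even (k := l) hm (by omega) (by omega) (by linarith) (Or.inr (by linarith))
      (by linarith) (by linarith)
  rcases q4.eq_or_lt with e | q4
  · rcases (Nat.succ_le_of_lt hk).eq_or_lt with rfl | hk1
    · refine mem_last_even hm (by omega) ?_ ?_ ?_ <;> push_cast <;> linarith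
    · refine mem_upper_even (k := l + 2) hk1 (by omega) ?_ ?_ ?_ (Or.inr ?_) <;> push_cast <;>
        linarith
  rcases q1.eq_or_lt with e | q1
  · refine mem_upper_odd (k := l + 1) hk h ?_ ?_ ?_ <;> push_cast
    · linarith
    · by_contra hcon
      exact n2 ⟨⟨by linarith, by linarith⟩, by linarith, by linarith⟩
    · linarith
  rcases q2.eq_or_lt with e | q2
  · refine mem_lower_odd (k := l + 1) hm hk h ?_ ?_ ?_ ?_ <;> push_cast
    · linarith
    · linarith
    · linarith
    · by_contra hcon
      rw [not_or, not_le] at hcon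
      exact n1 (by omega) ⟨⟨by linarith, by linarith⟩, by linarith, by linarith⟩
  exact absurd ⟨⟨q1, q2⟩, q3, q4⟩ n0

theorem exists_edge (hm : 1 ≤ m) (hq : q ∈ region m) (hn : q ∉ inner m) :
    ∃ k < 2 * m + 2, q ∈ edge m k := by
  obtain ⟨k, hk, hqk⟩ := mem_region.1 hq
  rcases Nat.mod_two_eq_zero_or_one k with h | h
  · exact exists_edge_of_even hm hk h hqk hn
  · exact exists_edge_of_odd hm hk h hqk hn

theorem interior_region (hm : 1 ≤ m) : interior (region m) = inner m := by
  refine subset_antisymm (fun q hq => ?_)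
    (interior_maximal (inner_subset_region m) (isOpen_inner m))
  by_contra hn
  obtain ⟨k, hk, hqk⟩ := exists_edge hm (interior_subset hq) hn
  exact notMem_interior_of_mem_edge hm hk hqk hq

theorem frontier_region (hm : 1 ≤ m) : frontier (region m) = (cycle m hm).curve := by
  rw [(isCompact_region m).isClosed.frontier_eq, curve_cycle]
  ext q
  rw [mem_iUnion₂, interior_region hm]
  constructor
  · rintro ⟨hq, hn⟩
    obtain ⟨k, hk, hqk⟩ := exists_edge hm hq hn
    exact ⟨k, hk, hqk⟩
  · rintro ⟨k, hk, hqk⟩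
    refine ⟨edge_subset_region hm hk hqk, ?_⟩
    rw [← interior_region hm]
    exact notMem_interior_of_mem_edge hm hk hqk

/-- The staircase with `m` bricks as an orthogonal polygon. -/
def polygon (m : ℕ) (hm : 1 ≤ m) : OrthogonalPolygon where
  numCycles := 1
  cycle _ := cycle m hm
  cycles_disjoint i j h := absurd (Subsingleton.elim i j) h
  region := region m
  isCompact_region := isCompact_region m
  closure_interior_region := by rw [interior_region hm, closure_inner]
  isConnected_interior := by
    rw [interior_region hm]
    exact isConnected_inner hm
  frontier_region := by rw [frontier_region hm, iUnion_const]

theorem numVertices_polygon (m : ℕ) (hm : 1 ≤ m) : (polygon m hm).numVertices = 2 * m + 2 := by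
  rw [OrthogonalPolygon.numVertices]
  exact Fin.sum_univ_one _

end Staircase

/-! ### The vertical segmentation of the staircase -/

namespace Staircase

variable {m k : ℕ}

/-- Indexing the vertex by `k + 1` avoids cyclic wrap-around when passing to its predecessor. -/
theorem isReflexVertex_pt (hm : 1 ≤ m) (hk : k + 1 < 2 * m + 2) {u v w : ℝ × ℝ}
    (hu : pt m k = u) (hv : pt m (k + 1) = v) (hw : pt m (next m (k + 1)) = w)
    (h : ∀ t : ℝ, 0 < t → v + t • (u - v) + t • (w - v) ∉ region m) :
    (polygon m hm).IsReflexVertex v := by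
  have hpred : (⟨k + 1, hk⟩ : Fin (2 * m + 1 + 1)) - 1 = ⟨k, by omega⟩ := by
    rw [sub_eq_iff_eq_add]
    apply Fin.ext
    rw [val_succ, next_eq_succ (by dsimp only; omega)]
  have e1 : pt m (((⟨k + 1, hk⟩ : Fin (2 * m + 1 + 1)) - 1 : Fin (2 * m + 1 + 1)) : ℕ) = u := by
    rw [hpred]
    exact hu
  have e2 : pt m (((⟨k + 1, hk⟩ : Fin (2 * m + 1 + 1)) + 1 : Fin (2 * m + 1 + 1)) : ℕ) = w := by
    rw [val_succ]
    exact hw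
  refine ⟨(0 : Fin 1), (⟨k + 1, hk⟩ : Fin (2 * m + 1 + 1)), hv, ?_⟩
  filter_upwards [self_mem_nhdsWithin] with t ht
  have := h t ht
  rw [← e1, ← e2] at this
  exact this

theorem isReflexVertex_lower (hm : 1 ≤ m) (h0 : 0 < k) (hk : k < m) (h : k % 2 = 0) :
    (polygon m hm).IsReflexVertex (2 * k, 2 * k) := by
  obtain ⟨l, rfl⟩ : ∃ l, k = l + 1 := ⟨k - 1, by omega⟩
  obtain ⟨-, e1, e2, e3, e4⟩ := (lower_edge (show l < m by omega)).resolve_left (by omega)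
  obtain ⟨-, f1, f2, f3, f4⟩ := (lower_edge hk).resolve_right (by omega)
  rw [next_eq_succ (by omega)] at e2 e4
  refine isReflexVertex_pt hm (k := l) (by omega) (u := (2 * (l + 1), 2 * (l + 1) - 4))
    (w := (2 * (l + 1) + 4, 2 * (l + 1))) ?_ ?_ ?_ ?_
  · ext <;> simp only [pt, e1, e3] <;> push_cast <;> ring
  · ext <;> simp only [pt, e2, f1] <;> push_cast <;> ring
  · ext <;> simp only [pt, f2, f3] <;> push_cast <;> ring
  · intro t ht hmem
    obtain ⟨b, hb, hmem⟩ := mem_region.1 hmem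
    rcases Nat.mod_two_eq_zero_or_one b with hb' | hb'
    · rw [mem_brick_even hb'] at hmem
      simp at hmem
      rcases lt_or_ge b (l + 1) with hlt | hge
      · have : (b : ℝ) + 2 ≤ l + 1 := by exact_mod_cast (show b + 2 ≤ l + 1 by omega)
        linarith [hmem.1.2]
      · have : (l : ℝ) + 1 ≤ b := by exact_mod_cast hge
        linarith [hmem.2.1]
    · rw [mem_brick_odd hb'] at hmem
      simp at hmem
      rcases lt_or_ge b (l + 1) with hlt | hge
      · have : (b : ℝ) + 1 ≤ l + 1 := by exact_mod_cast (show b + 1 ≤ l + 1 by omega)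
        linarith [hmem.1.2]
      · have : (l : ℝ) + 2 ≤ b := by exact_mod_cast (show l + 2 ≤ b by omega)
        linarith [hmem.2.1]

theorem isReflexVertex_upper (hm : 1 ≤ m) (hk : k + 1 < m) (h : k % 2 = 0) :
    (polygon m hm).IsReflexVertex (2 * k + 1, 2 * k + 3) := by
  have hk0 : k < m := by omega
  have i1 : 2 * m - (k + 1) + (k + 1) = 2 * m := by omega
  have i2 : 2 * m - (k + 1) + 1 + k = 2 * m := by omega
  obtain ⟨-, e1, e2, e3, e4⟩ := (upper_edge hk i1).resolve_left (by omega)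
  obtain ⟨-, f1, f2, f3, f4⟩ := (upper_edge hk0 i2).resolve_right (by omega)
  rw [next_eq_succ (by omega)] at e2 e4
  refine isReflexVertex_pt hm (k := 2 * m - (k + 1)) (by omega) (u := (2 * k + 1, 2 * k + 7))
    (w := (2 * k - 3, 2 * k + 3)) ?_ ?_ ?_ ?_
  · ext <;> simp only [pt, e1, e3] <;> push_cast <;> ring
  · ext <;> simp only [pt, e2, f1] <;> push_cast <;> ring
  · ext <;> simp only [pt, f2, f3] <;> push_cast <;> ring
  · intro t ht hmem
    obtain ⟨b, hb, hmem⟩ := mem_region.1 hmem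
    rcases Nat.mod_two_eq_zero_or_one b with hb' | hb'
    · rw [mem_brick_even hb'] at hmem
      simp at hmem
      rcases lt_or_ge b (k + 1) with hlt | hge
      · have : (b : ℝ) ≤ k := by exact_mod_cast (show b ≤ k by omega)
        linarith [hmem.2.2]
      · have : (k : ℝ) + 2 ≤ b := by exact_mod_cast (show k + 2 ≤ b by omega)
        linarith [hmem.1.1]
    · rw [mem_brick_odd hb'] at hmem
      simp at hmem
      rcases lt_or_ge b (k + 1) with hlt | hge
      · have : (b : ℝ) + 1 ≤ k := by exact_mod_cast (show b + 1 ≤ k by omega)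
        linarith [hmem.2.2]
      · have : (k : ℝ) + 1 ≤ b := by exact_mod_cast hge
        linarith [hmem.1.1]

theorem interior_polygon (hm : 1 ≤ m) : interior (polygon m hm).region = inner m :=
  interior_region hm

theorem mem_cuts_lower (hm : 1 ≤ m) (h0 : 0 < k) (hk : k < m) (h : k % 2 = 0) {q : ℝ × ℝ}
    (hq : q ∈ openBrick k) (hq₁ : q.1 = 2 * k) : q ∈ (polygon m hm).cuts Prod.fst := by
  refine ⟨?_, _, isReflexVertex_lower hm h0 hk h, hq₁.symm, fun z hz => ?_⟩
  · rw [interior_polygon]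
    exact mem_inner.2 ⟨k, hk, hq⟩
  · rw [interior_polygon]
    refine mem_inner.2 ⟨k, hk, ?_⟩
    rw [mem_openBrick_even h] at hq ⊢
    rw [← Prod.mk.eta (p := q), hq₁, mem_openSegment_vertical hq.2.1.ne, uIoo_of_le hq.2.1.le] at hz
    obtain ⟨z1, z2, z3⟩ := hz
    refine ⟨⟨?_, ?_⟩, ?_, ?_⟩ <;> linarith [hq.2.2]

theorem mem_cuts_upper (hm : 1 ≤ m) (hk : k + 1 < m) (h : k % 2 = 0) {q : ℝ × ℝ}
    (hq : q ∈ openBrick k) (hq₁ : q.1 = 2 * k + 1) : q ∈ (polygon m hm).cuts Prod.fst := by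
  refine ⟨?_, _, isReflexVertex_upper hm hk h, hq₁.symm, fun z hz => ?_⟩
  · rw [interior_polygon]
    exact mem_inner.2 ⟨k, by omega, hq⟩
  · rw [interior_polygon]
    refine mem_inner.2 ⟨k, by omega, ?_⟩
    rw [mem_openBrick_even h] at hq ⊢
    rw [← Prod.mk.eta (p := q), hq₁, mem_openSegment_vertical hq.2.2.ne', uIoo_of_ge hq.2.2.le] at hz
    obtain ⟨z1, z2, z3⟩ := hz
    refine ⟨⟨?_, ?_⟩, ?_, ?_⟩ <;> linarith [hq.2.1]

/-- The left end of the slice `i`, which is the right end of the slice `i - 1`. -/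
def brk (m i : ℕ) : ℤ :=
  if i = 0 then -3 else if i = m ∧ m % 2 = 1 then 2 * m + 2
  else if i % 2 = 0 then 2 * i else 2 * i - 1

theorem brk_spec {i : ℕ} (hi : i < m) :
    (i % 2 = 0 ∧ (i = 0 ∧ brk m i = -3 ∨ 0 < i ∧ brk m i = 2 * i) ∧
      (i + 1 = m ∧ brk m (i + 1) = 2 * i + 4 ∨ i + 1 < m ∧ brk m (i + 1) = 2 * i + 1)) ∨
    (i % 2 = 1 ∧ brk m i = 2 * i - 1 ∧ brk m (i + 1) = 2 * i + 2) := by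
  rcases Nat.mod_two_eq_zero_or_one i with h | h
  · refine Or.inl ⟨h, ?_, ?_⟩ <;> unfold brk <;> split_ifs <;> first | contradiction | omega
  · refine Or.inr ⟨h, ?_, ?_⟩ <;> unfold brk <;> split_ifs <;> first | contradiction | omega

theorem brk_lt {i : ℕ} (hi : i < m) : brk m i < brk m (i + 1) := by
  have := brk_spec hi
  omega

theorem brk_succ_le {i j : ℕ} (hij : i < j) (hj : j < m) : brk m (i + 1) ≤ brk m j := by
  have h1 := brk_spec (hij.trans hj)
  have h2 := brk_spec hj
  omega

theorem brk_succ_lt {i j : ℕ} (hij : i + 1 < j) (hj : j < m) : brk m (i + 1) < brk m j := by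
  have h1 := brk_spec (show i < m by omega)
  have h2 := brk_spec hj
  omega

/-- Every cut has the first coordinate of a vertex, so no cut passes through an open slice. -/
theorem X_notMem_Ioo {i : ℕ} (hm : 1 ≤ m) (hi : i < m) (hk : k < 2 * m + 2) :
    X m k ≤ brk m i ∨ brk m (i + 1) ≤ X m k := by
  have h1 := brk_spec hi
  rcases index_cases hk with h | rfl | ⟨j, hj, h⟩ | rfl
  · rcases lower_edge h with h' | h' <;> omega
  · rcases last_edge hm with h' | h' <;> omega
  · rcases upper_edge hj h with h' | h' <;> omega
  · have := (first_edge hm).1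
    omega

theorem brk_bounds {i : ℕ} (hi : i < m) : left i ≤ brk m i ∧ brk m (i + 1) ≤ right i := by
  have h1 := brk_spec hi
  unfold left right
  split_ifs <;> omega

/-- The interior of the slice `i`. -/
def openSlice (m i : ℕ) : Set (ℝ × ℝ) :=
  Ioo (brk m i : ℝ) (brk m (i + 1)) ×ˢ Ioo (bottom i : ℝ) (top i)

/-- The slice `i`. -/
def slice (m i : ℕ) : Set (ℝ × ℝ) :=
  Icc (brk m i : ℝ) (brk m (i + 1)) ×ˢ Icc (bottom i : ℝ) (top i)

theorem closure_openSlice {i : ℕ} (hi : i < m) : closure (openSlice m i) = slice m i := by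
  have h1 : (brk m i : ℝ) ≠ brk m (i + 1) := by exact_mod_cast (brk_lt hi).ne
  have h2 : (bottom i : ℝ) ≠ top i := by exact_mod_cast (bottom_lt_top i).ne
  rw [openSlice, closure_prod_eq, closure_Ioo h1, closure_Ioo h2, slice]

theorem openSlice_subset (hm : 1 ≤ m) {i : ℕ} (hi : i < m) :
    openSlice m i ⊆ interior (polygon m hm).region \ (polygon m hm).cuts Prod.fst := by
  rintro q ⟨⟨q1, q2⟩, q3⟩
  refine ⟨?_, ?_⟩
  · rw [interior_polygon]
    obtain ⟨h1, h2⟩ := brk_bounds hi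
    have h1' : (left i : ℝ) ≤ brk m i := Int.cast_le.2 h1
    have h2' : (brk m (i + 1) : ℝ) ≤ right i := Int.cast_le.2 h2
    exact mem_inner.2 ⟨i, hi, ⟨by linarith, by linarith⟩, q3⟩
  · rintro ⟨-, v, ⟨c, l, hl, -⟩, hvq, -⟩
    have hX : q.1 = X m (l : Fin (2 * m + 1 + 1)) := by
      rw [← hvq, ← hl]
      rfl
    rw [hX] at q1 q2
    have q1' := Int.cast_lt.1 q1
    have q2' := Int.cast_lt.1 q2
    have := X_notMem_Ioo hm hi (k := (l : Fin (2 * m + 1 + 1))) (l : Fin (2 * m + 1 + 1)).2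
    omega

/-- Vertical bricks are slices, up to the extent of the brick at the ends of the staircase. A
horizontal brick is cut at `2k` and `2k + 1` where it has neighbours: its outer parts belong to the
neighbouring vertical bricks, and the middle is a slice of its own. -/
theorem exists_openSlice (hm : 1 ≤ m) {q : ℝ × ℝ}
    (hq : q ∈ interior (polygon m hm).region \ (polygon m hm).cuts Prod.fst) :
    ∃ i < m, q ∈ openSlice m i := by
  obtain ⟨hq, hc⟩ := hq
  rw [interior_polygon] at hq
  obtain ⟨k, hk, hqk⟩ := mem_inner.1 hq
  have hqk' := hqk
  rcases Nat.mod_two_eq_zero_or_one k with h | h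
  · rw [mem_openBrick_even h] at hqk
    obtain ⟨⟨q1, q2⟩, q3, q4⟩ := hqk
    have e := (brk_spec hk).resolve_right (by omega)
    by_cases c1 : 0 < k ∧ q.1 ≤ 2 * k
    · rcases c1.2.eq_or_lt with c2 | c2
      · exact absurd (mem_cuts_lower hm c1.1 hk h hqk' c2) hc
      · obtain ⟨l, rfl⟩ : ∃ l, k = l + 1 := ⟨k - 1, by omega⟩
        obtain ⟨-, e1, e2⟩ := (brk_spec (show l < m by omega)).resolve_left (by omega)
        refine ⟨l, by omega, ?_⟩
        push_cast at q1 q2 q3 q4 c2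
        simp only [openSlice, e1, e2, bottom, top, mem_prod, mem_Ioo, show l % 2 = 1 by omega,
          one_ne_zero, if_false]
        push_cast
        refine ⟨⟨?_, ?_⟩, ?_, ?_⟩ <;> linarith
    by_cases c3 : k + 1 < m ∧ 2 * k + 1 ≤ q.1
    · rcases c3.2.eq_or_lt with c4 | c4
      · exact absurd (mem_cuts_upper hm c3.1 h hqk' c4.symm) hc
      · obtain ⟨-, e1, e2⟩ := (brk_spec c3.1).resolve_left (by omega)
        refine ⟨k + 1, c3.1, ?_⟩
        simp only [openSlice, e1, e2, bottom, top, mem_prod, mem_Ioo, show (k + 1) % 2 = 1 by omega,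
          one_ne_zero, if_false]
        push_cast
        refine ⟨⟨?_, ?_⟩, ?_, ?_⟩ <;> linarith
    refine ⟨k, hk, ⟨?_, ?_⟩, ?_⟩
    · rcases e.2.1 with ⟨rfl, e⟩ | ⟨h0, e⟩ <;> rw [e] <;> push_cast
      · simpa using q1
      · by_contra hcon
        exact c1 ⟨h0, not_lt.1 hcon⟩
    · rcases e.2.2 with ⟨-, e⟩ | ⟨h0, e⟩ <;> rw [e] <;> push_cast
      · exact q2
      · by_contra hcon
        exact c3 ⟨h0, not_lt.1 hcon⟩
    · simp only [bottom, top, h, if_true, mem_Ioo]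
      push_cast
      exact ⟨q3, q4⟩
  · obtain ⟨-, e1, e2⟩ := (brk_spec hk).resolve_left (by omega)
    refine ⟨k, hk, ?_, hqk.2⟩
    rw [mem_openBrick_odd h] at hqk'
    rw [e1, e2]
    push_cast
    exact hqk'.1

theorem openSlice_disjoint {i j : ℕ} (hi : i < m) (hj : j < m) (hij : i ≠ j) :
    Disjoint (openSlice m i) (openSlice m j) := by
  have key : ∀ {i j : ℕ}, i < j → j < m → Disjoint (openSlice m i) (openSlice m j) := by
    intro i j hij hj
    rw [Set.disjoint_left]
    rintro q ⟨⟨-, h1⟩, -⟩ ⟨⟨h2, -⟩, -⟩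
    have : (brk m (i + 1) : ℝ) ≤ brk m j := Int.cast_le.2 (brk_succ_le hij hj)
    linarith
  rcases lt_or_gt_of_ne hij with h | h
  · exact key h hj
  · exact (key h hi).symm

/-- The open slices are open, connected and pairwise disjoint, and they cover the interior without
the cuts, so they are its components. -/
theorem connectedComponentIn_eq_openSlice (hm : 1 ≤ m) {i : ℕ} (hi : i < m) {q : ℝ × ℝ}
    (hq : q ∈ openSlice m i) :
    connectedComponentIn (interior (polygon m hm).region \ (polygon m hm).cuts Prod.fst) q =
      openSlice m i := by
  have hF := openSlice_subset hm hi hq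
  refine subset_antisymm ?_ (IsPreconnected.subset_connectedComponentIn
    (isPreconnected_Ioo.prod isPreconnected_Ioo) hq (openSlice_subset hm hi))
  refine isPreconnected_connectedComponentIn.subset_left_of_subset_union
    (v := ⋃ j ∈ Iio m \ {i}, openSlice m j) (isOpen_Ioo.prod isOpen_Ioo)
    (isOpen_biUnion fun _ _ => isOpen_Ioo.prod isOpen_Ioo) ?_ ?_ ⟨q, mem_connectedComponentIn hF, hq⟩
  · rw [disjoint_iUnion₂_right]
    rintro j ⟨hj, hji⟩
    exact openSlice_disjoint hi hj (Ne.symm hji)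
  · intro z hz
    obtain ⟨j, hj, hzj⟩ := exists_openSlice hm (connectedComponentIn_subset _ _ hz)
    by_cases hji : j = i
    · exact Or.inl (hji ▸ hzj)
    · exact Or.inr (mem_iUnion₂.2 ⟨j, ⟨hj, hji⟩, hzj⟩)

theorem nonempty_openSlice {i : ℕ} (hi : i < m) : (openSlice m i).Nonempty := by
  have h1 : (brk m i : ℝ) < brk m (i + 1) := Int.cast_lt.2 (brk_lt hi)
  have h2 : (bottom i : ℝ) < top i := Int.cast_lt.2 (bottom_lt_top i)
  exact (nonempty_Ioo.2 h1).prod (nonempty_Ioo.2 h2)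

theorem mem_slices_iff (hm : 1 ≤ m) {s : Set (ℝ × ℝ)} :
    s ∈ (polygon m hm).slices Prod.fst ↔ ∃ i < m, slice m i = s := by
  constructor
  · rintro ⟨p, hp, rfl⟩
    obtain ⟨i, hi, hpi⟩ := exists_openSlice hm hp
    exact ⟨i, hi, by rw [connectedComponentIn_eq_openSlice hm hi hpi, closure_openSlice hi]⟩
  · rintro ⟨i, hi, rfl⟩
    obtain ⟨p, hp⟩ := nonempty_openSlice hi
    exact ⟨p, openSlice_subset hm hi hp,
      by rw [connectedComponentIn_eq_openSlice hm hi hp, closure_openSlice hi]⟩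

theorem slice_injective {i j : ℕ} (hi : i < m) (hj : j < m) (h : slice m i = slice m j) :
    i = j := by
  have key : ∀ {i : ℕ}, i < m → (brk m i : ℝ) ≤ brk m (i + 1) ∧ (bottom i : ℝ) ≤ top i :=
    fun hi => ⟨Int.cast_le.2 (brk_lt hi).le, Int.cast_le.2 (bottom_lt_top _).le⟩
  have h' := OrthogonalPolygon.eq_of_Icc_prod_eq (key hi).1 (key hi).2 (key hj).1 (key hj).2 h
  have h1 : brk m i = brk m j := Int.cast_injective h'.1
  have h2 := brk_lt hi
  have h3 := brk_lt hj
  rcases lt_trichotomy i j with h | h | h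
  · have := brk_succ_le h hj
    omega
  · exact h
  · have := brk_succ_le h hi
    omega

theorem exists_segment_of_consecutive {i : ℕ} (hi : i + 1 < m) :
    ∃ a b : ℝ × ℝ, a ≠ b ∧ segment ℝ a b ⊆ slice m i ∩ slice m (i + 1) := by
  have hlt : max (bottom i) (bottom (i + 1)) < min (top i) (top (i + 1)) := by
    unfold bottom top
    split_ifs <;> omega
  have h1 : (brk m i : ℝ) ≤ brk m (i + 1) := Int.cast_le.2 (brk_lt (by omega)).le
  have h2 : (brk m (i + 1) : ℝ) ≤ brk m (i + 1 + 1) := Int.cast_le.2 (brk_lt hi).le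
  have hlt' : max (bottom i : ℝ) (bottom (i + 1)) < min (top i : ℝ) (top (i + 1)) := by
    exact_mod_cast hlt
  refine ⟨(brk m (i + 1), max (bottom i : ℝ) (bottom (i + 1))),
    (brk m (i + 1), min (top i : ℝ) (top (i + 1))), fun h => hlt'.ne (congrArg Prod.snd h), ?_⟩
  intro q hq
  rw [mem_segment_vertical, uIcc_of_le hlt'.le] at hq
  obtain ⟨q1, q2, q3⟩ := hq
  rw [max_le_iff] at q2
  rw [le_min_iff] at q3
  exact ⟨⟨⟨by linarith, by linarith⟩, q2.1, q3.1⟩, ⟨by linarith, by linarith⟩, q2.2, q3.2⟩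

theorem hasPathSegmentation (hm : 1 ≤ m) : (polygon m hm).HasPathSegmentation := by
  let f : Fin m → {s // s ∈ (polygon m hm).slices Prod.fst} :=
    fun i => ⟨slice m i, (mem_slices_iff hm).2 ⟨i, i.2, rfl⟩⟩
  have hf : Function.Bijective f := by
    refine ⟨fun i j h => Fin.ext (slice_injective i.2 j.2 (congrArg Subtype.val h)), ?_⟩
    rintro ⟨s, hs⟩
    obtain ⟨i, hi, rfl⟩ := (mem_slices_iff hm).1 hs
    exact ⟨⟨i, hi⟩, rfl⟩
  have key : ∀ i j : Fin m, i < j →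
      ((∃ a b : ℝ × ℝ, a ≠ b ∧ segment ℝ a b ⊆ slice m i ∩ slice m j) ↔ (i : ℕ) + 1 = j) := by
    intro i j hij
    constructor
    · rintro ⟨a, b, -, h⟩
      by_contra hne
      have hlt : (i : ℕ) + 1 < j := lt_of_le_of_ne hij hne
      -- A whole slice lies strictly between them, so they do not even share a point.
      have h1 : (brk m (i + 1) : ℝ) < brk m j := Int.cast_lt.2 (brk_succ_lt hlt j.2)
      obtain ⟨h2, h3⟩ := h (left_mem_segment _ _ _)
      linarith [h2.1.2, h3.1.1]
    · intro h
      have := exists_segment_of_consecutive (m := m) (i := i) (by omega)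
      rwa [h] at this
  have hadj : ∀ i j : Fin m, ((polygon m hm).weakDual Prod.fst).Adj (f i) (f j) ↔
      (SimpleGraph.pathGraph m).Adj i j := by
    intro i j
    rw [SimpleGraph.pathGraph_adj]
    change f i ≠ f j ∧ (∃ a b : ℝ × ℝ, a ≠ b ∧ segment ℝ a b ⊆ slice m i ∩ slice m j) ↔ _
    rw [hf.1.ne_iff]
    rcases lt_trichotomy i j with h | rfl | h
    · rw [key i j h]
      have : (i : ℕ) < j := h
      exact ⟨fun h' => Or.inl h'.2, fun h' => ⟨h.ne, by omega⟩⟩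
    · simp
    · rw [inter_comm, key j i h]
      have : (j : ℕ) < i := h
      exact ⟨fun h' => Or.inr h'.2, fun h' => ⟨h.ne', by omega⟩⟩
  let e : SimpleGraph.pathGraph m ≃g (polygon m hm).weakDual Prod.fst :=
    ⟨Equiv.ofBijective f hf, fun {i j} => hadj i j⟩
  exact Or.inl ⟨m, ⟨e.symm⟩⟩

/-! ### Witness points and the lower bound -/

/-- A point in the slice `i`; no camera sees two witnesses with indices at distance at least 3. -/
noncomputable def witness (i : ℕ) : ℝ × ℝ := (2 * i + 1 / 2, 2 * i + 3 / 2)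

theorem witness_mem_region {i : ℕ} (hi : i < m) : witness i ∈ region m := by
  refine mem_region.2 ⟨i, hi, ?_⟩
  rcases Nat.mod_two_eq_zero_or_one i with h | h
  · rw [mem_brick_even h]
    refine ⟨⟨?_, ?_⟩, ?_, ?_⟩ <;> simp only [witness] <;> linarith
  · rw [mem_brick_odd h]
    refine ⟨⟨?_, ?_⟩, ?_, ?_⟩ <;> simp only [witness] <;> linarith

end Staircase

namespace Staircase

variable {m i j : ℕ}

theorem abs_le_one_of_lt {a b : ℕ} (h1 : (a : ℝ) < b + 2) (h2 : (b : ℝ) < a + 2) :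
    a ≤ b + 1 ∧ b ≤ a + 1 := by
  have h1' : a < b + 2 := by exact_mod_cast h1
  have h2' : b < a + 2 := by exact_mod_cast h2
  omega

/-- The horizontal line through the witness stays within the columns of brick `i`. For odd `i` it
misses the horizontal bricks above and below, which leaves only the narrow range. In `snd_bounds`
the parities exchange roles. -/
theorem fst_bounds {h : ℝ} (hmem : (h, (witness i).2) ∈ region m) :
    (2 * i - 3 ≤ h ∧ h ≤ 2 * i + 4) ∧ (i % 2 = 1 → 2 * i - 1 ≤ h ∧ h ≤ 2 * i + 2) := by
  obtain ⟨b, -, hb⟩ := mem_region.1 hmem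
  rcases Nat.mod_two_eq_zero_or_one b with hb' | hb'
  · rw [mem_brick_even hb'] at hb
    simp only [witness] at hb
    obtain ⟨⟨h1, h2⟩, h3, h4⟩ := hb
    obtain ⟨h5, h6⟩ := abs_le_one_of_lt (a := b) (b := i) (by linarith) (by linarith)
    obtain rfl : b = i := by
      rcases lt_trichotomy b i with hlt | heq | hlt
      · have : (b : ℝ) + 1 ≤ i := by exact_mod_cast hlt
        linarith
      · exact heq
      · have : (i : ℝ) + 1 ≤ b := by exact_mod_cast hlt
        linarith
    exact ⟨⟨h1, h2⟩, fun h => by omega⟩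
  · rw [mem_brick_odd hb'] at hb
    simp only [witness] at hb
    obtain ⟨⟨h1, h2⟩, h3, h4⟩ := hb
    obtain ⟨h5, h6⟩ := abs_le_one_of_lt (a := b) (b := i) (by linarith) (by linarith)
    have h5' : (b : ℝ) ≤ i + 1 := by exact_mod_cast h5
    have h6' : (i : ℝ) ≤ b + 1 := by exact_mod_cast h6
    refine ⟨⟨by linarith, by linarith⟩, fun h => ?_⟩
    obtain rfl : b = i := by omega
    exact ⟨h1, h2⟩

theorem snd_bounds {h : ℝ} (hmem : ((witness i).1, h) ∈ region m) :
    (2 * i - 2 ≤ h ∧ h ≤ 2 * i + 5) ∧ (i % 2 = 0 → 2 * i ≤ h ∧ h ≤ 2 * i + 3) := by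
  obtain ⟨b, -, hb⟩ := mem_region.1 hmem
  rcases Nat.mod_two_eq_zero_or_one b with hb' | hb'
  · rw [mem_brick_even hb'] at hb
    simp only [witness] at hb
    obtain ⟨⟨h1, h2⟩, h3, h4⟩ := hb
    obtain ⟨h5, h6⟩ := abs_le_one_of_lt (a := b) (b := i) (by linarith) (by linarith)
    have h5' : (b : ℝ) ≤ i + 1 := by exact_mod_cast h5
    have h6' : (i : ℝ) ≤ b + 1 := by exact_mod_cast h6
    refine ⟨⟨by linarith, by linarith⟩, fun h => ?_⟩
    obtain rfl : b = i := by omega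
    exact ⟨h3, h4⟩
  · rw [mem_brick_odd hb'] at hb
    simp only [witness] at hb
    obtain ⟨⟨h1, h2⟩, h3, h4⟩ := hb
    obtain ⟨h5, h6⟩ := abs_le_one_of_lt (a := b) (b := i) (by linarith) (by linarith)
    obtain rfl : b = i := by
      rcases lt_trichotomy b i with hlt | heq | hlt
      · have : (b : ℝ) + 1 ≤ i := by exact_mod_cast hlt
        linarith
      · exact heq
      · have : (i : ℝ) + 1 ≤ b := by exact_mod_cast hlt
        linarith
    exact ⟨⟨h3, h4⟩, fun h => by omega⟩

/-- Indices at distance 3 have opposite parity, so one of the two ranges is the narrow one and they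
are disjoint. From distance 4 on, even two wide ranges are disjoint. -/
theorem notMem_region_of_fst_le (hij : i + 3 ≤ j) {h : ℝ} (hi : (h, (witness i).2) ∈ region m) :
    (h, (witness j).2) ∉ region m := by
  intro hj
  obtain ⟨⟨-, h1⟩, h2⟩ := fst_bounds hi
  obtain ⟨⟨h3, -⟩, h4⟩ := fst_bounds hj
  rcases Nat.eq_or_lt_of_le hij with heq | hlt
  · have hcast : (i : ℝ) + 3 = j := by exact_mod_cast heq
    rcases Nat.mod_two_eq_zero_or_one i with hi' | hi'
    · linarith [(h4 (by omega)).1]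
    · linarith [(h2 hi').2]
  · have hcast : (i : ℝ) + 4 ≤ j := by exact_mod_cast hlt
    linarith

theorem notMem_region_of_snd_le (hij : i + 3 ≤ j) {h : ℝ} (hi : ((witness i).1, h) ∈ region m) :
    ((witness j).1, h) ∉ region m := by
  intro hj
  obtain ⟨⟨-, h1⟩, h2⟩ := snd_bounds hi
  obtain ⟨⟨h3, -⟩, h4⟩ := snd_bounds hj
  rcases Nat.eq_or_lt_of_le hij with heq | hlt
  · have hcast : (i : ℝ) + 3 = j := by exact_mod_cast heq
    rcases Nat.mod_two_eq_zero_or_one i with hi' | hi'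
    · linarith [(h2 hi').2]
    · linarith [(h4 (by omega)).1]
  · have hcast : (i : ℝ) + 4 ≤ j := by exact_mod_cast hlt
    linarith

end Staircase

namespace OrthogonalPolygon

/-- The foot of the perpendicular from `p` lies on the camera, hence in the polygon. This weaker
condition, which forgets the extent of the camera and the line of sight, already suffices for the
lower bound. -/
theorem SlidingCamera.Sees.mem_region_of_fst_eq {P : OrthogonalPolygon} {γ : P.SlidingCamera}
    {p : ℝ × ℝ} (hp : γ.Sees p) (h : γ.a.1 = γ.b.1) : (γ.a.1, p.2) ∈ P.region := by
  obtain ⟨g, hg, horth, hsub⟩ := hp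
  have hne : γ.a.2 ≠ γ.b.2 := fun h' => γ.ne (Prod.ext h h')
  rw [mem_segment_of_fst_eq h] at hg
  rw [← h, sub_self, zero_mul, zero_add, mul_eq_zero] at horth
  have h2 : g.2 = p.2 := sub_eq_zero.1 (horth.resolve_left (sub_ne_zero.2 hne.symm))
  have : g = (γ.a.1, p.2) := Prod.ext hg.1 h2
  exact this ▸ hsub (right_mem_segment _ _ _)

theorem SlidingCamera.Sees.mem_region_of_snd_eq {P : OrthogonalPolygon} {γ : P.SlidingCamera}
    {p : ℝ × ℝ} (hp : γ.Sees p) (h : γ.a.2 = γ.b.2) : (p.1, γ.a.2) ∈ P.region := by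
  obtain ⟨g, hg, horth, hsub⟩ := hp
  have hne : γ.a.1 ≠ γ.b.1 := fun h' => γ.ne (Prod.ext h' h)
  rw [mem_segment_of_snd_eq h] at hg
  rw [← h, sub_self, zero_mul, add_zero, mul_eq_zero] at horth
  have h2 : g.1 = p.1 := sub_eq_zero.1 (horth.resolve_left (sub_ne_zero.2 hne.symm))
  have : g = (p.1, γ.a.2) := Prod.ext h2 hg.1
  exact this ▸ hsub (right_mem_segment _ _ _)

end OrthogonalPolygon

namespace Staircase

theorem not_sees {m i j : ℕ} (hm : 1 ≤ m) (γ : (polygon m hm).SlidingCamera) (hij : i + 3 ≤ j)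
    (hi : γ.Sees (witness i)) : ¬ γ.Sees (witness j) := by
  intro hj
  rcases γ.axisParallel with h | h
  · exact notMem_region_of_fst_le (m := m) hij (hi.mem_region_of_fst_eq h) (hj.mem_region_of_fst_eq h)
  · exact notMem_region_of_snd_le (m := m) hij (hi.mem_region_of_snd_eq h) (hj.mem_region_of_snd_eq h)

theorem not_guardableWith {m k : ℕ} (hm : 1 ≤ m) (hk : k < (m + 2) / 3) :
    ¬ (polygon m hm).GuardableWith k := by
  rintro ⟨S, hS, hguard⟩
  have hlt : ∀ t ∈ Finset.range ((m + 2) / 3), 3 * t < m := by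
    intro t ht
    have := Finset.mem_range.1 ht
    omega
  -- Choosing a camera as a total function of the index needs a default camera; any camera seeing
  -- the first witness will do.
  have : Nonempty (polygon m hm).SlidingCamera :=
    ⟨(hguard (witness 0) (witness_mem_region hm)).choose⟩
  choose! f hfS hf using fun t ht => hguard (witness (3 * t)) (witness_mem_region (hlt t ht))
  obtain ⟨s, hs, t, ht, hst, heq⟩ := Finset.exists_ne_map_eq_of_card_lt_of_maps_to
    -- By the pigeonhole principle one camera is chosen for two witnesses, whose indices are
    -- distinct multiples of 3.
    (by rw [Finset.card_range]; omega : S.card < (Finset.range ((m + 2) / 3)).card) hfS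
  rcases hst.lt_or_gt with h | h
  · exact not_sees hm (f s) (by omega) (hf s hs) (heq ▸ hf t ht)
  · exact not_sees hm (f t) (by omega) (hf t ht) (heq ▸ hf s hs)

end Staircase
theorem mainTheorem8 :
    (∀ (n : ℕ) (P : OrthogonalPolygon), P.numVertices = n → P.HasPathSegmentation →
      P.GuardableWith ((n + 2) / 6)) ∧
    (∀ n : ℕ, 4 ≤ n → Even n →
      ∃ P : OrthogonalPolygon, P.numVertices = n ∧ P.HasPathSegmentation ∧
        ∀ k : ℕ, k < (n + 2) / 6 → ¬ P.GuardableWith k) := by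
  refine ⟨?_, ?_⟩
  · rintro _ P rfl h
    exact h.guardableWith
  · intro n hn heven
    obtain ⟨m, rfl⟩ := heven
    -- Here `n = 2l + 2`, which is the number of vertices of the staircase with `l` bricks, and `(n
    -- + 2) / 6 = (l + 2) / 3`.
    obtain ⟨l, rfl⟩ : ∃ l, m = l + 1 := ⟨m - 1, by omega⟩
    have hl : 1 ≤ l := by omega
    refine ⟨Staircase.polygon l hl, ?_, Staircase.hasPathSegmentation hl, fun k hk => ?_⟩
    · rw [Staircase.numVertices_polygon]
      omega
    · exact Staircase.not_guardableWith hl (by omega)
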